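/- **Theorem.** Let $\mathbb R^*=\mathbb R\setminus\{0\}$ and $\mathbb R^*_+=(0,\infty)$, both as multiplicative groups. For every Borel probability measure $\kappa$ on $\mathbb R^*_+$ there are an infinite $\sigma$-finite standard Borel measure space $(Z,\nu)$, an ergodic conservative $\nu$-preserving measurable flow $V=(V_t)_{t\in\mathbb R}$ on it, and a finite measure $\sigma$ of the maximal spectral type of $V$ on $L^2(Z,\nu)$, such that the images $\sigma_s$ of $\sigma$ under the maps $\mathbb R\ni x\mapsto sx$ $(s>0)$ satisfy $\sigma_s\perp\sigma_{s'}$ whenever $s\ne s'$, and such that the following holds. Let $T=(T_t)_{t\in\mathbb R}$ be the measure preserving flow $$T_t(s,y,z)=(s,y,V_{st}z)\quad\text{on}\quad (X,\mu)=(\mathbb R^*_+\times\mathbb R\times Z,\ \kappa\times\lambda\times\nu),$$ where $\lambda$ is Lebesgue measure on $\mathbb R$. Then the Poisson suspension $\widetilde T$ of $(X,\mu,T)$ is a weakly mixing probability preserving flow and $$I_{\mathrm{Po}}(\widetilde T)=H_{\mathbb R^*_+}(\kappa).$$ Here the Poisson suspension is the flow $\widetilde T_t\,\omega=\omega\circ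 T_t^{-1}$ on the space of measures $\omega$ on $X$, equipped with the law $\widetilde\mu$ of the Poisson random measure with intensity $\mu$: under $\widetilde\mu$ the variable $\omega(A)$ is Poisson distributed with parameter $\mu(A)$ whenever $\mu(A)<\infty$, and the values of $\omega$ on pairwise disjoint sets of finite measure are independent. The flow $\widetilde T$ is weakly mixing if $(\widetilde T_t\times\widetilde T_t)_{t\in\mathbb R}$ is ergodic for $\widetilde\mu\times\widetilde\mu$. The group $I_{\mathrm{Po}}(\widetilde T)$ of Poissonian self-similarities is, by definition, the group $I(T)$ of all $h\in\mathbb R^*$ (positive or negative) for which the flow $(T_{ht})_{t\in\mathbb R}$ is isomorphic to $T$ through an invertible (mod 0) $\mu$-preserving map of $X$. The quasi-invariance group $H_{\mathbb R^*_+}(\kappa)$ consists of all $h\in\mathbb R^*_+$ such that the image of $\kappa$ under $s\mapsto hs$ is equivalent to $\kappa$ (has the same null sets); it is regarded as a subset of $\mathbb R^*$. -/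

import Mathlib

open MeasureTheory ProbabilityTheory Set
open scoped ENNReal

/-- `T = (T_t)_{t ∈ ℝ}` is a measure preserving flow on `(X, μ)`. Joint measurability of
`(t, x) ↦ T_t x` is required up to a null set, that is, for the completed product σ-algebra. -/
structure IsMPFlow {X : Type*} [MeasurableSpace X] (T : ℝ → X → X) (μ : Measure X) : Prop where
  zero : T 0 = id
  add : ∀ s t : ℝ, T (s + t) = T s ∘ T t
  aemeasurable : AEMeasurable (fun p : ℝ × X => T p.1 p.2) ((volume : Measure ℝ).prod μ)
  measurePreserving : ∀ t : ℝ, MeasurePreserving (T t) μ μ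

/-- Ergodicity of a flow: every (almost) invariant measurable set is null or conull. -/
def IsErgodicFlow {X : Type*} [MeasurableSpace X] (T : ℝ → X → X) (μ : Measure X) : Prop :=
  ∀ A : Set X, MeasurableSet A → (∀ t : ℝ, T t ⁻¹' A =ᵐ[μ] A) → μ A = 0 ∨ μ Aᶜ = 0

/-- Conservativity of a flow: every map `T_t` with `t ≠ 0` is conservative. -/
def IsConservativeFlow {X : Type*} [MeasurableSpace X] (T : ℝ → X → X) (μ : Measure X) : Prop :=
  ∀ t : ℝ, t ≠ 0 → Conservative (T t) μ

/-- Weak mixing of a probability preserving flow: the Cartesian square `(T_t × T_t)_{t ∈ ℝ}`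
is ergodic. -/
def IsWeaklyMixingFlow {X : Type*} [MeasurableSpace X] (T : ℝ → X → X) (μ : Measure X) : Prop :=
  IsErgodicFlow (fun t => Prod.map (T t) (T t)) (μ.prod μ)

/-- The flow `T ∘ s = (T_{st})_{t ∈ ℝ}`. -/
def rescaledFlow {X : Type*} (T : ℝ → X → X) (s : ℝ) : ℝ → X → X :=
  fun t => T (s * t)

/-- Measure theoretic isomorphism of the flows `(X, μ, T)` and `(Y, ν, S)`: an invertible (mod 0)
measure preserving map which intertwines `T_t` with `S_t` for every `t`. -/
def FlowIsomorphic {X Y : Type*} [MeasurableSpace X] [MeasurableSpace Y]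
    (T : ℝ → X → X) (μ : Measure X) (S : ℝ → Y → Y) (ν : Measure Y) : Prop :=
  ∃ (f : X → Y) (g : Y → X), MeasurePreserving f μ ν ∧ MeasurePreserving g ν μ ∧
    g ∘ f =ᵐ[μ] id ∧ f ∘ g =ᵐ[ν] id ∧ ∀ t : ℝ, f ∘ T t =ᵐ[μ] S t ∘ f

/-- The group `I(T)` of self-similarities: all `s ∈ ℝ*` such that `T ∘ s` is isomorphic
to `T`. -/
def selfSimilarities {X : Type*} [MeasurableSpace X] (T : ℝ → X → X) (μ : Measure X) : Set ℝ :=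
  {s : ℝ | s ≠ 0 ∧ FlowIsomorphic (rescaledFlow T s) μ T μ}

/-- The group of `κ`-quasi-invariance: all `g` such that the translate of `κ` by `g` is
equivalent to `κ`. -/
def quasiInvarianceGroup {G : Type*} [Mul G] [MeasurableSpace G] (κ : Measure G) : Set G :=
  {g : G | κ.map (fun x => g * x) ≪ κ ∧ κ ≪ κ.map (fun x => g * x)}

/-- `P` is the law of the Poisson random measure with intensity `μ`: the value on a set `A` of
finite measure has the Poisson distribution with parameter `μ A`, and the values on pairwise
disjoint sets of finite measure are independent. For σ-finite `μ` this determines `P`. -/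
structure IsPoissonLaw {X : Type*} [MeasurableSpace X] (μ : Measure X) (P : Measure (Measure X)) :
    Prop where
  isProbabilityMeasure : IsProbabilityMeasure P
  poisson : ∀ A : Set X, MeasurableSet A → μ A ≠ ∞ →
    P.map (fun ω : Measure X => ω A) =
      (poissonMeasure (μ A).toNNReal).map (fun n : ℕ => (n : ℝ≥0∞))
  indep : ∀ (n : ℕ) (A : Fin n → Set X), (∀ i, MeasurableSet (A i)) → (∀ i, μ (A i) ≠ ∞) →
    (∀ i j, i ≠ j → Disjoint (A i) (A j)) →
    iIndepFun (fun (i : Fin n) (ω : Measure X) => ω (A i)) P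

/-- The flow induced by `T` on the space of measures. On the probability space
`(Measure X, P)` with `IsPoissonLaw μ P` it is the Poisson suspension of `(X, μ, T)`. -/
noncomputable def suspensionFlow {X : Type*} [MeasurableSpace X] (T : ℝ → X → X) :
    ℝ → Measure X → Measure X :=
  fun t ω => ω.map (T t)

/-- The group `I_Po` of Poissonian self-similarities of the Poisson suspension of `(X, μ, T)`;
by definition it is the group `I(T)` of self-similarities of the underlying flow `T`. -/
def poissonianSelfSimilarities {X : Type*} [MeasurableSpace X] (T : ℝ → X → X)
    (μ : Measure X) : Set ℝ :=
  selfSimilarities T μ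

/-- `τ` is the spectral measure of `f` with respect to the Koopman representation of the flow `V`:
`⟨f ∘ V_t, f⟩ = ∫ e^{itx} dτ(x)` for all `t`. -/
def IsSpectralMeasure {Z : Type*} [MeasurableSpace Z] (V : ℝ → Z → Z) (ν : Measure Z)
    (f : Z → ℂ) (τ : Measure ℝ) : Prop :=
  IsFiniteMeasure τ ∧ ∀ t : ℝ, charFun τ t = ∫ z, f (V t z) * (starRingEnd ℂ) (f z) ∂ν

/-- `σ` is a (finite) measure of maximal spectral type of the flow `V`: it dominates the spectral
measure of each `f ∈ L²(ν)`, and it is dominated by one of them. -/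
structure IsMaximalSpectralType {Z : Type*} [MeasurableSpace Z] (V : ℝ → Z → Z) (ν : Measure Z)
    (σ : Measure ℝ) : Prop where
  isFiniteMeasure : IsFiniteMeasure σ
  dominates : ∀ f : Z → ℂ, MemLp f 2 ν → ∃ τ : Measure ℝ, IsSpectralMeasure V ν f τ ∧ τ ≪ σ
  attained : ∃ f : Z → ℂ, MemLp f 2 ν ∧ ∃ τ : Measure ℝ, IsSpectralMeasure V ν f τ ∧ σ ≪ τ

/-- The flow `T_t(s, y, z) = (s, y, V_{st} z)` on `ℝ*₊ × ℝ × Z`. -/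
def fiberedFlow {Z : Type*} (V : ℝ → Z → Z) :
    ℝ → {r : ℝ // 0 < r} × ℝ × Z → {r : ℝ // 0 < r} × ℝ × Z :=
  fun t p => (p.1, p.2.1, V ((p.1 : ℝ) * t) p.2.2)

/-!
The flow `V` is an explicit flow of infinite rank one type, which does not depend on `κ`. A point of
`Om = (ℕ → Fin 3) × ℝ` is a sequence of digits with a position on the line; changing finitely many
digits, and shifting the position by the corresponding sum of differences of the numbers `dig k a`,
is a measure preserving action of a countable group which commutes with the translations of the
position. The flow is the translation flow on the quotient, realized on the set of representatives
`dom`. The points with a representative whose first `n` digits are `0` and whose position is in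
`[-hgt n, hgt n)` form the `n`-th tower `level n`, and this tower consists of three copies inside the
next one, at the offsets `0`, `gapA n` and `gapA n + gapB n`. The scales
`hgt n ≪ gapA n ≪ gapB n ≪ hgt (n + 1)` are separated by quotients which tend to infinity. So a
return time to a tower is, up to a small error, a difference of two offsets of one stage
(`abs_sub_dig_le`). This has two consequences for a fixed tower: `θ * hgt (k + 1)` is not
a return time for fixed `θ ≠ 0` and large `k`, and neither is `θ * gapA k` for large `k` and `θ` in a
compact interval of positive numbers without `1`.

Ergodicity is the zero-one law for invariance under finite changes of the digits, and conservativity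
holds because every orbit spends an infinite time in the lowest tower, whose measure is finite.

The spectral measures come from Bochner's theorem, which is proved here for correlations of
stationary curves in a Hilbert space. The maximal spectral type is attained by the indicator of a
brick, the piece of unit height of the lowest tower: the indicators of all bricks of rational length
are sums of translates of shorter ones, passing to a sum of translates multiplies the spectral
measure by `|P|²` for a trigonometric polynomial `P`, and this density is positive almost everywhere
because the spectral measures have no atoms. For two distinct scalings `s`, `s'` the averages of the
characters with frequencies `gapA k / s'` tend to `1 / 3` with respect to `σ_{s'}` and to `0` with
respect to `σ_s`, since the characteristic function of `σ` can be computed at sums of offset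
differences and vanishes at times which are not return times. Hence `σ_s ⟂ σ_{s'}`.

The Poisson law is built from Poisson numbers of independent points in countably many pieces of the
intensity. Along the times `hgt (k + 1)` every set of finite measure of the fibered flow `T` becomes
asymptotically disjoint from its translates (`tendsto_fibMeas_inter`), so that cylinder events of the
suspension become asymptotically independent; the suspension, and hence its square, mixes along this
sequence of times, which gives weak mixing.

If `κ` is quasi-invariant under `h`, then `(s, y, z) ↦ (h s, w y, z)` conjugates `T_{h t}` with
`T_t`, and it preserves the measure when `w` is the density of the image of `κ`: the factor `ℝ`
absorbs the density. Conversely, let `f` be a conjugacy of the rescaled flow with `T`. It maps the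
fibre over `s` to fibres on which time runs at a speed that is compared with the natural one by a
factor `θ`. In a set of positive measure there are simultaneous returns at the times `gapA k` and
`gapA k + gapB k` (`exists_returns`), and applying `f` to them gives returns at the `θ`-multiples of
these times. This is impossible for positive `θ ≠ 1` by the above, and for negative `θ` because the
offsets would have to occur in the reverse order. Thus `θ = 1` (`ae_speed_eq`), that is, `f`
multiplies the first coordinate by a positive constant, which then preserves the class of `κ`.
-/

namespace RankOneFlow

noncomputable section

/-! ### Bochner's theorem for stationary curves -/

section Bochner

open Complex Filter Topology BoundedContinuousFunction
open scoped NNReal ComplexConjugate InnerProductSpace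

variable {H : Type*} [NormedAddCommGroup H] [InnerProductSpace ℂ H]

/-- A curve in a Hilbert space is stationary with correlation function `r` if it is continuous and
`⟪v s, v t⟫ = r (t - s)`. -/
structure IsStationary (v : ℝ → H) (r : ℝ → ℂ) : Prop where
  continuous : Continuous v
  inner_eq : ∀ s t, ⟪v s, v t⟫_ℂ = r (t - s)

namespace IsStationary

variable {v : ℝ → H} {r : ℝ → ℂ}

lemma norm_sq (h : IsStationary v r) (s : ℝ) : (‖v s‖ : ℂ) ^ 2 = r 0 := by
  rw [← sub_self s, ← h.inner_eq, inner_self_eq_norm_sq_to_K]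
  rfl

lemma norm_eq (h : IsStationary v r) (s : ℝ) : ‖v s‖ = ‖v 0‖ := by
  have h1 : ((‖v s‖ ^ 2 : ℝ) : ℂ) = ((‖v 0‖ ^ 2 : ℝ) : ℂ) := by
    push_cast
    rw [h.norm_sq, h.norm_sq]
  have h2 : ‖v s‖ ^ 2 = ‖v 0‖ ^ 2 := by exact_mod_cast h1
  exact (pow_left_inj₀ (norm_nonneg _) (norm_nonneg _) two_ne_zero).1 h2

lemma corr_eq (h : IsStationary v r) (t : ℝ) : r t = ⟪v 0, v t⟫_ℂ := by
  rw [h.inner_eq, sub_zero]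

lemma continuous_corr (h : IsStationary v r) : Continuous r := by
  rw [show r = fun t => ⟪v 0, v t⟫_ℂ from funext h.corr_eq]
  exact continuous_const.inner h.continuous

lemma norm_corr_le (h : IsStationary v r) (t : ℝ) : ‖r t‖ ≤ ‖v 0‖ ^ 2 := by
  rw [h.corr_eq, sq]
  refine (norm_inner_le_norm _ _).trans ?_
  rw [h.norm_eq t]

variable [CompleteSpace H]

/-- The squared norm of a Fourier average of a stationary curve is an average of its correlation
function. -/
lemma norm_integral_sq (h : IsStationary v r) (γ : Measure ℝ) [IsProbabilityMeasure γ] (x : ℝ) :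
    ((‖∫ s, exp (-(s * x * I)) • v s ∂γ‖ ^ 2 : ℝ) : ℂ) =
      ∫ p, r (p.2 - p.1) * exp ((p.1 - p.2) * x * I) ∂(γ.prod γ) := by
  have hn : ∀ s : ℝ, ‖exp (-(s * x * I))‖ = 1 := fun s => by
    rw [show -((s : ℂ) * x * I) = ((-(s * x) : ℝ) : ℂ) * I by push_cast; ring, norm_exp_ofReal_mul_I]
  have hi : Integrable (fun s : ℝ => exp (-(s * x * I)) • v s) γ := by
    refine Integrable.of_bound (C := ‖v 0‖) (Continuous.aestronglyMeasurable ?_) (.of_forall ?_)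
    · exact (by fun_prop : Continuous fun s : ℝ => exp (-(s * x * I))).smul h.continuous
    · intro s
      rw [norm_smul, hn, one_mul, h.norm_eq s]
  have hn' : ∀ a : ℝ, ‖exp (a * x * I)‖ = 1 := fun s => by
    rw [show ((s : ℂ) * x * I) = (((s * x) : ℝ) : ℂ) * I by push_cast; ring, norm_exp_ofReal_mul_I]
  have h1 : ((‖∫ s, exp (-(s * x * I)) • v s ∂γ‖ ^ 2 : ℝ) : ℂ) =
      ⟪∫ s, exp (-(s * x * I)) • v s ∂γ, ∫ s, exp (-(s * x * I)) • v s ∂γ⟫_ℂ := by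
    rw [inner_self_eq_norm_sq_to_K]
    push_cast
    rfl
  rw [h1, ← integral_inner hi, integral_prod_symm]
  · refine integral_congr_ae (.of_forall fun s => ?_)
    simp only
    rw [← inner_conj_symm, ← integral_inner hi, ← integral_conj]
    refine integral_congr_ae (.of_forall fun s' => ?_)
    simp only
    rw [inner_conj_symm, inner_smul_left, inner_smul_right, h.inner_eq, ← exp_conj]
    simp only [map_neg, map_mul, conj_ofReal, conj_I, mul_neg, neg_neg]
    rw [← mul_assoc, ← exp_add, mul_comm]
    congr 2
    ring
  · refine Integrable.of_bound (C := ‖v 0‖ ^ 2) (Continuous.aestronglyMeasurable ?_)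
      (.of_forall fun p => ?_)
    · have := h.continuous_corr
      fun_prop
    · have := hn' (p.1 - p.2)
      push_cast at this
      rw [norm_mul, this, mul_one]
      exact h.norm_corr_le _

end IsStationary

lemma map_sub_gaussianReal_prod (n : ℝ≥0) :
    ((gaussianReal 0 n).prod (gaussianReal 0 n)).map (fun p => p.2 - p.1) =
      gaussianReal 0 (n + n) := by
  refine Measure.ext_of_charFun (funext fun t => ?_)
  rw [charFun_gaussianReal, charFun_apply_real, integral_map (by fun_prop)
    (by fun_prop : Continuous fun x : ℝ => exp (t * x * I)).aestronglyMeasurable]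
  have : ∀ p : ℝ × ℝ, exp (t * ((p.2 - p.1 : ℝ) : ℂ) * I) =
      exp ((-t : ℝ) * p.1 * I) * exp (t * p.2 * I) := fun p => by
    rw [← exp_add]; congr 1; push_cast; ring
  simp only [this]
  rw [integral_prod_mul (fun x : ℝ => exp ((-t : ℝ) * x * I)) (fun x : ℝ => exp (t * x * I)),
    ← charFun_apply_real, ← charFun_apply_real, charFun_gaussianReal, charFun_gaussianReal,
    ← exp_add]
  congr 1
  push_cast
  ring

/-- The constant relating a Gaussian weight for the law `N(0, 2n)` to the law `N(t, 1/n)`. -/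
def gaussianRatio (n : ℝ≥0) : ℝ≥0 := .mk (√(2 * Real.pi * (n + n : ℝ≥0)) / √(2 * Real.pi * (n⁻¹ : ℝ≥0)))
  (by positivity)

/-- A Gaussian average of centre `0` with an additional Gaussian factor centred at `t` is, up to a
constant, a narrow Gaussian average centred at `t`, by completing the square. -/
lemma integral_gaussianReal_mul_exp (f : ℝ → ℂ) {n : ℝ≥0} (hn : n ≠ 0) (t : ℝ) :
    (gaussianRatio n : ℂ) * ∫ u, f u * exp (-(n * (t - u) ^ 2 / 2)) ∂(gaussianReal 0 (n + n)) =
      ∫ u, f u * exp (-(u ^ 2 / (4 * n))) ∂(gaussianReal t n⁻¹) := by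
  have hn' : (0 : ℝ) < n := by positivity
  rw [integral_gaussianReal_eq_integral_smul (by positivity),
    integral_gaussianReal_eq_integral_smul (by positivity), ← integral_const_mul]
  refine integral_congr_ae (.of_forall fun u => ?_)
  simp only [gaussianPDFReal, real_smul, gaussianRatio, NNReal.coe_mk]
  push_cast
  have h1 : ((√(2 * Real.pi * (n + n)) : ℝ) : ℂ) ≠ 0 := by
    rw [ne_eq, ofReal_eq_zero]
    positivity
  have h2 : exp (-((u : ℂ) - 0) ^ 2 / (2 * (n + n))) * exp (-(n * (t - u) ^ 2 / 2)) =
      exp (-((u : ℂ) - t) ^ 2 / (2 * (n : ℂ)⁻¹)) * exp (-(u ^ 2 / (4 * n))) := by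
    have : (n : ℂ) ≠ 0 := by exact_mod_cast hn'.ne'
    rw [← exp_add, ← exp_add]
    congr 1
    field_simp
    ring
  calc _ = (((√(2 * Real.pi * (n + n)) : ℝ) : ℂ) * (((√(2 * Real.pi * (n + n)) : ℝ) : ℂ))⁻¹) *
        (((√(2 * Real.pi * (n : ℝ)⁻¹) : ℝ) : ℂ))⁻¹ * f u *
        (exp (-((u : ℂ) - 0) ^ 2 / (2 * (n + n))) * exp (-(n * (t - u) ^ 2 / 2))) := by ring
    _ = _ := by
      rw [h2, mul_inv_cancel₀ h1]
      ring

/-- Smoothed versions of a correlation function are characteristic functions. -/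
lemma IsStationary.exists_charFun_eq_integral [CompleteSpace H] {v : ℝ → H} {r : ℝ → ℂ}
    (h : IsStationary v r) {n : ℝ≥0} (hn : n ≠ 0) :
    ∃ μ : Measure ℝ, IsFiniteMeasure μ ∧ ∀ t,
      charFun μ t = ∫ u, r u * exp (-(u ^ 2 / (4 * n))) ∂(gaussianReal t n⁻¹) := by
  set γ := gaussianReal 0 n
  set F : ℝ → H := fun x => ∫ s, exp (-(s * x * I)) • v s ∂γ
  have hFn : ∀ x, ‖F x‖ ≤ ‖v 0‖ := fun x => by
    refine (norm_integral_le_of_norm_le_const (C := ‖v 0‖) (.of_forall fun s => ?_)).trans (by simp)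
    rw [norm_smul, h.norm_eq s, show -((s : ℂ) * x * I) = ((-(s * x) : ℝ) : ℂ) * I by push_cast; ring,
      norm_exp_ofReal_mul_I, one_mul]
  have hF : Continuous F := by
    refine continuous_of_dominated (bound := fun _ => ‖v 0‖) (fun x => ?_) (fun x => ?_)
      (integrable_const _) (.of_forall fun s => ?_)
    · exact ((by fun_prop : Continuous fun s : ℝ => exp (-(s * x * I))).smul
        h.continuous).aestronglyMeasurable
    · refine .of_forall fun s => ?_
      rw [norm_smul, h.norm_eq s, show -((s : ℂ) * x * I) = ((-(s * x) : ℝ) : ℂ) * I by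
        push_cast; ring, norm_exp_ofReal_mul_I, one_mul]
    · fun_prop
  have hm : Measurable fun x => ENNReal.ofReal (‖F x‖ ^ 2) :=
    (ENNReal.continuous_ofReal.comp (hF.norm.pow 2)).measurable
  refine ⟨gaussianRatio n • γ.withDensity fun x => ENNReal.ofReal (‖F x‖ ^ 2), ?_, fun t => ?_⟩
  · have : IsFiniteMeasure (γ.withDensity fun x => ENNReal.ofReal (‖F x‖ ^ 2)) := by
      refine isFiniteMeasure_withDensity_ofReal ?_
      refine (Integrable.of_bound (C := ‖v 0‖ ^ 2) ?_ (.of_forall fun x => ?_)).2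
      · exact (hF.norm.pow 2).aestronglyMeasurable
      · rw [Real.norm_eq_abs, abs_of_nonneg (by positivity)]
        exact pow_le_pow_left₀ (norm_nonneg _) (hFn x) 2
    infer_instance
  · rw [charFun_apply_real, integral_smul_nnreal_measure,
      integral_withDensity_eq_integral_toReal_smul hm (by simp),
      ← integral_gaussianReal_mul_exp r hn t, ← map_sub_gaussianReal_prod]
    have hr := h.continuous_corr
    rw [integral_map (by fun_prop) (Continuous.aestronglyMeasurable (by fun_prop)),
      NNReal.smul_def, real_smul]
    congr 1
    have h1 : ∀ x : ℝ, (ENNReal.ofReal (‖F x‖ ^ 2)).toReal • exp (t * x * I) =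
        ∫ p, r (p.2 - p.1) * exp ((t + p.1 - p.2 : ℝ) * x * I) ∂(γ.prod γ) := fun x => by
      rw [ENNReal.toReal_ofReal (by positivity), real_smul, h.norm_integral_sq γ x,
        ← integral_mul_const]
      refine integral_congr_ae (.of_forall fun p => ?_)
      simp only
      rw [mul_assoc, ← exp_add]
      congr 2
      push_cast
      ring
    simp only [h1]
    rw [integral_integral_swap]
    · refine integral_congr_ae (.of_forall fun p => ?_)
      simp only
      rw [integral_const_mul, ← charFun_apply_real, charFun_gaussianReal]
      congr 2
      push_cast
      ring
    · refine Integrable.of_bound (C := ‖v 0‖ ^ 2) (Continuous.aestronglyMeasurable ?_)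
        (.of_forall fun q => ?_)
      · simp only [Function.uncurry_def]
        fun_prop
      · simp only [Function.uncurry_def]
        rw [norm_mul, ← ofReal_mul, norm_exp_ofReal_mul_I, mul_one]
        exact h.norm_corr_le _

/-- The smoothed correlation functions converge to the correlation function. -/
lemma IsStationary.tendsto_integral_gaussianReal [CompleteSpace H] {v : ℝ → H} {r : ℝ → ℂ}
    (h : IsStationary v r) (t : ℝ) : Tendsto (fun n : ℕ => ∫ u, r u *
      exp (-(u ^ 2 / (4 * ((n + 1 : ℕ) : ℝ≥0)))) ∂(gaussianReal t ((n + 1 : ℕ) : ℝ≥0)⁻¹)) atTop (𝓝 (r t)) := by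
  have hr := h.continuous_corr
  -- rescale to the standard normal law
  have h1 : ∀ n : ℕ, gaussianReal t ((n + 1 : ℕ) : ℝ≥0)⁻¹ =
      (gaussianReal 0 1).map (fun y => t + (√(n + 1 : ℝ))⁻¹ * y) := fun n => by
    have e : (fun y : ℝ => t + (√(n + 1 : ℝ))⁻¹ * y) =
      (fun y => t + y) ∘ (fun y => (√(n + 1 : ℝ))⁻¹ * y) := rfl
    rw [e, ← Measure.map_map (by fun_prop) (by fun_prop), gaussianReal_map_const_mul,
      gaussianReal_map_const_add]
    congr 1
    · simp
    · rw [mul_one]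
      ext
      simp [inv_pow, Real.sq_sqrt (by positivity : (0 : ℝ) ≤ n + 1)]
  have h2 : ∀ n : ℕ, ∫ u, r u * exp (-(u ^ 2 / (4 * ((n + 1 : ℕ) : ℝ≥0))))
      ∂(gaussianReal t ((n + 1 : ℕ) : ℝ≥0)⁻¹) = ∫ y, r (t + (√(n + 1 : ℝ))⁻¹ * y) *
        exp ((-((t + (√(n + 1 : ℝ))⁻¹ * y) ^ 2 / 4 * (n + 1 : ℝ)⁻¹) : ℝ)) ∂(gaussianReal 0 1) := fun n => by
    rw [h1, integral_map (by fun_prop) (Continuous.aestronglyMeasurable (by fun_prop))]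
    refine integral_congr_ae (.of_forall fun y => ?_)
    simp only
    congr 2
    push_cast
    field_simp
  have hlim : Tendsto (fun n : ℕ => (√(n + 1 : ℝ))⁻¹) atTop (𝓝 0) :=
    tendsto_inv_atTop_zero.comp (Real.tendsto_sqrt_atTop.comp
      (tendsto_atTop_add_const_right _ _ tendsto_natCast_atTop_atTop))
  have hlim' : Tendsto (fun n : ℕ => (n + 1 : ℝ)⁻¹) atTop (𝓝 0) :=
    tendsto_inv_atTop_zero.comp (tendsto_atTop_add_const_right _ _ tendsto_natCast_atTop_atTop)
  have h3 : r t = ∫ _, r t ∂(gaussianReal 0 1) := by simp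
  rw [h3]
  refine Tendsto.congr (fun n => (h2 n).symm) ?_
  refine tendsto_integral_of_dominated_convergence (fun _ => ‖v 0‖ ^ 2)
    (fun n => Continuous.aestronglyMeasurable (by fun_prop)) (integrable_const _)
    (fun n => .of_forall fun y => ?_) (.of_forall fun y => ?_)
  · rw [norm_mul, norm_exp_ofReal]
    refine (mul_le_of_le_one_right (norm_nonneg _) ?_).trans (h.norm_corr_le _)
    rw [Real.exp_le_one_iff, neg_nonpos]
    positivity
  · have e1 : Tendsto (fun n : ℕ => t + (√(n + 1 : ℝ))⁻¹ * y) atTop (𝓝 (t + 0 * y)) :=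
      tendsto_const_nhds.add (hlim.mul_const y)
    have e2 := ((e1.pow 2).div_const 4).mul hlim'
    have e3 := ((continuous_ofReal.comp Real.continuous_exp).tendsto _).comp e2.neg
    have e4 := ((hr.tendsto _).comp e1).mul e3
    simp only [Function.comp_def, mul_zero, neg_zero, zero_mul, add_zero, Real.exp_zero,
      ofReal_one, mul_one, ofReal_exp] at e4
    refine e4.congr fun n => ?_
    simp

/-- **Bochner's theorem** for correlation functions of stationary curves. -/
theorem IsStationary.exists_charFun_eq [CompleteSpace H] {v : ℝ → H} {r : ℝ → ℂ}
    (h : IsStationary v r) : ∃ μ : Measure ℝ, IsFiniteMeasure μ ∧ ∀ t, charFun μ t = r t := by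
  by_cases h0 : r 0 = 0
  · refine ⟨0, inferInstance, fun t => ?_⟩
    have : v 0 = 0 := by
      have := h.norm_sq 0
      rw [h0] at this
      simpa using this
    rw [h.corr_eq, this]
    simp
  have := fun n : ℕ => h.exists_charFun_eq_integral (n := ((n + 1 : ℕ) : ℝ≥0)) (by simp)
  choose μ hμ hμr using this
  have hlim : ∀ t, Tendsto (fun n => charFun (μ n) t) atTop (𝓝 (r t)) := fun t => by
    simp only [hμr]
    exact h.tendsto_integral_gaussianReal t
  -- Lévy's theorem needs probability measures, so the approximations are normalized
  let m : ℕ → FiniteMeasure ℝ := fun n => ⟨μ n, hμ n⟩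
  let p : ℕ → ProbabilityMeasure ℝ := fun n => (m n).normalize
  have hc : ∀ n t, charFun (μ n) t = charFun (μ n) 0 * charFun (p n : Measure ℝ) t := fun n t => by
    have e : μ n = (m n).mass • (p n : Measure ℝ) := by
      have := congrArg (fun ρ : FiniteMeasure ℝ => (ρ : Measure ℝ)) (m n).self_eq_mass_smul_normalize
      exact this
    have e' : ∀ t, charFun (μ n) t = ((m n).mass : ℂ) * charFun (p n : Measure ℝ) t := fun t => by
      conv_lhs => rw [e]
      rw [charFun_apply_real, integral_smul_nnreal_measure, ← charFun_apply_real,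
        NNReal.smul_def, real_smul]
    rw [e' t, e' 0]
    simp
  have hlim' : ∀ t, Tendsto (fun n => charFun (p n : Measure ℝ) t) atTop (𝓝 (r t / r 0)) := fun t => by
    refine ((hlim t).div (hlim 0) h0).congr' ?_
    filter_upwards [(hlim 0).eventually_ne h0] with n hn
    simp only [Pi.div_apply]
    rw [hc n t]
    field_simp
  have htight := isTightMeasureSet_of_tendsto_charFun (μ := fun n => (p n : Measure ℝ))
    (f := fun t => r t / r 0) (by have := h.continuous_corr; fun_prop) hlim'
  have hcomp : IsCompact (closure (range p)) :=
    isCompact_closure_of_isTightMeasureSet (by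
      convert htight using 1
      ext ρ
      simp)
  obtain ⟨q, -, hq⟩ := hcomp.ultrafilter_le_nhds (Ultrafilter.of (atTop.map p))
    ((Ultrafilter.of_le _).trans (by
      rw [Filter.le_principal_iff, Filter.mem_map]
      exact Filter.univ_mem' fun n => subset_closure ⟨n, rfl⟩))
  set U := Ultrafilter.of (atTop.map p)
  have hU : ∀ t, charFun (q : Measure ℝ) t = r t / r 0 := fun t => by
    have l1 : Tendsto (fun ρ : ProbabilityMeasure ℝ => charFun (ρ : Measure ℝ) t) U
        (𝓝 (charFun (q : Measure ℝ) t)) := by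
      have : Tendsto (fun ρ : ProbabilityMeasure ℝ => ρ) U (𝓝 q) := hq
      rw [ProbabilityMeasure.tendsto_iff_forall_integral_rclike_tendsto ℂ] at this
      simp_rw [charFun_eq_integral_innerProbChar]
      exact this (innerProbChar t)
    have l2 : Tendsto (fun ρ : ProbabilityMeasure ℝ => charFun (ρ : Measure ℝ) t) U
        (𝓝 (r t / r 0)) :=
      Tendsto.mono_left (Filter.tendsto_map'_iff.2 (hlim' t)) (Ultrafilter.of_le _)
    exact tendsto_nhds_unique l1 l2
  refine ⟨(‖v 0‖₊ ^ 2) • (q : Measure ℝ), inferInstance, fun t => ?_⟩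
  rw [charFun_apply_real, integral_smul_nnreal_measure, ← charFun_apply_real, hU,
    NNReal.smul_def, real_smul]
  have := h.norm_sq 0
  push_cast
  rw [this]
  field_simp

end Bochner

/-! ### Spectral measures of isometric flows -/

section Spectral

open Complex Filter Topology
open scoped NNReal ComplexConjugate InnerProductSpace

variable {H : Type*} [NormedAddCommGroup H] [InnerProductSpace ℂ H]

/-- A strongly continuous one-parameter group of isometries of a Hilbert space. -/
structure IsIsometricFlow (U : ℝ → H →ₗᵢ[ℂ] H) : Prop where
  zero_apply : ∀ v, U 0 v = v
  add_apply : ∀ s t v, U (s + t) v = U s (U t v)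
  continuous : ∀ v, Continuous fun t => U t v

namespace IsIsometricFlow

variable {U : ℝ → H →ₗᵢ[ℂ] H}

lemma inner_apply (hU : IsIsometricFlow U) (s t : ℝ) (v w : H) :
    ⟪U s v, U t w⟫_ℂ = ⟪v, U (t - s) w⟫_ℂ := by
  rw [← (U s).inner_map_map v, ← hU.add_apply, add_sub_cancel]

lemma isStationary (hU : IsIsometricFlow U) (v : H) :
    IsStationary (fun t => U t v) (fun t => ⟪v, U t v⟫_ℂ) :=
  ⟨hU.continuous v, fun s t => hU.inner_apply s t v v⟩

variable [CompleteSpace H]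

/-- The spectral measure of the vector `v`. -/
def spec (hU : IsIsometricFlow U) (v : H) : Measure ℝ :=
  (hU.isStationary v).exists_charFun_eq.choose

instance (hU : IsIsometricFlow U) (v : H) : IsFiniteMeasure (hU.spec v) :=
  (hU.isStationary v).exists_charFun_eq.choose_spec.1

lemma charFun_spec (hU : IsIsometricFlow U) (v : H) (t : ℝ) :
    charFun (hU.spec v) t = ⟪v, U t v⟫_ℂ :=
  (hU.isStationary v).exists_charFun_eq.choose_spec.2 t

lemma spec_univ (hU : IsIsometricFlow U) (v : H) : (hU.spec v).real univ = ‖v‖ ^ 2 := by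
  have := hU.charFun_spec v 0
  rw [charFun_zero, hU.zero_apply, inner_self_eq_norm_sq_to_K] at this
  rw [← ofReal_inj, this]
  push_cast
  rfl

lemma charFun_add_measure (μ ν : Measure ℝ) [IsFiniteMeasure μ] [IsFiniteMeasure ν] (t : ℝ) :
    charFun (μ + ν) t = charFun μ t + charFun ν t := by
  rw [charFun_apply_real, charFun_apply_real, charFun_apply_real, integral_add_measure]
  all_goals
    refine Integrable.of_bound (C := 1) (Continuous.aestronglyMeasurable (by fun_prop))
      (.of_forall fun x => ?_)
    rw [← ofReal_mul, norm_exp_ofReal_mul_I]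

/-- The parallelogram law for spectral measures. -/
lemma spec_add_add_spec_sub (hU : IsIsometricFlow U) (v w : H) :
    hU.spec (v + w) + hU.spec (v - w) =
      (hU.spec v + hU.spec w) + (hU.spec v + hU.spec w) := by
  refine Measure.ext_of_charFun (funext fun t => ?_)
  simp only [charFun_add_measure, charFun_spec, map_add, map_sub, inner_add_left, inner_add_right,
    inner_sub_left, inner_sub_right]
  ring

lemma spec_add_le (hU : IsIsometricFlow U) (v w : H) (B : Set ℝ) :
    hU.spec (v + w) B ≤ (hU.spec v B + hU.spec w B) + (hU.spec v B + hU.spec w B) := by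
  have := congrArg (fun ρ : Measure ℝ => ρ B) (hU.spec_add_add_spec_sub v w)
  simp only [Measure.add_apply] at this
  rw [← this]
  exact le_self_add

lemma spec_smul (hU : IsIsometricFlow U) (c : ℂ) (v : H) :
    hU.spec (c • v) = (‖c‖₊ ^ 2) • hU.spec v := by
  refine Measure.ext_of_charFun (funext fun t => ?_)
  conv_rhs => rw [charFun_apply_real, integral_smul_nnreal_measure, ← charFun_apply_real]
  rw [charFun_spec, charFun_spec, map_smul, inner_smul_left, inner_smul_right, NNReal.smul_def,
    real_smul, ← mul_assoc, conj_mul']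
  simp

lemma spec_zero (hU : IsIsometricFlow U) : hU.spec 0 = 0 := by
  have := hU.spec_smul 0 0
  simpa using this

/-- The vectors with spectral measure absolutely continuous with respect to `σ`. -/
def acSubspace (hU : IsIsometricFlow U) (σ : Measure ℝ) : Submodule ℂ H where
  carrier := {v | hU.spec v ≪ σ}
  add_mem' := fun {v w} hv hw B hB => by
    refine le_antisymm ((hU.spec_add_le v w B).trans ?_) bot_le
    rw [hv hB, hw hB]
    simp
  zero_mem' := by
    simp only [mem_ofPred_eq, spec_zero]
    exact Measure.AbsolutelyContinuous.zero _
  smul_mem' := fun c v hv => by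
    simp only [mem_ofPred_eq, spec_smul]
    exact hv.smul_left _

lemma mem_acSubspace {hU : IsIsometricFlow U} {σ : Measure ℝ} {v : H} :
    v ∈ hU.acSubspace σ ↔ hU.spec v ≪ σ := Iff.rfl

lemma isClosed_acSubspace (hU : IsIsometricFlow U) (σ : Measure ℝ) :
    IsClosed (hU.acSubspace σ : Set H) := by
  refine isClosed_of_closure_subset fun v hv B hB => ?_
  refine le_antisymm (ENNReal.le_of_forall_pos_le_add fun ε hε _ => ?_) bot_le
  obtain ⟨w, hw, hvw⟩ := Metric.mem_closure_iff.1 hv (√(ε / 2)) (by positivity)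
  have h1 : hU.spec (v - w) B ≤ ENNReal.ofReal (ε / 2) := by
    refine (measure_mono (subset_univ _)).trans ?_
    rw [← ofReal_measureReal, spec_univ]
    refine ENNReal.ofReal_le_ofReal ?_
    rw [dist_eq_norm] at hvw
    calc ‖v - w‖ ^ 2 ≤ √(ε / 2) ^ 2 := pow_le_pow_left₀ (norm_nonneg _) hvw.le 2
      _ = ε / 2 := Real.sq_sqrt (by positivity)
  -- `v = (v - w) + w`, and the spectral measure of `v - w` is small
  have h2 := hU.spec_add_le (v - w) w B
  rw [sub_add_cancel, hw hB, add_zero] at h2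
  refine h2.trans ((add_le_add h1 h1).trans ?_)
  rw [← ENNReal.ofReal_add (by positivity) (by positivity)]
  simp

/-- A trigonometric polynomial. -/
def trigPoly {ι : Type*} (J : Finset ι) (t : ι → ℝ) (x : ℝ) : ℂ := ∑ j ∈ J, exp (t j * x * I)

lemma continuous_trigPoly {ι : Type*} (J : Finset ι) (t : ι → ℝ) : Continuous (trigPoly J t) := by
  unfold trigPoly
  fun_prop

lemma norm_trigPoly_sq {ι : Type*} (J : Finset ι) (t : ι → ℝ) (x : ℝ) :
    ((‖trigPoly J t x‖ ^ 2 : ℝ) : ℂ) = ∑ j ∈ J, ∑ l ∈ J, exp ((t l - t j : ℝ) * x * I) := by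
  push_cast
  rw [← conj_mul', trigPoly, map_sum, Finset.sum_mul_sum]
  refine Finset.sum_congr rfl fun j _ => Finset.sum_congr rfl fun l _ => ?_
  rw [← exp_conj, ← exp_add]
  congr 1
  simp
  ring

/-- A sum of translates of `v` multiplies the spectral measure by the squared modulus of the
corresponding trigonometric polynomial. -/
lemma spec_sum (hU : IsIsometricFlow U) {ι : Type*} (J : Finset ι) (t : ι → ℝ) (v : H) :
    hU.spec (∑ j ∈ J, U (t j) v) =
      (hU.spec v).withDensity fun x => ENNReal.ofReal (‖trigPoly J t x‖ ^ 2) := by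
  have hc : Continuous fun x => ‖trigPoly J t x‖ ^ 2 := (continuous_trigPoly J t).norm.pow 2
  have hm : Measurable fun x => ENNReal.ofReal (‖trigPoly J t x‖ ^ 2) :=
    (ENNReal.continuous_ofReal.comp hc).measurable
  have hi : ∀ u : ℝ, Integrable (fun x : ℝ => exp (u * x * I)) (hU.spec v) := fun u => by
    refine Integrable.of_bound (C := 1) (Continuous.aestronglyMeasurable (by fun_prop))
      (.of_forall fun x => ?_)
    rw [← ofReal_mul, norm_exp_ofReal_mul_I]
  have hb : ∀ x, ‖trigPoly J t x‖ ^ 2 ≤ (J.card : ℝ) ^ 2 := fun x => by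
    refine pow_le_pow_left₀ (norm_nonneg _) ?_ 2
    refine (norm_sum_le_of_le J (n := fun _ => 1) fun j _ => ?_).trans (by simp)
    rw [← ofReal_mul, norm_exp_ofReal_mul_I]
  have : IsFiniteMeasure ((hU.spec v).withDensity fun x => ENNReal.ofReal (‖trigPoly J t x‖ ^ 2)) := by
    refine isFiniteMeasure_withDensity_ofReal ?_
    refine (Integrable.of_bound (C := (J.card : ℝ) ^ 2) hc.aestronglyMeasurable
      (.of_forall fun x => ?_)).2
    rw [Real.norm_eq_abs, abs_of_nonneg (sq_nonneg _)]
    exact hb x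
  refine Measure.ext_of_charFun (funext fun u => ?_)
  rw [charFun_spec, charFun_apply_real, integral_withDensity_eq_integral_toReal_smul
    hm
      (.of_forall fun x => ENNReal.ofReal_lt_top)]
  have h1 : ∀ x : ℝ, (ENNReal.ofReal (‖trigPoly J t x‖ ^ 2)).toReal • exp (u * x * I) =
      ∑ j ∈ J, ∑ l ∈ J, exp ((u + t l - t j : ℝ) * x * I) := fun x => by
    rw [ENNReal.toReal_ofReal (by positivity), real_smul, norm_trigPoly_sq, Finset.sum_mul]
    refine Finset.sum_congr rfl fun j _ => ?_
    rw [Finset.sum_mul]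
    refine Finset.sum_congr rfl fun l _ => ?_
    rw [← exp_add]
    congr 1
    push_cast
    ring
  simp only [h1]
  rw [integral_finsetSum J fun j _ => integrable_finsetSum J fun l _ => hi _, sum_inner]
  refine Finset.sum_congr rfl fun j _ => ?_
  rw [integral_finsetSum J fun l _ => hi _, map_sum, inner_sum]
  refine Finset.sum_congr rfl fun l _ => ?_
  rw [← charFun_apply_real, charFun_spec, ← hU.add_apply, hU.inner_apply]

/-- A nontrivial trigonometric polynomial with positive coefficients has countably many zeros. -/
lemma countable_trigPoly_eq_zero {ι : Type*} {J : Finset ι} (hJ : J.Nonempty) (t : ι → ℝ) :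
    {x : ℝ | trigPoly J t x = 0}.Countable := by
  have h : AnalyticOnNhd ℝ (trigPoly J t) univ := fun x _ => by
    refine Finset.analyticAt_fun_sum J fun j _ => ?_
    exact (analyticAt_cexp.restrictScalars (𝕜 := ℝ)).comp
      ((analyticAt_const.mul (ofRealCLM.analyticAt x)).mul analyticAt_const)
  -- a nonzero analytic function has a discrete set of zeros
  have h0 : trigPoly J t 0 ≠ 0 := by
    simpa [trigPoly] using hJ.ne_empty
  have h1 := h.preimage_zero_mem_codiscrete h0
  rw [mem_codiscrete'] at h1
  have h2 : IsDiscrete {x : ℝ | trigPoly J t x = 0} := by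
    convert h1.2 using 1
    ext x
    simp
  have := h2.to_subtype
  exact (countable_of_Lindelof_of_discrete (X := {x : ℝ | trigPoly J t x = 0})).to_set

/-- If the spectral measure of `v` has no atoms, it is dominated by the spectral measure of every
sum of translates of `v`. -/
lemma spec_absolutelyContinuous_sum (hU : IsIsometricFlow U) {ι : Type*} {J : Finset ι}
    (hJ : J.Nonempty) (t : ι → ℝ) (v : H) [NullSingletonClass (hU.spec v)] :
    hU.spec v ≪ hU.spec (∑ j ∈ J, U (t j) v) := by
  rw [spec_sum]
  have hc : Continuous fun x => ‖trigPoly J t x‖ ^ 2 := (continuous_trigPoly J t).norm.pow 2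
  refine withDensity_absolutelyContinuous' (ENNReal.continuous_ofReal.comp hc).measurable.aemeasurable
    ?_
  have := (countable_trigPoly_eq_zero hJ t).measure_zero (hU.spec v)
  filter_upwards [measure_eq_zero_iff_ae_notMem.1 this] with x hx
  have hx' : 0 < ‖trigPoly J t x‖ := norm_pos_iff.2 hx
  simpa using hx'

/-- A sum of translates of `v` has a spectral measure dominated by the one of `v`. -/
lemma spec_sum_absolutelyContinuous (hU : IsIsometricFlow U) {ι : Type*} (J : Finset ι)
    (t : ι → ℝ) (v : H) : hU.spec (∑ j ∈ J, U (t j) v) ≪ hU.spec v := by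
  rw [spec_sum]
  exact withDensity_absolutelyContinuous _ _

end IsIsometricFlow

/-! ### Averages of orthogonal functions -/

/-- The mean square of an average of orthogonal bounded functions is small. -/
lemma integral_norm_average_sq_le {α : Type*} [MeasurableSpace α] (τ : Measure α)
    [IsFiniteMeasure τ] (f : ℕ → α → ℂ) (hf : ∀ k, Measurable (f k)) {C : ℝ}
    (hC : ∀ k x, ‖f k x‖ ≤ C) (ho : ∀ k l, k ≠ l → ∫ x, f k x * conj (f l x) ∂τ = 0) (N : ℕ) :
    ∫ x, ‖∑ k ∈ Finset.range N, f k x‖ ^ 2 ∂τ ≤ N * (C ^ 2 * τ.real univ) := by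
  have hi : ∀ k l, Integrable (fun x => f k x * conj (f l x)) τ := fun k l => by
    refine Integrable.of_bound (C := C * C) ?_ (.of_forall fun x => ?_)
    · exact ((hf k).mul (continuous_conj.measurable.comp (hf l))).aestronglyMeasurable
    · rw [norm_mul, RCLike.norm_conj]
      exact mul_le_mul (hC k x) (hC l x) (norm_nonneg _) ((norm_nonneg _).trans (hC k x))
  have h1 : ((∫ x, ‖∑ k ∈ Finset.range N, f k x‖ ^ 2 ∂τ : ℝ) : ℂ) =
      ((∑ k ∈ Finset.range N, ∫ x, ‖f k x‖ ^ 2 ∂τ : ℝ) : ℂ) := by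
    rw [← integral_complex_ofReal]
    have : ∀ x, ((‖∑ k ∈ Finset.range N, f k x‖ ^ 2 : ℝ) : ℂ) =
        ∑ k ∈ Finset.range N, ∑ l ∈ Finset.range N, f k x * conj (f l x) := fun x => by
      push_cast
      rw [← mul_conj', map_sum, Finset.sum_mul_sum]
    simp only [this]
    rw [integral_finsetSum _ fun k _ => integrable_finsetSum _ fun l _ => hi k l]
    push_cast
    refine Finset.sum_congr rfl fun k hk => ?_
    rw [integral_finsetSum _ fun l _ => hi k l, Finset.sum_eq_single_of_mem k hk
      (fun l _ hl => ho k l hl.symm), ← integral_complex_ofReal]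
    refine integral_congr_ae (.of_forall fun x => ?_)
    simp only
    rw [mul_conj']
    push_cast
    rfl
  rw [ofReal_inj.1 h1]
  refine (Finset.sum_le_sum (g := fun _ => C ^ 2 * τ.real univ) fun k _ => ?_).trans (by simp)
  refine (integral_mono_of_nonneg (.of_forall fun x => sq_nonneg _)
    (integrable_const (C ^ 2)) (.of_forall fun x => ?_)).trans ?_
  · exact pow_le_pow_left₀ (norm_nonneg _) (hC k x) 2
  · simp [mul_comm]

/-- Chebyshev's inequality for the averages of bounded orthogonal functions. -/
lemma measure_norm_average_ge_le {α : Type*} [MeasurableSpace α] (τ : Measure α)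
    [IsFiniteMeasure τ] (f : ℕ → α → ℂ) (hf : ∀ k, Measurable (f k)) {C : ℝ}
    (hC : ∀ k x, ‖f k x‖ ≤ C) (ho : ∀ k l, k ≠ l → ∫ x, f k x * conj (f l x) ∂τ = 0)
    {δ : ℝ} (hδ : 0 < δ) {ε : ℝ} (hε : 0 < ε) :
    ∀ᶠ N : ℕ in atTop, τ {x | N * δ ≤ ‖∑ k ∈ Finset.range N, f k x‖} ≤ ENNReal.ofReal ε := by
  filter_upwards [tendsto_natCast_atTop_atTop.eventually_ge_atTop
    ((C ^ 2 * τ.real univ) / (δ ^ 2 * ε)), eventually_ge_atTop 1] with N hN hN1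
  have hN0 : (0 : ℝ) < N := by exact_mod_cast hN1
  rw [div_le_iff₀ (by positivity)] at hN
  have hm : Measurable fun x => ∑ k ∈ Finset.range N, f k x :=
    Finset.measurable_fun_sum _ fun k _ => hf k
  have h1 := mul_meas_ge_le_integral_of_nonneg (μ := τ)
    (f := fun x => ‖∑ k ∈ Finset.range N, f k x‖ ^ 2) (.of_forall fun x => sq_nonneg _) ?_
    ((N * δ) ^ 2)
  · have h2 := h1.trans (integral_norm_average_sq_le τ f hf hC ho N)
    have h3 : τ.real {x | N * δ ≤ ‖∑ k ∈ Finset.range N, f k x‖} ≤ ε := by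
      refine le_of_mul_le_mul_left (a := (N * δ) ^ 2) ?_ (by positivity)
      calc (N * δ) ^ 2 * τ.real {x | N * δ ≤ ‖∑ k ∈ Finset.range N, f k x‖}
          ≤ (N * δ) ^ 2 * τ.real {x | (N * δ) ^ 2 ≤ ‖∑ k ∈ Finset.range N, f k x‖ ^ 2} := by
            refine mul_le_mul_of_nonneg_left (measureReal_mono fun x hx => ?_) (by positivity)
            exact pow_le_pow_left₀ (mul_nonneg hN0.le hδ.le) hx 2
        _ ≤ N * (C ^ 2 * τ.real univ) := h2
        _ ≤ N * (N * (δ ^ 2 * ε)) := mul_le_mul_of_nonneg_left hN hN0.le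
        _ = _ := by ring
    rw [← ofReal_measureReal]
    exact ENNReal.ofReal_le_ofReal h3
  · refine Integrable.of_bound (C := (N * C) ^ 2) (hm.norm.pow_const 2).aestronglyMeasurable
      (.of_forall fun x => ?_)
    rw [Real.norm_eq_abs, abs_of_nonneg (sq_nonneg _)]
    have : ‖∑ k ∈ Finset.range N, f k x‖ ≤ N * C :=
      (norm_sum_le_of_le _ fun k _ => hC k x).trans (by simp)
    exact pow_le_pow_left₀ (norm_nonneg _) this 2

/-- Measures which are separated by sets up to an arbitrarily small error are mutually singular. -/
lemma mutuallySingular_of_forall_exists {α : Type*} [MeasurableSpace α] {τ τ' : Measure α}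
    (h : ∀ ε : ℝ, 0 < ε → ∃ S, τ S ≤ ENNReal.ofReal ε ∧ τ' Sᶜ ≤ ENNReal.ofReal ε) :
    τ ⟂ₘ τ' := by
  refine Measure.mutuallySingular_of_disjoint (disjoint_iff_inf_le.2 ?_)
  set ρ := τ ⊓ τ'
  have h0 : ρ univ = 0 := by
    refine le_antisymm (ENNReal.le_of_forall_pos_le_add fun ε hε _ => ?_) bot_le
    obtain ⟨S, hS, hS'⟩ := h (ε / 2) (by positivity)
    rw [← union_compl_self S, zero_add]
    refine (measure_union_le _ _).trans ((add_le_add (((inf_le_left : ρ ≤ τ) S).trans hS)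
      (((inf_le_right : ρ ≤ τ') _).trans hS')).trans ?_)
    rw [← ENNReal.ofReal_add (by positivity) (by positivity)]
    simp
  rw [Measure.measure_univ_eq_zero.1 h0]
  exact bot_le

/-- Two measures are mutually singular if there are bounded functions which are orthogonal for the
first one, and orthogonal up to a nonzero additive constant for the second one: the averages of the
functions converge to `0` for the first measure and to the constant for the second measure. -/
lemma mutuallySingular_of_orthogonal {α : Type*} [MeasurableSpace α] {τ τ' : Measure α}
    [IsFiniteMeasure τ] [IsFiniteMeasure τ'] (f : ℕ → α → ℂ) (hf : ∀ k, Measurable (f k))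
    (h1 : ∀ k x, ‖f k x‖ ≤ 1) {c : ℂ} (hc : c ≠ 0)
    (ho : ∀ k l, k ≠ l → ∫ x, f k x * conj (f l x) ∂τ = 0)
    (ho' : ∀ k l, k ≠ l → ∫ x, (f k x - c) * conj (f l x - c) ∂τ' = 0) : τ ⟂ₘ τ' := by
  refine mutuallySingular_of_forall_exists fun ε hε => ?_
  have hδ : 0 < ‖c‖ / 2 := by positivity
  have e1 := measure_norm_average_ge_le τ f hf h1 ho hδ hε
  have e2 := measure_norm_average_ge_le τ' (fun k x => f k x - c) (fun k => (hf k).sub_const c)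
    (C := 1 + ‖c‖) (fun k x => (norm_sub_le _ _).trans (by gcongr; exact h1 k x)) ho' hδ hε
  obtain ⟨N, hN1, hN2⟩ := (e1.and e2).exists
  refine ⟨_, hN1, (measure_mono fun x hx => ?_).trans hN2⟩
  simp only [mem_compl_iff, mem_ofPred_eq, not_le, Finset.sum_sub_distrib, Finset.sum_const,
    Finset.card_range, nsmul_eq_mul] at hx ⊢
  have := norm_sub_norm_le ((N : ℂ) * c) (∑ k ∈ Finset.range N, f k x)
  rw [norm_sub_rev] at this
  rw [norm_mul, norm_natCast] at this
  linarith

/-- A finite measure on the line has no atoms if there are times such that the characteristic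
function vanishes on their differences. -/
lemma nullSingletonClass_of_charFun_sub_eq_zero {τ : Measure ℝ} [IsFiniteMeasure τ] (t : ℕ → ℝ)
    (h : ∀ k l, k ≠ l → charFun τ (t k - t l) = 0) : NullSingletonClass τ := by
  refine ⟨fun x₀ => le_antisymm (ENNReal.le_of_forall_pos_le_add fun ε hε _ => ?_) bot_le⟩
  let f : ℕ → ℝ → ℂ := fun k x => exp ((t k * (x - x₀) : ℝ) * I)
  have e1 := measure_norm_average_ge_le τ f (fun k => Continuous.measurable (by fun_prop)) (C := 1)
    (fun k x => (norm_exp_ofReal_mul_I _).le) (fun k l hkl => ?_) one_pos (ε := ε) hε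
  · obtain ⟨N, hN⟩ := e1.exists
    rw [zero_add]
    refine (measure_mono fun x hx => ?_).trans (hN.trans (by simp))
    rw [mem_singleton_iff] at hx
    simp [hx, f]
  · have : ∀ x : ℝ, f k x * conj (f l x) =
        exp (-((t k - t l : ℝ) * x₀ * I)) * exp ((t k - t l : ℝ) * x * I) := fun x => by
      simp only [f]
      rw [← exp_conj, ← exp_add, ← exp_add]
      congr 1
      simp
      ring
    simp only [this]
    rw [integral_const_mul, ← charFun_apply_real, h k l hkl, mul_zero]

/-- Mutual singularity of two finite measures on the line, in terms of their characteristic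
functions along a sequence of times. -/
lemma mutuallySingular_of_charFun {τ τ' : Measure ℝ} [IsFiniteMeasure τ] [IsProbabilityMeasure τ']
    (t : ℕ → ℝ) {c : ℝ} (hc : c ≠ 0) (h : ∀ k l, k ≠ l → charFun τ (t k - t l) = 0)
    (h1 : ∀ k, charFun τ' (t k) = c) (h2 : ∀ k l, k ≠ l → charFun τ' (t k - t l) = c ^ 2) :
    τ ⟂ₘ τ' := by
  have hmul : ∀ (k l : ℕ) (x : ℝ), exp (t k * x * I) * conj (exp (t l * x * I)) =
      exp ((t k - t l : ℝ) * x * I) := fun k l x => by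
    rw [← exp_conj, ← exp_add]
    congr 1
    simp
    ring
  have hi : ∀ u : ℝ, Integrable (fun x : ℝ => exp (u * x * I)) τ' := fun u => by
    refine Integrable.of_bound (C := 1) (Continuous.aestronglyMeasurable (by fun_prop))
      (.of_forall fun x => ?_)
    rw [← ofReal_mul, norm_exp_ofReal_mul_I]
  refine mutuallySingular_of_orthogonal (fun k x => exp (t k * x * I))
    (fun k => Continuous.measurable (by fun_prop)) (fun k x => ?_) (c := c) (by exact_mod_cast hc)
    (fun k l hkl => ?_) (fun k l hkl => ?_)
  · rw [← ofReal_mul, norm_exp_ofReal_mul_I]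
  · simp only [hmul]
    rw [← charFun_apply_real, h k l hkl]
  · have : ∀ x : ℝ, (exp (t k * x * I) - c) * conj (exp (t l * x * I) - (c : ℂ)) =
        exp ((t k - t l : ℝ) * x * I) - c * exp (t k * x * I) - c * exp ((-t l : ℝ) * x * I) +
          c ^ 2 := fun x => by
      rw [← hmul, map_sub, conj_ofReal, ← exp_conj]
      simp only [map_mul, conj_ofReal, conj_I, mul_neg, ofReal_neg, neg_mul]
      ring
    simp only [this]
    have i1 : Integrable (fun x : ℝ => exp ((t k - t l : ℝ) * x * I) - c * exp (t k * x * I)) τ' :=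
      (hi _).sub ((hi _).const_mul _)
    have i2 : Integrable (fun x : ℝ => exp ((t k - t l : ℝ) * x * I) - c * exp (t k * x * I) -
        c * exp ((-t l : ℝ) * x * I)) τ' := i1.sub ((hi _).const_mul _)
    rw [integral_add i2 (integrable_const _), integral_sub i1 ((hi _).const_mul _),
      integral_sub (hi _) ((hi _).const_mul _), integral_const_mul, integral_const_mul,
      ← charFun_apply_real, ← charFun_apply_real, ← charFun_apply_real, charFun_neg, h1, h1,
      h2 k l hkl]
    simp
    ring

end Spectral

/-! ### Scales and digits -/

/-- A rapidly growing sequence of lengths, `scale (k + 1) / scale k → ∞`. -/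
def scale (k : ℕ) : ℝ := (Nat.factorial (k + 20) : ℕ)

/-- Half the height of the `n`-th tower. -/
def hgt (n : ℕ) : ℝ := scale (3 * n)

/-- The distance between the first two copies of the `n`-th tower in the next one. -/
def gapA (n : ℕ) : ℝ := scale (3 * n + 1)

/-- The distance between the last two copies of the `n`-th tower in the next one. -/
def gapB (n : ℕ) : ℝ := scale (3 * n + 2)

lemma scale_succ (k : ℕ) : scale (k + 1) = (k + 21) * scale k := by
  unfold scale
  rw [show k + 1 + 20 = (k + 20) + 1 by ring, Nat.factorial_succ]
  push_cast
  ring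

lemma one_le_scale (k : ℕ) : 1 ≤ scale k := by
  unfold scale
  exact_mod_cast Nat.factorial_pos _

lemma scale_eq (k : ℕ) : scale k = (Nat.factorial (k + 20) : ℕ) := rfl

attribute [irreducible] scale

lemma scale_le (k : ℕ) : 21 * scale k ≤ scale (k + 1) := by
  rw [scale_succ]
  have := one_le_scale k
  nlinarith [(Nat.cast_nonneg k : (0 : ℝ) ≤ k)]

lemma one_le_hgt (n : ℕ) : 1 ≤ hgt n := one_le_scale _

lemma hgt_le_gapA (n : ℕ) : 21 * hgt n ≤ gapA n := scale_le _

lemma gapA_le_gapB (n : ℕ) : 21 * gapA n ≤ gapB n := scale_le _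

lemma gapB_le_hgt (n : ℕ) : 21 * gapB n ≤ hgt (n + 1) := scale_le _

lemma gapA_eq (n : ℕ) : gapA n = (3 * n + 21) * hgt n := by
  unfold gapA hgt
  rw [scale_succ]; push_cast; ring

lemma gapB_eq (n : ℕ) : gapB n = (3 * n + 22) * gapA n := by
  unfold gapA gapB
  rw [scale_succ]; push_cast; ring

lemma hgt_succ_eq (n : ℕ) : hgt (n + 1) = (3 * n + 23) * gapB n := by
  unfold hgt gapB
  rw [show 3 * (n + 1) = 3 * n + 2 + 1 by ring, scale_succ]; push_cast; ring

lemma gapA_pos (n : ℕ) : 0 < gapA n := lt_of_lt_of_le one_pos (one_le_scale _)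

lemma gapB_pos (n : ℕ) : 0 < gapB n := lt_of_lt_of_le one_pos (one_le_scale _)

lemma hgt_pos (n : ℕ) : 0 < hgt n := lt_of_lt_of_le one_pos (one_le_scale _)

lemma hgt_lt_succ (n : ℕ) : hgt n + (gapA n + gapB n) < hgt (n + 1) := by
  have h1 := hgt_le_gapA n
  have h2 := gapA_le_gapB n
  have h3 := gapB_le_hgt n
  have := one_le_hgt n
  linarith

lemma hgt_mono : Monotone hgt :=
  monotone_nat_of_le_succ fun n => by
    have := hgt_lt_succ n
    linarith [gapA_pos n, gapB_pos n]

lemma gapA_mono : Monotone gapA :=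
  monotone_nat_of_le_succ fun n => by
    linarith [gapA_le_gapB n, gapB_le_hgt n, hgt_le_gapA (n + 1), gapA_pos n, gapB_pos n,
      hgt_pos (n + 1)]

/-- The position of the copy with index `p` of the `n`-th tower in the next one. -/
def dig (n : ℕ) : Fin 3 → ℝ := ![0, gapA n, gapA n + gapB n]

@[simp] lemma dig_zero (n : ℕ) : dig n 0 = 0 := rfl
@[simp] lemma dig_one (n : ℕ) : dig n 1 = gapA n := rfl
@[simp] lemma dig_two (n : ℕ) : dig n 2 = gapA n + gapB n := rfl

lemma dig_nonneg (n : ℕ) (p : Fin 3) : 0 ≤ dig n p := by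
  have := gapA_pos n
  have := gapB_pos n
  fin_cases p <;> simp <;> linarith

lemma dig_le (n : ℕ) (p : Fin 3) : dig n p ≤ gapA n + gapB n := by
  have := gapA_pos n
  have := gapB_pos n
  fin_cases p <;> simp <;> linarith

lemma abs_dig_sub_le (n : ℕ) (p q : Fin 3) : |dig n p - dig n q| ≤ gapA n + gapB n := by
  rw [abs_le]
  constructor <;> linarith [dig_nonneg n p, dig_nonneg n q, dig_le n p, dig_le n q]

/-- Distinct differences of positions are at least `gapA n` apart. -/
lemma gapA_le_of_dig_sub_ne (n : ℕ) (p q p' q' : Fin 3)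
    (h : dig n p - dig n q ≠ dig n p' - dig n q') :
    gapA n ≤ |(dig n p - dig n q) - (dig n p' - dig n q')| := by
  have h1 := gapA_pos n
  have h2 := gapA_le_gapB n
  rw [le_abs]
  fin_cases p <;> fin_cases q <;> fin_cases p' <;> fin_cases q' <;>
    simp only [Fin.zero_eta, Fin.mk_one, Fin.reduceFinMk, dig_zero, dig_one, dig_two] at h ⊢ <;>
    first
    | (exfalso; apply h; ring; done)
    | (left; linarith)
    | (right; linarith)

lemma dig_injective (n : ℕ) : Function.Injective (dig n) := by
  intro p q h
  have h1 := gapA_pos n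
  have h2 := gapB_pos n
  fin_cases p <;> fin_cases q <;>
    simp only [Fin.zero_eta, Fin.mk_one, Fin.reduceFinMk, dig_zero, dig_one, dig_two] at h ⊢ <;>
    linarith

lemma sum_gap_le (N : ℕ) : ∑ i ∈ Finset.range N, (gapA i + gapB i) ≤ hgt N / 5 := by
  induction N with
  | zero => simpa using div_nonneg (hgt_pos 0).le (by norm_num)
  | succ N ih =>
    rw [Finset.sum_range_succ]
    linarith [hgt_le_gapA N, gapA_le_gapB N, gapB_le_hgt N, hgt_pos N]

lemma sum_Ico_gap_le (n N : ℕ) : ∑ i ∈ Finset.Ico n N, (gapA i + gapB i) ≤ hgt N / 5 := by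
  refine le_trans (Finset.sum_le_sum_of_subset_of_nonneg (t := Finset.range N) ?_ ?_) (sum_gap_le N)
  · intro i hi; simp at hi ⊢; omega
  · intro i _ _; linarith [gapA_pos i, gapB_pos i]

lemma abs_sum_dig_sub_le (n N : ℕ) (c c' : ℕ → Fin 3) :
    |∑ i ∈ Finset.Ico n N, (dig i (c' i) - dig i (c i))| ≤ hgt N / 5 :=
  (Finset.abs_sum_le_sum_abs _ _).trans
    ((Finset.sum_le_sum fun i _ => abs_dig_sub_le i _ _).trans (sum_Ico_gap_le n N))

/-- Sums of digit differences determine the differences: two such sums, over digits from `n` on,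
which are closer than `4/5 * gapA n` are equal term by term. -/
lemma dig_sub_eq_of_abs_sum_lt {n N : ℕ} (c c' D D' : ℕ → Fin 3)
    (h : |∑ i ∈ Finset.Ico n N, (dig i (c' i) - dig i (c i)) -
      ∑ i ∈ Finset.Ico n N, (dig i (D' i) - dig i (D i))| < 4 / 5 * gapA n) :
    ∀ i, n ≤ i → i < N → dig i (c' i) - dig i (c i) = dig i (D' i) - dig i (D i) := by
  induction N with
  | zero => intro i _ hi; omega
  | succ N ih =>
    intro i hni hiN
    have hnN : n ≤ N := by omega
    rw [Finset.sum_Ico_succ_top hnN, Finset.sum_Ico_succ_top hnN] at h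
    have htop : dig N (c' N) - dig N (c N) = dig N (D' N) - dig N (D N) := by
      by_contra hne
      have h1 := gapA_le_of_dig_sub_ne N _ _ _ _ hne
      have h2 := abs_sum_dig_sub_le n N c c'
      have h3 := abs_sum_dig_sub_le n N D D'
      have h4 := gapA_mono hnN
      have h5 := hgt_le_gapA N
      have h6 := hgt_pos N
      rw [abs_lt] at h
      rw [abs_le] at h2 h3
      rw [le_abs] at h1
      rcases h1 with h1 | h1 <;> linarith
    rw [htop, add_sub_add_right_eq_sub] at h
    rcases Nat.lt_succ_iff_lt_or_eq.1 hiN with hi | rfl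
    · exact ih h i hni hi
    · exact htop

/-! ### The group action and its fundamental domain -/

/-- The space of digit sequences and positions. -/
abbrev Om : Type := (ℕ → Fin 3) × ℝ

/-- The group of finitely supported digit changes. -/
abbrev Dig : Type := ℕ →₀ Fin 3

/-- The change of position which compensates the digit change `g`. -/
def shift (g : Dig) (c : ℕ → Fin 3) : ℝ :=
  g.sum fun i x => dig i (c i) - dig i (c i + x)

lemma shift_eq (g : Dig) (c : ℕ → Fin 3) (s : Finset ℕ) (h : g.support ⊆ s) :
    shift g c = ∑ i ∈ s, (dig i (c i) - dig i (c i + g i)) :=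
  Finsupp.sum_of_support_subset g h _ (by simp)

/-- Finitely supported digit changes act on digits and positions, preserving the total position. -/
instance : AddAction Dig Om where
  vadd g x := (x.1 + g, x.2 + shift g x.1)
  zero_vadd x := by
    change (x.1 + ⇑(0 : Dig), x.2 + shift 0 x.1) = x
    simp [shift]
  add_vadd g g' x := by
    change (x.1 + ⇑(g + g'), x.2 + shift (g + g') x.1) =
      (x.1 + ⇑g' + ⇑g, x.2 + shift g' x.1 + shift g (x.1 + ⇑g'))
    classical
    have h1 : (g + g').support ⊆ g.support ∪ g'.support := Finsupp.support_add
    refine Prod.ext ?_ ?_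
    · simp only [Finsupp.coe_add]
      abel
    · simp only
      rw [shift_eq _ _ _ h1, shift_eq g _ _ Finset.subset_union_left,
        shift_eq g' _ _ Finset.subset_union_right, add_assoc, ← Finset.sum_add_distrib]
      congr 1
      refine Finset.sum_congr rfl fun i _ => ?_
      simp only [Finsupp.coe_add, Pi.add_apply]
      rw [show x.1 i + (g i + g' i) = x.1 i + g' i + g i by abel]
      ring

lemma vadd_def (g : Dig) (x : Om) : g +ᵥ x = (x.1 + ⇑g, x.2 + shift g x.1) := rfl

/-- The position with respect to the `N`-th tower. -/
def pos (N : ℕ) (x : Om) : ℝ := x.2 + ∑ i ∈ Finset.range N, dig i (x.1 i)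

/-- The orbits of the digit changes: two points are in the same orbit if and only if their digits
eventually agree and their positions in one of the high towers agree. -/
lemma exists_vadd_eq_iff (x y : Om) : (∃ g : Dig, g +ᵥ x = y) ↔
    ∃ M, (∀ i, M ≤ i → x.1 i = y.1 i) ∧ pos M x = pos M y := by
  classical
  constructor
  · rintro ⟨g, rfl⟩
    obtain ⟨M, hM⟩ := g.support.exists_nat_subset_range
    refine ⟨M, fun i hi => ?_, ?_⟩
    · have : g i = 0 := by
        by_contra h
        have := hM (Finsupp.mem_support_iff.2 h)
        simp at this; omega
      simp [vadd_def, this]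
    · simp only [pos, vadd_def, shift_eq g _ _ hM, Pi.add_apply, Finset.sum_sub_distrib]
      ring
  · rintro ⟨M, h1, h2⟩
    let g : Dig := Finsupp.onFinset (Finset.range M) (fun i => y.1 i - x.1 i) (by
      intro i hi
      by_contra h
      simp at h
      exact hi (by rw [h1 i h, sub_self]))
    have hg : g.support ⊆ Finset.range M := Finsupp.support_onFinset_subset
    have hg' : x.1 + ⇑g = y.1 := by
      ext1 i
      simp [g]
    refine ⟨g, Prod.ext hg' ?_⟩
    simp only [vadd_def, shift_eq g _ _ hg]
    have : ∀ i, x.1 i + g i = y.1 i := fun i => congrFun hg' i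
    simp only [this, pos, Finset.sum_sub_distrib] at h2 ⊢
    linarith

/-- Equivalent points are related at all large levels. -/
lemma vadd_spec (g : Dig) (x : Om) : ∃ M, ∀ N, M ≤ N →
    (∀ i, N ≤ i → x.1 i = (g +ᵥ x).1 i) ∧ pos N x = pos N (g +ᵥ x) := by
  obtain ⟨M, h1, h2⟩ := (exists_vadd_eq_iff x (g +ᵥ x)).1 ⟨g, rfl⟩
  refine ⟨M, fun N hN => ⟨fun i hi => h1 i (hN.trans hi), ?_⟩⟩
  simp only [pos] at h2 ⊢
  rw [← Finset.sum_range_add_sum_Ico _ hN, ← Finset.sum_range_add_sum_Ico _ hN, ← add_assoc,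
    ← add_assoc, h2]
  congr 1
  exact Finset.sum_congr rfl fun i hi => by rw [h1 i (Finset.mem_Ico.1 hi).1]

/-- The `n`-th tower. -/
def tower (n : ℕ) : Set Om := {x | (∀ i < n, x.1 i = 0) ∧ x.2 ∈ Ico (-hgt n) (hgt n)}

/-- The points equivalent to a point of `S`. -/
def sat (S : Set Om) : Set Om := ⋃ g : Dig, (fun x => g +ᵥ x) ⁻¹' S

lemma mem_sat {S : Set Om} {x : Om} : x ∈ sat S ↔ ∃ g : Dig, g +ᵥ x ∈ S := by
  simp [sat]

lemma subset_sat (S : Set Om) : S ⊆ sat S := fun x hx => mem_sat.2 ⟨0, by simpa using hx⟩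

lemma vadd_mem_sat {S : Set Om} (g : Dig) {x : Om} : g +ᵥ x ∈ sat S ↔ x ∈ sat S := by
  simp only [mem_sat]
  constructor
  · rintro ⟨g', h⟩
    exact ⟨g' + g, by rwa [add_vadd]⟩
  · rintro ⟨g', h⟩
    exact ⟨g' - g, by rwa [← add_vadd, sub_add_cancel]⟩

lemma sat_mono {S T : Set Om} (h : S ⊆ sat T) : sat S ⊆ sat T := by
  intro x hx
  obtain ⟨g, hg⟩ := mem_sat.1 hx
  exact (vadd_mem_sat g).1 (h hg)

/-- The positions of equivalent points differ by a sum of digit differences. -/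
lemma snd_sub_snd_eq {n : ℕ} {g : Dig} {x : Om} (h : ∀ i < n, x.1 i = (g +ᵥ x).1 i) :
    ∃ M, ∀ N, M ≤ N → (∀ i, N ≤ i → x.1 i = (g +ᵥ x).1 i) ∧
      x.2 - (g +ᵥ x).2 = ∑ i ∈ Finset.Ico n N, (dig i ((g +ᵥ x).1 i) - dig i (x.1 i)) := by
  obtain ⟨M, hM⟩ := vadd_spec g x
  refine ⟨max M n, fun N hN => ⟨(hM N (le_of_max_le_left hN)).1, ?_⟩⟩
  have h2 := (hM N (le_of_max_le_left hN)).2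
  simp only [pos] at h2
  have hn : n ≤ N := le_of_max_le_right hN
  rw [← Finset.sum_range_add_sum_Ico _ hn, ← Finset.sum_range_add_sum_Ico _ hn] at h2
  have h3 : ∑ i ∈ Finset.range n, dig i (x.1 i) = ∑ i ∈ Finset.range n, dig i ((g +ᵥ x).1 i) :=
    Finset.sum_congr rfl fun i hi => by rw [h i (Finset.mem_range.1 hi)]
  rw [Finset.sum_sub_distrib]
  linarith

/-- Distinct points of a tower are inequivalent. -/
lemma vadd_eq_self_of_mem_tower {n : ℕ} {g : Dig} {x : Om} (hx : x ∈ tower n)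
    (hgx : g +ᵥ x ∈ tower n) : g = 0 := by
  obtain ⟨M, hM⟩ := snd_sub_snd_eq (n := n) (g := g) (x := x)
    (fun i hi => by rw [hx.1 i hi, hgx.1 i hi])
  have heq : ∀ i, (g +ᵥ x).1 i = x.1 i := by
    intro i
    rcases lt_or_ge i n with hi | hi
    · rw [hx.1 i hi, hgx.1 i hi]
    have h1 := (hM (max M (i + 1)) (le_max_left _ _)).2
    refine dig_injective i (sub_eq_zero.1 ?_)
    rw [dig_sub_eq_of_abs_sum_lt (n := n) (N := max M (i + 1)) x.1 (g +ᵥ x).1 0 0 ?_ i hi ?_]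
    · simp
    · rw [← h1]
      simp only [Pi.zero_apply, sub_self, Finset.sum_const_zero, sub_zero]
      have h5 := hgt_le_gapA n
      have h6 := hgt_pos n
      rw [abs_lt]
      constructor <;> linarith [hx.2.1, hx.2.2, hgx.2.1, hgx.2.2]
    · exact lt_of_lt_of_le (Nat.lt_succ_self i) (le_max_right _ _)
  ext1 i
  have := heq i
  simpa [vadd_def] using this

/-- The tower `n + 1` contains a copy of the tower `n` for each value of the digit `n`. -/
lemma tower_subset_sat_succ (n : ℕ) : tower n ⊆ sat (tower (n + 1)) := by
  classical
  intro x hx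
  let y : Om := (Function.update x.1 n 0, x.2 + dig n (x.1 n))
  have hy : y ∈ tower (n + 1) := by
    constructor
    · intro i hi
      rcases Nat.lt_succ_iff_lt_or_eq.1 hi with h | rfl
      · simp [y, Function.update_of_ne h.ne, hx.1 i h]
      · simp [y]
    · have := hgt_lt_succ n
      have := dig_nonneg n (x.1 n)
      have := dig_le n (x.1 n)
      have := gapA_pos n
      have := gapB_pos n
      constructor <;> simp only [y] <;> linarith [hx.2.1, hx.2.2]
  obtain ⟨g, hg⟩ := (exists_vadd_eq_iff x y).2 ⟨n + 1, fun i hi => by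
    simp [y, Function.update_of_ne (show i ≠ n by omega)], by
    simp only [pos, y, Finset.sum_range_succ, Function.update_self, dig_zero]
    have : ∀ i ∈ Finset.range n, dig i (Function.update x.1 n 0 i) = dig i (x.1 i) :=
      fun i hi => by rw [Function.update_of_ne (Finset.mem_range.1 hi).ne]
    rw [Finset.sum_congr rfl this]
    ring⟩
  exact mem_sat.2 ⟨g, hg ▸ hy⟩

lemma sat_tower_mono : Monotone fun n => sat (tower n) :=
  monotone_nat_of_le_succ fun n => sat_mono (tower_subset_sat_succ n)

lemma tendsto_hgt : Filter.Tendsto hgt Filter.atTop Filter.atTop := by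
  refine Filter.tendsto_atTop_mono (f := fun n : ℕ => (n : ℝ)) (fun n => ?_)
    tendsto_natCast_atTop_atTop
  induction n with
  | zero => simpa using (hgt_pos 0).le
  | succ n ih =>
    push_cast
    linarith [hgt_lt_succ n, hgt_le_gapA n, one_le_hgt n, gapB_pos n]

/-- The towers exhaust the space, since the sums of the offsets up to stage `n` are small compared
with `hgt n`. -/
lemma exists_mem_sat_tower (x : Om) : ∃ n, x ∈ sat (tower n) := by
  obtain ⟨n, hn⟩ := (tendsto_hgt.eventually_gt_atTop (2 * |x.2|)).exists
  let y : Om := (fun i => if i < n then 0 else x.1 i, pos n x)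
  have hy : y ∈ tower n := by
    refine ⟨fun i hi => by simp [y, hi], ?_⟩
    have h1 : 0 ≤ ∑ i ∈ Finset.range n, dig i (x.1 i) :=
      Finset.sum_nonneg fun i _ => dig_nonneg i _
    have h2 : ∑ i ∈ Finset.range n, dig i (x.1 i) ≤ hgt n / 5 :=
      (Finset.sum_le_sum fun i _ => dig_le i _).trans (sum_gap_le n)
    simp only [y, pos]
    have := neg_abs_le x.2
    have := le_abs_self x.2
    have := abs_nonneg x.2
    constructor <;> linarith
  obtain ⟨g, hg⟩ := (exists_vadd_eq_iff x y).2 ⟨n, fun i hi => by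
    simp [y, show ¬ i < n by omega], by
    have : ∀ i ∈ Finset.range n, dig i (y.1 i) = 0 :=
      fun i hi => by simp [y, Finset.mem_range.1 hi]
    rw [pos.eq_1 n y, Finset.sum_eq_zero this, add_zero]⟩
  exact ⟨n, mem_sat.2 ⟨g, hg ▸ hy⟩⟩

/-- A set of representatives for the action of the digit changes. -/
def dom : Set Om := ⋃ n, tower n \ ⋃ k : Fin n, sat (tower k)

/-- Every orbit meets the set of representatives exactly once. -/
lemma existsUnique_vadd_mem_dom (x : Om) : ∃! g : Dig, g +ᵥ x ∈ dom := by
  classical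
  have hex := exists_mem_sat_tower x
  let n := Nat.find hex
  obtain ⟨g, hg⟩ := mem_sat.1 (Nat.find_spec hex)
  have hdom : ∀ g' : Dig, g' +ᵥ x ∈ dom ↔ g' +ᵥ x ∈ tower n := by
    intro g'
    simp only [dom, mem_iUnion, mem_sdiff, not_exists, vadd_mem_sat]
    constructor
    · rintro ⟨m, h1, h2⟩
      have hm : x ∈ sat (tower m) := mem_sat.2 ⟨g', h1⟩
      have : n ≤ m := Nat.find_min' hex hm
      rcases this.eq_or_lt with h | h
      · rwa [h]
      · exact absurd (Nat.find_spec hex) (h2 ⟨n, h⟩)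
    · exact fun h => ⟨n, h, fun k => Nat.find_min hex k.2⟩
  refine ⟨g, (hdom g).2 hg, fun g' hg' => ?_⟩
  replace hg' := (hdom g').1 hg'
  have : (g' - g) = 0 := vadd_eq_self_of_mem_tower hg (by rwa [← add_vadd, sub_add_cancel])
  exact sub_eq_zero.1 this

/-! ### The measure space and the flow -/

/-- The uniform probability measure on the three digits. -/
def unif : Measure (Fin 3) := (3 : ℝ≥0∞)⁻¹ • Measure.count

lemma unif_singleton (a : Fin 3) : unif {a} = 3⁻¹ := by
  simp [unif]

instance : IsProbabilityMeasure unif := by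
  constructor
  rw [unif, Measure.smul_apply, smul_eq_mul, Measure.count_univ, ENat.card_eq_coe_fintype_card]
  simpa using ENNReal.inv_mul_cancel (a := 3) (by norm_num) (by norm_num)

lemma unif_map_add (a : Fin 3) : unif.map (fun x => x + a) = unif := by
  refine Measure.ext_of_singleton fun b => ?_
  rw [Measure.map_apply (by fun_prop) (by simp)]
  have : (fun x : Fin 3 => x + a) ⁻¹' {b} = {b - a} := by
    ext x
    exact eq_sub_iff_add_eq.symm
  rw [this, unif_singleton, unif_singleton]

/-- The uniform distribution of a sequence of digits. -/
def digLaw : Measure (ℕ → Fin 3) := Measure.infinitePi fun _ => unif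

instance : IsProbabilityMeasure digLaw := by unfold digLaw; infer_instance

lemma measurePreserving_add_digLaw (e : ℕ → Fin 3) :
    MeasurePreserving (fun c : ℕ → Fin 3 => c + e) digLaw digLaw := by
  have hm : Measurable (fun c : ℕ → Fin 3 => c + e) :=
    measurable_pi_lambda _ fun i =>
      (Measurable.of_discrete (f := fun x : Fin 3 => x + e i)).comp (measurable_pi_apply i)
  refine ⟨hm, ?_⟩
  refine Measure.eq_infinitePi _ fun s t ht => ?_
  rw [Measure.map_apply hm (MeasurableSet.pi s.countable_toSet fun i _ => ht i)]
  have : (fun c : ℕ → Fin 3 => c + e) ⁻¹' Set.pi s t =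
      Set.pi s fun i => (fun x => x + e i) ⁻¹' t i := by
    ext c; simp [Set.mem_pi]
  rw [this, digLaw, Measure.infinitePi_pi _ fun i _ => Measurable.of_discrete (ht i)]
  refine Finset.prod_congr rfl fun i _ => ?_
  rw [← Measure.map_apply Measurable.of_discrete (ht i), unif_map_add]

lemma digLaw_pi_singleton (s : Finset ℕ) (e : ℕ → Fin 3) :
    digLaw {c | ∀ i ∈ s, c i = e i} = (3⁻¹ : ℝ≥0∞) ^ s.card := by
  have : {c : ℕ → Fin 3 | ∀ i ∈ s, c i = e i} = Set.pi s fun i => {e i} := by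
    ext c; simp [Set.mem_pi]
  rw [this, digLaw, Measure.infinitePi_pi _ fun i _ => measurableSet_singleton _]
  simp [unif_singleton]

/-- The product of the uniform distribution of the digits and Lebesgue measure. -/
def mOm : Measure Om := digLaw.prod volume

instance : SigmaFinite mOm := by unfold mOm; infer_instance

lemma measurable_shift (g : Dig) : Measurable (shift g) := by
  unfold shift Finsupp.sum
  refine Finset.measurable_fun_sum _ fun i _ => ?_
  exact (Measurable.of_discrete (f := fun x : Fin 3 => dig i x - dig i (x + g i))).comp
    (measurable_pi_apply i)

lemma measurePreserving_vadd (g : Dig) : MeasurePreserving (fun x : Om => g +ᵥ x) mOm mOm := by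
  refine MeasurePreserving.skew_product (g := fun c r => r + shift g c)
    (measurePreserving_add_digLaw g) ?_ ?_
  · exact measurable_snd.add ((measurable_shift g).comp measurable_fst)
  · exact Filter.Eventually.of_forall fun c => (measurePreserving_add_right volume _).map_eq

instance : MeasurableConstVAdd Dig Om := ⟨fun g => (measurePreserving_vadd g).measurable⟩

instance : VAddInvariantMeasure Dig Om mOm :=
  ⟨fun g _ hs => (measurePreserving_vadd g).measure_preimage hs.nullMeasurableSet⟩

/-- Translation of the position. -/
def trans (t : ℝ) (x : Om) : Om := (x.1, x.2 + t)

lemma vadd_trans (g : Dig) (t : ℝ) (x : Om) : g +ᵥ trans t x = trans t (g +ᵥ x) := by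
  simp only [vadd_def, trans]
  exact Prod.ext rfl (by ring)

lemma trans_trans (s t : ℝ) (x : Om) : trans s (trans t x) = trans (s + t) x :=
  Prod.ext rfl (by simp only [trans]; ring)

lemma measurePreserving_trans (t : ℝ) : MeasurePreserving (trans t) mOm mOm :=
  (MeasurePreserving.id digLaw).prod (measurePreserving_add_right volume t)

lemma measurableSet_tower (n : ℕ) : MeasurableSet (tower n) := by
  unfold tower
  refine MeasurableSet.inter ?_ (measurable_snd measurableSet_Ico)
  have : {x : Om | ∀ i < n, x.1 i = 0} = ⋂ i, ⋂ (_ : i < n), {x : Om | x.1 i = 0} := by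
    ext; simp
  rw [show (fun x : Om => ∀ i < n, x.1 i = 0) = {x : Om | ∀ i < n, x.1 i = 0} from rfl, this]
  refine MeasurableSet.iInter fun i => MeasurableSet.iInter fun _ => ?_
  exact ((measurable_pi_apply i).comp measurable_fst) (measurableSet_singleton 0)

lemma measurableSet_sat {S : Set Om} (hS : MeasurableSet S) : MeasurableSet (sat S) :=
  MeasurableSet.iUnion fun g => (measurePreserving_vadd g).measurable hS

lemma measurableSet_dom : MeasurableSet dom :=
  MeasurableSet.iUnion fun n => (measurableSet_tower n).diff
    (MeasurableSet.iUnion fun k => measurableSet_sat (measurableSet_tower k))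

/-- The phase space of the rank one flow. -/
abbrev Space : Type := dom

instance : StandardBorelSpace Space := measurableSet_dom.standardBorel

/-- The representative of a point. -/
def retr (x : Om) : Space :=
  ⟨(existsUnique_vadd_mem_dom x).choose +ᵥ x, (existsUnique_vadd_mem_dom x).choose_spec.1⟩

lemma exists_vadd_eq_retr (x : Om) : ∃ g : Dig, g +ᵥ x = (retr x : Om) := ⟨_, rfl⟩

lemma retr_eq_of_mem {x : Om} {g : Dig} (h : g +ᵥ x ∈ dom) : (retr x : Om) = g +ᵥ x := by
  have := (existsUnique_vadd_mem_dom x).choose_spec.2 g h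
  rw [retr, this]

lemma retr_vadd (g : Dig) (x : Om) : retr (g +ᵥ x) = retr x := by
  obtain ⟨g', hg'⟩ := exists_vadd_eq_retr (g +ᵥ x)
  refine Subtype.ext ?_
  rw [← hg', ← add_vadd, retr_eq_of_mem (g := g' + g)]
  rw [add_vadd, hg']
  exact (retr (g +ᵥ x)).2

lemma retr_coe (z : Space) : retr (z : Om) = z := by
  refine Subtype.ext ?_
  rw [retr_eq_of_mem (g := 0)] <;> simp

lemma retr_eq_iff {x y : Om} : retr x = retr y ↔ ∃ g : Dig, g +ᵥ x = y := by
  constructor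
  · intro h
    obtain ⟨g, hg⟩ := exists_vadd_eq_retr x
    obtain ⟨g', hg'⟩ := exists_vadd_eq_retr y
    refine ⟨-g' + g, ?_⟩
    rw [add_vadd, hg, h, ← hg', neg_vadd_vadd]
  · rintro ⟨g, rfl⟩
    exact (retr_vadd g x).symm

lemma measurable_retr : Measurable retr := by
  intro S hS
  obtain ⟨T, hT, rfl⟩ := hS
  have : retr ⁻¹' (Subtype.val ⁻¹' T) = sat (T ∩ dom) := by
    ext x
    simp only [mem_preimage, mem_sat]
    constructor
    · intro h
      obtain ⟨g, hg⟩ := exists_vadd_eq_retr x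
      exact ⟨g, hg ▸ ⟨h, (retr x).2⟩⟩
    · rintro ⟨g, h1, h2⟩
      rwa [retr_eq_of_mem h2]
  rw [this]
  exact measurableSet_sat (hT.inter measurableSet_dom)

lemma retr_trans_retr (t : ℝ) (x : Om) : retr (trans t (retr x)) = retr (trans t x) := by
  obtain ⟨g, hg⟩ := exists_vadd_eq_retr x
  rw [← hg, ← vadd_trans, retr_vadd]

/-- The rank one flow. -/
def flow (t : ℝ) (z : Space) : Space := retr (trans t z)

/-- The invariant measure of the rank one flow. -/
def mSpace : Measure Space := mOm.comap Subtype.val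

lemma flow_retr (t : ℝ) (x : Om) : flow t (retr x) = retr (trans t x) := retr_trans_retr t x

lemma flow_zero : flow 0 = id := by
  ext1 z
  simp only [flow, trans, add_zero, id]
  exact retr_coe z

lemma flow_add (s t : ℝ) : flow (s + t) = flow s ∘ flow t := by
  ext1 z
  change retr _ = retr _
  rw [flow, retr_trans_retr, trans_trans]

lemma flow_flow (s t : ℝ) (z : Space) : flow s (flow t z) = flow (s + t) z :=
  (congrFun (flow_add s t) z).symm

lemma measurable_flow_uncurry : Measurable (Function.uncurry flow) := by
  refine measurable_retr.comp ?_
  have h : Measurable fun p : ℝ × Space => (p.2 : Om) := measurable_subtype_coe.comp measurable_snd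
  exact (measurable_fst.comp h).prodMk ((measurable_snd.comp h).add measurable_fst)

lemma measurable_flow (t : ℝ) : Measurable (flow t) :=
  measurable_retr.comp ((measurePreserving_trans t).measurable.comp measurable_subtype_coe)

lemma isAddFundamentalDomain_dom : IsAddFundamentalDomain Dig dom mOm :=
  .mk' measurableSet_dom.nullMeasurableSet existsUnique_vadd_mem_dom

lemma image_val_eq (B : Set Space) : Subtype.val '' B = retr ⁻¹' B ∩ dom := by
  ext x
  constructor
  · rintro ⟨z, hz, rfl⟩
    exact ⟨by rwa [mem_preimage, retr_coe], z.2⟩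
  · rintro ⟨h1, h2⟩
    refine ⟨⟨x, h2⟩, ?_, rfl⟩
    rwa [mem_preimage, retr_coe ⟨x, h2⟩] at h1

lemma mSpace_apply (B : Set Space) : mSpace B = mOm (retr ⁻¹' B ∩ dom) := by
  rw [mSpace, comap_subtype_coe_apply measurableSet_dom, image_val_eq]

/-- The invariant measure can be computed in any fundamental domain. -/
lemma mOm_retr_preimage_inter {S : Set Om} (hS : IsAddFundamentalDomain Dig S mOm)
    {B : Set Space} (hB : MeasurableSet B) : mOm (retr ⁻¹' B ∩ S) = mSpace B := by
  rw [mSpace_apply]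
  refine hS.measure_set_eq isAddFundamentalDomain_dom (measurable_retr hB) fun g => ?_
  ext x
  simp only [mem_preimage, retr_vadd]

lemma measurePreserving_flow (t : ℝ) : MeasurePreserving (flow t) mSpace mSpace := by
  refine ⟨measurable_flow t, Measure.ext fun B hB => ?_⟩
  rw [Measure.map_apply (measurable_flow t) hB, mSpace_apply]
  have hS : IsAddFundamentalDomain Dig (trans (-t) ⁻¹' dom) mOm := by
    refine .mk' ((measurePreserving_trans _).measurable measurableSet_dom).nullMeasurableSet
      fun x => ?_
    simpa only [mem_preimage, ← vadd_trans] using existsUnique_vadd_mem_dom (trans (-t) x)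
  rw [← mOm_retr_preimage_inter hS hB, ← (measurePreserving_trans t).measure_preimage
    ((measurable_retr hB).inter
      ((measurePreserving_trans _).measurable measurableSet_dom)).nullMeasurableSet]
  congr 1
  ext x
  simp only [mem_inter_iff, mem_preimage, flow_retr, trans_trans, neg_add_cancel]
  simp [trans]

/-- The part of the phase space covered by the `n`-th tower. -/
def level (n : ℕ) : Set Space := {z | (z : Om) ∈ sat (tower n)}

lemma mem_level {n : ℕ} {z : Space} : z ∈ level n ↔ ∃ x ∈ tower n, retr x = z := by
  constructor
  · intro h
    obtain ⟨g, hg⟩ := mem_sat.1 h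
    exact ⟨_, hg, by rw [retr_vadd, retr_coe]⟩
  · rintro ⟨x, hx, rfl⟩
    obtain ⟨g, hg⟩ := exists_vadd_eq_retr x
    change ((retr x : Space) : Om) ∈ sat (tower n)
    rw [← hg, vadd_mem_sat]
    exact subset_sat _ hx

lemma retr_mem_level {n : ℕ} {x : Om} : retr x ∈ level n ↔ x ∈ sat (tower n) := by
  obtain ⟨g, hg⟩ := exists_vadd_eq_retr x
  change ((retr x : Space) : Om) ∈ sat (tower n) ↔ _
  rw [← hg, vadd_mem_sat]

lemma measurableSet_level (n : ℕ) : MeasurableSet (level n) :=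
  measurable_subtype_coe (measurableSet_sat (measurableSet_tower n))

lemma level_mono : Monotone level := fun _ _ h _ hz => sat_tower_mono h hz

lemma iUnion_level : ⋃ n, level n = univ :=
  eq_univ_of_forall fun z => mem_iUnion.2 (exists_mem_sat_tower z)

lemma isAddFundamentalDomain_tower (n : ℕ) :
    IsAddFundamentalDomain Dig (tower n ∪ dom \ sat (tower n)) mOm := by
  refine .mk' ((measurableSet_tower n).union (measurableSet_dom.diff
    (measurableSet_sat (measurableSet_tower n)))).nullMeasurableSet fun x => ?_
  by_cases hx : x ∈ sat (tower n)
  · have h : ∀ g : Dig, g +ᵥ x ∈ tower n ∪ dom \ sat (tower n) ↔ g +ᵥ x ∈ tower n := fun g => by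
      simp [vadd_mem_sat, hx]
    simp only [h]
    obtain ⟨g, hg⟩ := mem_sat.1 hx
    refine ⟨g, hg, fun g' hg' => ?_⟩
    have : (g' - g) = 0 :=
      vadd_eq_self_of_mem_tower hg (by rw [← add_vadd, sub_add_cancel]; exact hg')
    exact sub_eq_zero.1 this
  · have h : ∀ g : Dig, g +ᵥ x ∈ tower n ∪ dom \ sat (tower n) ↔ g +ᵥ x ∈ dom := fun g => by
      have : g +ᵥ x ∉ tower n := fun h => hx (mem_sat.2 ⟨g, h⟩)
      simp [vadd_mem_sat, hx, this]
    simp only [h]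
    exact existsUnique_vadd_mem_dom x

/-- The `n`-th tower is mapped isomorphically onto the part of the phase space it covers. -/
lemma measurePreserving_retr (n : ℕ) :
    MeasurePreserving retr (mOm.restrict (tower n)) (mSpace.restrict (level n)) := by
  refine ⟨measurable_retr, Measure.ext fun B hB => ?_⟩
  rw [Measure.map_apply measurable_retr hB, Measure.restrict_apply (measurable_retr hB),
    Measure.restrict_apply hB,
    ← mOm_retr_preimage_inter (isAddFundamentalDomain_tower n) (hB.inter (measurableSet_level n))]
  congr 1
  ext x
  simp only [mem_inter_iff, mem_preimage, retr_mem_level, mem_union, mem_sdiff]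
  have := subset_sat (tower n) (a := x)
  tauto

/-- The digit sequences which start with `n` zeros. -/
def cyl (n : ℕ) : Set (ℕ → Fin 3) := {c | ∀ i < n, c i = 0}

lemma digLaw_cyl (n : ℕ) : digLaw (cyl n) = (3⁻¹ : ℝ≥0∞) ^ n := by
  have := digLaw_pi_singleton (Finset.range n) 0
  simpa [cyl] using this

lemma tower_eq (n : ℕ) : tower n = cyl n ×ˢ Ico (-hgt n) (hgt n) := rfl

lemma mSpace_level (n : ℕ) : mSpace (level n) = (3⁻¹ : ℝ≥0∞) ^ n * ENNReal.ofReal (2 * hgt n) := by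
  have := (measurePreserving_retr n).measure_preimage MeasurableSet.univ.nullMeasurableSet
  simp only [preimage_univ, Measure.restrict_apply_univ] at this
  rw [← this, tower_eq, mOm, Measure.prod_prod, digLaw_cyl, Real.volume_Ico]
  congr 2
  ring

lemma mSpace_level_ne_top (n : ℕ) : mSpace (level n) ≠ ∞ := by
  rw [mSpace_level]
  exact ENNReal.mul_ne_top (ENNReal.pow_ne_top (by norm_num)) ENNReal.ofReal_ne_top

instance : SigmaFinite mSpace :=
  ⟨⟨{ set := level
      set_mem := fun _ => trivial
      finite := fun n => (mSpace_level_ne_top n).lt_top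
      spanning := iUnion_level }⟩⟩

/-- The heights grow faster than the bases shrink, so that the quotient space has infinite measure. -/
lemma nine_pow_le_hgt (n : ℕ) : (9 : ℝ) ^ n ≤ hgt n := by
  induction n with
  | zero => simpa using one_le_hgt 0
  | succ n ih =>
    rw [pow_succ]
    linarith [hgt_le_gapA n, gapA_le_gapB n, gapB_le_hgt n, hgt_pos n]

lemma mSpace_univ : mSpace univ = ∞ := by
  refine ENNReal.eq_top_of_forall_nnreal_le fun r => ?_
  obtain ⟨n, hn⟩ := pow_unbounded_of_one_lt (r : ℝ) (show (1 : ℝ) < 3 by norm_num)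
  refine le_trans ?_ (measure_mono (subset_univ (level n)))
  rw [mSpace_level, ← ENNReal.ofReal_coe_nnreal,
    show (3⁻¹ : ℝ≥0∞) ^ n = ENNReal.ofReal ((3 : ℝ)⁻¹ ^ n) by
      rw [ENNReal.ofReal_pow (by norm_num), ENNReal.ofReal_inv_of_pos (by norm_num)]; norm_num,
    ← ENNReal.ofReal_mul (by positivity)]
  refine ENNReal.ofReal_le_ofReal ?_
  have h1 := nine_pow_le_hgt n
  have h2 : (3 : ℝ)⁻¹ ^ n * (2 * 9 ^ n) = 2 * 3 ^ n := by
    rw [show (9 : ℝ) = 3 * 3 by norm_num, mul_pow, inv_pow]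
    field_simp
  have h3 : (3 : ℝ)⁻¹ ^ n * (2 * 9 ^ n) ≤ (3 : ℝ)⁻¹ ^ n * (2 * hgt n) := by gcongr
  have h4 : (0 : ℝ) < 3 ^ n := by positivity
  linarith

lemma isMPFlow_flow : IsMPFlow flow mSpace where
  zero := flow_zero
  add := flow_add
  aemeasurable := measurable_flow_uncurry.aemeasurable
  measurePreserving := measurePreserving_flow

/-! ### Return times -/

/-- A point of the `n`-th tower representing `z`, if there is one. -/
def rep (n : ℕ) (z : Space) : Om :=
  open Classical in if h : ∃ x ∈ tower n, retr x = z then h.choose else 0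

lemma rep_mem {n : ℕ} {z : Space} (hz : z ∈ level n) : rep n z ∈ tower n := by
  have h := mem_level.1 hz
  rw [rep, dif_pos h]
  exact h.choose_spec.1

lemma retr_rep {n : ℕ} {z : Space} (hz : z ∈ level n) : retr (rep n z) = z := by
  have h := mem_level.1 hz
  rw [rep, dif_pos h]
  exact h.choose_spec.2

/-- A time which connects two points of the `n`-th tower is a sum of digit differences up to the
difference of the positions. -/
lemma time_eq_sum {n : ℕ} {x y : Om} {u : ℝ} (hx : ∀ i < n, x.1 i = 0) (hy : ∀ i < n, y.1 i = 0)
    (h : retr (trans u x) = retr y) : ∃ M, ∀ N, M ≤ N →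
      u + (x.2 - y.2) = ∑ i ∈ Finset.Ico n N, (dig i (y.1 i) - dig i (x.1 i)) := by
  obtain ⟨g, rfl⟩ := retr_eq_iff.1 h
  obtain ⟨M, hM⟩ := snd_sub_snd_eq (n := n) (g := g) (x := trans u x)
    (fun i hi => by rw [hy i hi]; exact hx i hi)
  refine ⟨M, fun N hN => ?_⟩
  have h2 : x.2 + u - (g +ᵥ trans u x).2 =
    ∑ i ∈ Finset.Ico n N, (dig i ((g +ᵥ trans u x).1 i) - dig i (x.1 i)) := (hM N hN).2
  rw [← h2]
  ring

/-- Return times to the `n`-th tower are governed by one digit of large index. -/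
lemma abs_sub_dig_le {n k : ℕ} (hnk : n ≤ k) {z : Space} {u : ℝ} (hz : z ∈ level n)
    (huz : flow u z ∈ level n) (hu : |u| ≤ gapA (k + 1) / 2) :
    |u - (dig k ((rep n (flow u z)).1 k) - dig k ((rep n z).1 k))| ≤ 3 * hgt k := by
  have hx := rep_mem hz
  have hy := rep_mem huz
  have hxy : retr (trans u (rep n z)) = retr (rep n (flow u z)) := by
    rw [← flow_retr, retr_rep hz, retr_rep huz]
  set x := rep n z
  set y := rep n (flow u z)
  obtain ⟨M, hM⟩ := time_eq_sum hx.1 hy.1 hxy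
  have hN := hM (max M (k + 1)) (le_max_left _ _)
  set N := max M (k + 1)
  have hkN : k + 1 ≤ N := le_max_right _ _
  rw [← Finset.sum_Ico_consecutive _ (show n ≤ k + 1 by omega) hkN,
    Finset.sum_Ico_succ_top hnk] at hN
  have hd : |x.2 - y.2| ≤ 2 * hgt n := by
    rw [abs_le]
    constructor <;> linarith [hx.2.1, hx.2.2, hy.2.1, hy.2.2]
  have hnk' := hgt_mono hnk
  have h1 := abs_sum_dig_sub_le n k x.1 y.1
  -- a change of a digit of index above `k` would move the point by more than `gapA (k + 1) / 2`
  have h2 : ∑ i ∈ Finset.Ico (k + 1) N, (dig i (y.1 i) - dig i (x.1 i)) = 0 := by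
    have h3 := abs_dig_sub_le k (y.1 k) (x.1 k)
    have : ∀ i, k + 1 ≤ i → i < N → dig i (y.1 i) - dig i (x.1 i) = 0 := by
      intro i hi hiN
      rw [dig_sub_eq_of_abs_sum_lt (n := k + 1) (N := N) x.1 y.1 0 0 ?_ i hi hiN]
      · simp
      · simp only [Pi.zero_apply, sub_self, Finset.sum_const_zero, sub_zero]
        have := hgt_lt_succ k
        have := hgt_le_gapA (k + 1)
        have := hgt_pos k
        have := gapA_pos k
        have := gapB_pos k
        rw [abs_le] at hu h1 h3 hd
        rw [abs_lt]
        constructor <;> linarith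
    exact Finset.sum_eq_zero fun i hi => this i (Finset.mem_Ico.1 hi).1 (Finset.mem_Ico.1 hi).2
  rw [h2, add_zero] at hN
  have := hgt_pos k
  rw [abs_le] at h1 hd ⊢
  constructor <;> linarith

/-- There are no return times to the `n`-th tower of intermediate size. -/
lemma abs_le_gapB {n k : ℕ} (hnk : n ≤ k) {z : Space} {u : ℝ} (hz : z ∈ level n)
    (huz : flow u z ∈ level n) (hu : |u| ≤ gapA (k + 1) / 2) : |u| ≤ 2 * gapB k := by
  have h1 := abs_sub_dig_le hnk hz huz hu
  have h2 := abs_dig_sub_le k ((rep n (flow u z)).1 k) ((rep n z).1 k)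
  have h3 := hgt_le_gapA k
  have h4 := gapA_le_gapB k
  have h5 := hgt_pos k
  rw [abs_le] at h1 h2 ⊢
  constructor <;> linarith

lemma eventually_natCast_ge (C : ℝ) : ∀ᶠ k : ℕ in Filter.atTop, C ≤ k :=
  tendsto_natCast_atTop_atTop.eventually_ge_atTop C

/-- Multiples of the heights of the towers are eventually not return times. -/
lemma eventually_flow_notMem_level (n : ℕ) {θ : ℝ} (hθ : θ ≠ 0) :
    ∀ᶠ k in Filter.atTop, ∀ r, hgt (k + 1) / 2 ≤ |r| → |r| ≤ hgt (k + 1) →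
      ∀ z ∈ level n, flow (θ * r) z ∉ level n := by
  have hθ' : 0 < |θ| := abs_pos.2 hθ
  filter_upwards [Filter.eventually_ge_atTop n, eventually_natCast_ge (2 * |θ|),
    eventually_natCast_ge (4 / |θ|)] with k hnk h1 h2 r hr1 hr2 z hz huz
  have h4 := gapA_eq (k + 1)
  have h5 := hgt_succ_eq k
  have h6 := hgt_pos (k + 1)
  have h7 := gapB_pos k
  have h8 := abs_le_gapB hnk hz huz (by
    rw [abs_mul, h4]
    push_cast
    nlinarith [mul_le_mul_of_nonneg_left hr2 hθ'.le])
  rw [abs_mul] at h8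
  rw [div_le_iff₀ hθ'] at h2
  have h9 : 4 * gapB k < |θ| * hgt (k + 1) := by
    rw [h5]
    nlinarith [mul_pos hθ' h7]
  nlinarith [mul_le_mul_of_nonneg_left hr1 hθ'.le]

lemma dig_cases (k : ℕ) (p : Fin 3) :
    dig k p = 0 ∨ dig k p = gapA k ∨ dig k p = gapA k + gapB k := by
  fin_cases p <;> simp

/-- Multiples `s * gapA k` with `s ≠ 1` are eventually not return times. -/
lemma eventually_flow_gapA_notMem_level (n : ℕ) {s : ℝ} (hs : 0 < s) (hs1 : s ≠ 1) :
    ∀ᶠ k in Filter.atTop, ∀ r, |r - gapA k| ≤ hgt k →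
      ∀ z ∈ level n, flow (s * r) z ∉ level n := by
  have hs' : 0 < |s - 1| := abs_pos.2 (sub_ne_zero.2 hs1)
  filter_upwards [Filter.eventually_ge_atTop n, eventually_natCast_ge (2 * s + 10),
    eventually_natCast_ge ((s + 10) / s), eventually_natCast_ge ((s + 10) / |s - 1|)]
    with k hnk h1 h2 h3 r hr z hz huz
  have ha := gapA_eq k
  have hb := gapB_eq k
  have hh := hgt_succ_eq k
  have ha' := gapA_eq (k + 1)
  have p1 := hgt_pos k
  have p2 := gapA_pos k
  have p3 := gapB_pos k
  have p4 := hgt_pos (k + 1)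
  rw [div_le_iff₀ hs] at h2
  rw [div_le_iff₀ hs'] at h3
  have q1 : (s + 10) * hgt k < s * gapA k := by
    rw [ha, ← mul_assoc]
    exact mul_lt_mul_of_pos_right (by linarith) p1
  have q2 : (s + 10) * hgt k < |s - 1| * gapA k := by
    rw [ha, ← mul_assoc]
    exact mul_lt_mul_of_pos_right (by linarith) p1
  have q3 : (2 * s + 10) * gapA k < gapB k := by
    rw [hb]
    exact mul_lt_mul_of_pos_right (by linarith) p2
  have q4 : 21 * gapB k ≤ hgt (k + 1) := gapB_le_hgt k
  have q5 : 21 * hgt (k + 1) ≤ gapA (k + 1) := hgt_le_gapA _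
  have q6 : 21 * hgt k ≤ gapA k := hgt_le_gapA _
  rw [abs_le] at hr
  have r1 : s * r ≤ s * gapA k + s * hgt k := by
    rw [← mul_add]
    exact mul_le_mul_of_nonneg_left (by linarith) hs.le
  have r2 : s * gapA k - s * hgt k ≤ s * r := by
    rw [← mul_sub]
    exact mul_le_mul_of_nonneg_left (by linarith) hs.le
  have r3 : s * hgt k ≤ s * gapA k := mul_le_mul_of_nonneg_left (by linarith) hs.le
  have hpos : 0 < s * r := by linarith
  have hmain := abs_sub_dig_le hnk hz huz (by rw [abs_of_pos hpos]; linarith)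
  rw [abs_le] at hmain
  have key : ∀ p q : Fin 3, ¬ (-(3 * hgt k) ≤ s * r - (dig k p - dig k q) ∧
      s * r - (dig k p - dig k q) ≤ 3 * hgt k) := by
    rintro p q ⟨l1, l2⟩
    have q2' : (s + 10) * hgt k < (s - 1) * gapA k ∨ (s + 10) * hgt k < (1 - s) * gapA k := by
      rcases abs_cases (s - 1) with ⟨h, _⟩ | ⟨h, _⟩
      · left; rwa [h] at q2
      · right; rw [h] at q2; linarith
    have t1 : s * hgt k + 10 * hgt k < s * gapA k := by linarith
    have t2 : s * hgt k + 10 * hgt k < s * gapA k - gapA k ∨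
        s * hgt k + 10 * hgt k < gapA k - s * gapA k := q2'.imp (by intro h; linarith)
      (by intro h; linarith)
    have t3 : 2 * (s * gapA k) + 10 * gapA k < gapB k := by linarith
    have t4 : 0 < s * hgt k := mul_pos hs p1
    clear hmain hz huz q1 q2 q3 ha hb hh ha' h1 h2 h3 hs1 hs' q4 q5 p4 hr q2' hpos
    generalize s * r = X at *
    generalize s * hgt k = Y at *
    generalize s * gapA k = W at *
    rcases dig_cases k p with hp | hp | hp <;> rcases dig_cases k q with hq | hq | hq <;>
      rw [hp, hq] at l1 l2 <;>
      first
      | linarith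
      | (rcases t2 with t2 | t2 <;> linarith)
  exact key _ _ hmain

/-- The flow never visits a tower in the order which is reverse to the order of the copies of the
towers: at time `0`, then after about `gapB k` and after about `gapA k` more. -/
lemma eventually_not_reversed (n : ℕ) {θ₁ θ₂ : ℝ} (h1 : 0 < θ₁) (h2 : θ₁ ≤ θ₂) :
    ∀ᶠ k in Filter.atTop, ∀ u u' : ℝ, θ₁ * gapA k ≤ u → u ≤ θ₂ * gapA k →
      θ₁ * (gapA k + gapB k) ≤ u' → u' ≤ θ₂ * (gapA k + gapB k) →
      ∀ z ∈ level n, flow (-u) z ∈ level n → flow (-u') z ∉ level n := by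
  filter_upwards [Filter.eventually_ge_atTop n, eventually_natCast_ge (2 * θ₂ + 10),
    eventually_natCast_ge (20 / θ₁)] with k hnk h3 h4 u u' l1 l2 l1' l2' z hz huz huz'
  have ha := gapA_eq k
  have hb := gapB_eq k
  have hh := hgt_succ_eq k
  have p1 := hgt_pos k
  have p2 := gapA_pos k
  have p3 := gapB_pos k
  rw [div_le_iff₀ h1] at h4
  have q1 : 10 * hgt k < θ₁ * gapA k := by
    rw [ha, ← mul_assoc]
    exact mul_lt_mul_of_pos_right (by linarith) p1
  have q3 : (θ₂ + 10) * gapA k < gapB k := by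
    rw [hb]
    exact mul_lt_mul_of_pos_right (by linarith) p2
  have q3' : 20 * gapA k < θ₁ * gapB k := by
    rw [hb, ← mul_assoc]
    exact mul_lt_mul_of_pos_right (by linarith) p2
  have q4 : (2 * θ₂ + 10) * gapB k ≤ hgt (k + 1) := by
    rw [hh]
    exact mul_le_mul_of_nonneg_right (by linarith) p3.le
  have q5 : 21 * hgt (k + 1) ≤ gapA (k + 1) := hgt_le_gapA _
  have q6 : 21 * hgt k ≤ gapA k := hgt_le_gapA _
  have q7 : θ₂ * gapA k ≤ θ₂ * gapB k :=
    mul_le_mul_of_nonneg_left (by linarith [gapA_le_gapB k]) (h1.le.trans h2)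
  have hu : 0 < u := lt_of_lt_of_le (by positivity) l1
  have hu' : 0 < u' := lt_of_lt_of_le (by positivity) l1'
  have m1 := abs_sub_dig_le hnk hz huz (by rw [abs_neg, abs_of_pos hu]; linarith)
  have m2 := abs_sub_dig_le hnk hz huz' (by rw [abs_neg, abs_of_pos hu']; linarith)
  rw [abs_le] at m1 m2
  have key : ∀ p q q' : Fin 3, -(3 * hgt k) ≤ -u - (dig k p - dig k q) →
      -u - (dig k p - dig k q) ≤ 3 * hgt k → -(3 * hgt k) ≤ -u' - (dig k q' - dig k q) →
      -u' - (dig k q' - dig k q) ≤ 3 * hgt k → False := by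
    intro p q q' l1 l2 l3 l4
    have t1 : 10 * hgt k < u := by linarith
    have t2 : u + 10 * gapA k < gapB k := by linarith
    have t3 : 11 * gapA k < u' := by linarith [mul_pos h1 p2]
    clear m1 m2 hz huz huz' ha hb hh h3 h4 q1 q3 q3' q4 q5 q7 l1' l2' hu hu'
    rcases dig_cases k p with hp | hp | hp <;> rcases dig_cases k q with hq | hq | hq <;>
      rw [hp, hq] at l1 l2 <;>
      first
      | linarith
      | (rcases dig_cases k q' with hq' | hq' | hq' <;> rw [hq', hq] at l3 l4 <;> linarith)
  exact key _ _ _ m1.1 m1.2 m2.1 m2.2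

/-! ### Ergodicity -/

lemma mOm_retr_preimage_eq_zero {B : Set Space} (h0 : mSpace B = 0) :
    mOm (retr ⁻¹' B) = 0 := by
  refine isAddFundamentalDomain_dom.measure_zero_of_invariant _ (fun g => ?_) ?_
  · ext x
    rw [mem_vadd_set_iff_neg_vadd_mem, mem_preimage, mem_preimage, retr_vadd]
  · rw [← mSpace_apply, h0]

lemma ae_retr {p : Space → Prop} (h : ∀ᵐ z ∂mSpace, p z) : ∀ᵐ x ∂mOm, p (retr x) :=
  mOm_retr_preimage_eq_zero h

lemma mSpace_eq_zero {B : Set Space} (h0 : mOm (retr ⁻¹' B) = 0) : mSpace B = 0 := by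
  rw [mSpace_apply]
  exact measure_mono_null inter_subset_left h0

instance : digLaw.IsAddLeftInvariant :=
  ⟨fun e => by
    have := (measurePreserving_add_digLaw e).map_eq
    simpa only [add_comm] using this⟩

instance : MeasurableAdd₂ (Fin 3) := ⟨.of_discrete⟩
instance : MeasurableNeg (Fin 3) := ⟨.of_discrete⟩

/-- Sets of digit sequences which are invariant under the finitely supported digit changes are null
or conull. -/
lemma digLaw_eq_zero_or (B : Set (ℕ → Fin 3)) (hB : MeasurableSet B)
    (h : ∀ (g : Dig) (c : ℕ → Fin 3), c + ⇑g ∈ B ↔ c ∈ B) : digLaw B = 0 ∨ digLaw Bᶜ = 0 := by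
  have hd : Dense {e : ℕ → Fin 3 | (fun c => e +ᵥ c) ⁻¹' B =ᵐ[digLaw] B} := by
    intro e
    let g (N : ℕ) : Dig := Finsupp.onFinset (Finset.range N) (fun i => if i < N then e i else 0)
      (by intro i hi; by_contra h; simp at h; simp [h] at hi)
    have hg : ∀ N i, g N i = if i < N then e i else 0 := fun _ _ => rfl
    refine mem_closure_of_tendsto (f := fun N => ⇑(g N)) (b := Filter.atTop) ?_
      (Filter.Eventually.of_forall fun N => ?_)
    · rw [tendsto_pi_nhds]
      intro i
      refine tendsto_const_nhds.congr' ?_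
      filter_upwards [Filter.eventually_gt_atTop i] with N hN
      rw [hg, if_pos hN]
    · change (fun c => ⇑(g N) +ᵥ c) ⁻¹' B =ᵐ[digLaw] B
      refine Filter.EventuallyEq.of_eq ?_
      ext c
      have := h (g N) c
      rw [add_comm] at this
      exact this
  have := aeconst_of_dense_setOfPred_preimage_vadd_ae (μ := digLaw) hB.nullMeasurableSet hd
  rw [Filter.eventuallyConst_set'] at this
  rcases this with h | h
  · left; simpa using measure_congr h
  · right
    have := measure_congr h.compl
    simpa using this

lemma trans_mem_iff {A : Set Space} (g : Dig) (c : ℕ → Fin 3) (f : ℝ) :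
    retr (c + ⇑g, f + shift g c) ∈ A ↔ retr (c, f) ∈ A := by
  rw [← retr_vadd g (c, f)]
  rfl

/-- An invariant set is, for almost every digit sequence, null or conull in the position; whether it
is conull is invariant under finite changes of the digits, so that the zero-one law applies. -/
lemma isErgodicFlow_flow : IsErgodicFlow flow mSpace := by
  intro A hA hinv
  have hA' : MeasurableSet (retr ⁻¹' A) := measurable_retr hA
  have h1 : ∀ t, ∀ᵐ x ∂mOm, (retr (trans t x) ∈ A ↔ retr x ∈ A) := fun t => by
    filter_upwards [ae_retr (Filter.eventuallyEq_set.1 (hinv t))] with x hx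
    rwa [mem_preimage, flow_retr] at hx
  have hmeas : MeasurableSet {p : ℝ × Om | retr (trans p.1 p.2) ∈ A ↔ retr p.2 ∈ A} := by
    have e1 : Measurable fun p : ℝ × Om => trans p.1 p.2 :=
      (measurable_fst.comp measurable_snd).prodMk
        ((measurable_snd.comp measurable_snd).add measurable_fst)
    exact MeasurableSet.iff (measurable_retr.comp e1 hA) (measurable_retr.comp measurable_snd hA)
  -- interchange the exceptional sets of points and of times by Fubini's theorem
  have h2 : ∀ᵐ x ∂mOm, ∀ᵐ t : ℝ, (retr (trans t x) ∈ A ↔ retr x ∈ A) :=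
    (Measure.ae_ae_comm hmeas).1 (Filter.Eventually.of_forall h1)
  have h3 := Measure.ae_ae_of_ae_prod h2
  have h4 : ∀ᵐ c ∂digLaw, (∀ᵐ f : ℝ, retr (c, f) ∈ A) ∨ (∀ᵐ f : ℝ, retr (c, f) ∉ A) := by
    filter_upwards [h3] with c hc
    obtain ⟨f₀, hf₀⟩ := hc.exists
    have h5 : ∀ᵐ f : ℝ, (retr (c, f) ∈ A ↔ retr (c, f₀) ∈ A) := by
      have := (measurePreserving_sub_right volume f₀).quasiMeasurePreserving.ae hf₀
      filter_upwards [this] with f hf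
      simpa [trans] using hf
    by_cases h : retr (c, f₀) ∈ A
    · exact Or.inl (h5.mono fun f hf => hf.2 h)
    · exact Or.inr (h5.mono fun f hf => fun h' => h (hf.1 h'))
  have hB : MeasurableSet {c : ℕ → Fin 3 | ∀ᵐ f : ℝ, retr (c, f) ∈ A} := by
    have := measurable_measure_prodMk_left (ν := (volume : Measure ℝ)) hA'.compl
    exact this (measurableSet_singleton 0)
  have hBinv : ∀ (g : Dig) (c : ℕ → Fin 3), c + ⇑g ∈ {c : ℕ → Fin 3 | ∀ᵐ f : ℝ, retr (c, f) ∈ A} ↔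
      c ∈ {c : ℕ → Fin 3 | ∀ᵐ f : ℝ, retr (c, f) ∈ A} := by
    intro g c
    simp only [mem_ofPred_eq]
    constructor
    · intro h
      have := (measurePreserving_add_right volume (shift g c)).quasiMeasurePreserving.ae h
      exact this.mono fun f hf => (trans_mem_iff g c f).1 hf
    · intro h
      have := (measurePreserving_sub_right volume (shift g c)).quasiMeasurePreserving.ae h
      filter_upwards [this] with f hf
      have := (trans_mem_iff g c _).2 hf
      rwa [sub_add_cancel] at this
  rcases digLaw_eq_zero_or _ hB hBinv with h | h
  · left
    refine mSpace_eq_zero ((Measure.measure_prod_null hA').2 ?_)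
    filter_upwards [h4, measure_eq_zero_iff_ae_notMem.1 h] with c hc hc'
    exact measure_eq_zero_iff_ae_notMem.2 (hc.resolve_left hc')
  · right
    refine mSpace_eq_zero ((Measure.measure_prod_null hA'.compl).2 ?_)
    filter_upwards [measure_eq_zero_iff_ae_notMem.1 h] with c hc
    exact not_not.1 hc

/-! ### Conservativity -/

/-- Every orbit spends an infinite time in the lowest tower. -/
lemma volume_setOf_flow_mem_level (z : Space) : volume {s : ℝ | flow s z ∈ level 0} = ∞ := by
  classical
  obtain ⟨x, rfl⟩ : ∃ x, retr x = z := ⟨z, retr_coe z⟩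
  -- changing the single digit `k` moves the point by at least `gapB k` into another copy of the
  -- lowest tower; these visits are disjoint for different `k`
  let e : ℕ → Fin 3 := fun k => if x.1 k = 2 then 0 else 2
  let δ : ℕ → ℝ := fun k => dig k (e k) - dig k (x.1 k)
  have he : ∀ k, gapB k ≤ |δ k| ∧ |δ k| ≤ gapA k + gapB k := by
    intro k
    refine ⟨?_, abs_dig_sub_le _ _ _⟩
    have h1 := gapA_pos k
    have h2 := gapB_pos k
    simp only [δ, e]
    generalize x.1 k = p
    rw [le_abs]
    fin_cases p
    · left; simp; linarith
    · left; simp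
    · right; simp; linarith
  let J : ℕ → Set ℝ := fun k => Ico (-hgt 0 - x.2 + δ k) (hgt 0 - x.2 + δ k)
  have hJ : ∀ k, J k ⊆ {s : ℝ | flow s (retr x) ∈ level 0} := by
    intro k s hs
    simp only [mem_ofPred_eq, flow_retr]
    refine mem_level.2 ⟨(Function.update x.1 k (e k), x.2 + s - δ k), ⟨by simp, ?_⟩, ?_⟩
    · simp only [J, mem_Ico] at hs
      constructor <;> simp only <;> linarith [hs.1, hs.2]
    · refine (retr_eq_iff.2 ((exists_vadd_eq_iff _ _).2 ⟨k + 1, fun i hi => ?_, ?_⟩)).symm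
      · simp [trans, Function.update_of_ne (show i ≠ k by omega)]
      · simp only [pos, trans, Finset.sum_range_succ, Function.update_self, δ]
        have : ∀ i ∈ Finset.range k, dig i (Function.update x.1 k (e k) i) = dig i (x.1 i) :=
          fun i hi => by rw [Function.update_of_ne (Finset.mem_range.1 hi).ne]
        rw [Finset.sum_congr rfl this]
        ring
  have hlt : ∀ k l, k < l → Disjoint (J k) (J l) := by
    intro k l hkl
    rw [Set.disjoint_left]
    intro s hs hs'
    simp only [J, mem_Ico] at hs hs'
    have h1 := hgt_mono (show 0 ≤ l by omega)
    have h2 := hgt_mono (show k + 1 ≤ l by omega)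
    have h3 := gapB_le_hgt k
    have h4 := gapA_le_gapB k
    have h5 := hgt_le_gapA l
    have h6 := gapA_le_gapB l
    have h7 := gapB_pos k
    have h8 := hgt_pos l
    have h9 := he k
    have h10 := (he l).1
    rw [abs_le] at h9
    rw [le_abs] at h10
    rcases h10 with h | h <;> linarith [h9.2.1, h9.2.2]
  have hdis : Pairwise (Function.onFun Disjoint J) := by
    intro k l hkl
    rcases lt_or_gt_of_ne hkl with h | h
    · exact hlt k l h
    · exact (hlt l k h).symm
  refine eq_top_iff.2 (le_trans ?_ (measure_mono (iUnion_subset hJ)))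
  rw [measure_iUnion hdis fun k => measurableSet_Ico]
  simp only [J, Real.volume_Ico]
  rw [show (fun k => ENNReal.ofReal (hgt 0 - x.2 + δ k - (-hgt 0 - x.2 + δ k))) =
    fun _ : ℕ => ENNReal.ofReal (2 * hgt 0) by ext k; congr 1; ring]
  rw [ENNReal.tsum_const_eq_top_of_ne_zero]
  simpa using hgt_pos 0

lemma iterate_flow (t : ℝ) (m : ℕ) : (flow t)^[m] = flow (m * t) := by
  induction m with
  | zero => simp [flow_zero]
  | succ m ih =>
    rw [Function.iterate_succ', ih, ← flow_add]
    congr 1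
    push_cast
    ring

/-- A wandering set of positive measure would spend an infinite total time in the lowest tower, but
its disjoint translates fit into that tower, which has finite measure. -/
lemma isConservativeFlow_flow : IsConservativeFlow flow mSpace := by
  intro t ht
  refine ⟨(measurePreserving_flow t).quasiMeasurePreserving, fun A hA hA0 => ?_⟩
  by_contra! hcon
  have hwand : ∀ z ∈ A, ∀ k : ℤ, k ≠ 0 → flow (k * t) z ∉ A := by
    intro z hz k hk hk'
    rcases lt_or_gt_of_ne hk with h | h
    · refine hcon _ hk' k.natAbs (by omega) ?_
      rw [iterate_flow, flow_flow]
      have : ((k.natAbs : ℕ) : ℝ) = -(k : ℝ) := by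
        rw [← Int.cast_natCast, show (k.natAbs : ℤ) = -k by omega, Int.cast_neg]
      rw [this, show -(k : ℝ) * t + k * t = 0 by ring, flow_zero]
      exact hz
    · refine hcon z hz k.natAbs (by omega) ?_
      rw [iterate_flow]
      have : ((k.natAbs : ℕ) : ℝ) = (k : ℝ) := by
        rw [← Int.cast_natCast, show (k.natAbs : ℤ) = k by omega]
      rwa [this]
  have hm : ∀ s, MeasurableSet (flow s ⁻¹' level 0) := fun s =>
    measurable_flow s (measurableSet_level 0)
  have hmj : MeasurableSet {p : ℝ × Space | flow p.1 p.2 ∈ level 0} :=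
    measurable_flow_uncurry (measurableSet_level 0)
  have hr : ∀ s : ℝ, mSpace (A ∩ flow s ⁻¹' level 0) =
      (mSpace.restrict A) (Prod.mk s ⁻¹' {p : ℝ × Space | flow p.1 p.2 ∈ level 0}) := fun s => by
    rw [inter_comm, ← Measure.restrict_apply (hm s)]
    rfl
  -- the total time spent in the lowest tower, integrated over the wandering set
  have h1 : ∫⁻ s : ℝ, mSpace (A ∩ flow s ⁻¹' level 0) = ∞ := by
    simp only [hr]
    rw [← Measure.prod_apply hmj, Measure.prod_apply_symm hmj]
    have : ∀ z : Space, volume ((fun s : ℝ => (s, z)) ⁻¹' {p : ℝ × Space | flow p.1 p.2 ∈ level 0})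
        = ∞ := volume_setOf_flow_mem_level
    simp only [this, lintegral_const, Measure.restrict_apply_univ]
    exact ENNReal.top_mul hA0
  -- split the line into intervals of length `|t|` and use that the translates of `A` by the multiples
  -- of `t` are disjoint
  have h2 : ∫⁻ s : ℝ, mSpace (A ∩ flow s ⁻¹' level 0) ≤ mSpace (level 0) * ENNReal.ofReal |t| := by
    have hfd : IsAddFundamentalDomain (AddSubgroup.zmultiples |t|) (Ioc (0 : ℝ) (0 + |t|)) volume :=
      isAddFundamentalDomain_Ioc (abs_pos.2 ht) 0
    rw [hfd.lintegral_eq_tsum'']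
    rw [← lintegral_tsum (fun g => ?_)]
    swap
    · have := measurable_measure_prodMk_left (ν := mSpace.restrict A) hmj
      have h3 : Measurable fun s : ℝ => mSpace (A ∩ flow s ⁻¹' level 0) := by
        simpa only [hr] using this
      exact (h3.comp (measurable_const_vadd g)).aemeasurable
    refine le_trans (lintegral_mono (g := fun _ => mSpace (level 0)) fun s => ?_) ?_
    · have h3 : ∀ g : AddSubgroup.zmultiples |t|, mSpace (A ∩ flow (g +ᵥ s) ⁻¹' level 0) =
          mSpace (flow (-(g +ᵥ s)) ⁻¹' A ∩ level 0) := fun g => by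
        rw [← (measurePreserving_flow (-(g +ᵥ s))).measure_preimage
          (hA.inter (hm _)).nullMeasurableSet]
        congr 1
        ext z
        simp [flow_flow, flow_zero]
      simp only [h3]
      rw [← measure_iUnion]
      · exact measure_mono (iUnion_subset fun g => inter_subset_right)
      · intro g g' hgg'
        rw [Function.onFun, Set.disjoint_left]
        rintro z ⟨hz, _⟩ ⟨hz', _⟩
        obtain ⟨k, hk⟩ := AddSubgroup.mem_zmultiples_iff.1 (g - g').2
        obtain ⟨j, hj⟩ : ∃ j : ℤ, (j : ℝ) * t = ((g - g' : AddSubgroup.zmultiples |t|) : ℝ) := by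
          rcases abs_choice t with h | h
          · exact ⟨k, by rw [← hk, h]; simp⟩
          · exact ⟨-k, by rw [← hk, h]; simp⟩
        refine hwand _ hz j (fun h0 => hgg' ?_) ?_
        · rw [h0] at hj
          simp only [Int.cast_zero, zero_mul] at hj
          exact sub_eq_zero.1 (Subtype.ext hj.symm)
        · have he : ((g - g' : AddSubgroup.zmultiples |t|) : ℝ) + -(g +ᵥ s) = -(g' +ᵥ s) := by
            simp only [AddSubgroup.vadd_def, vadd_eq_add, AddSubgroup.coe_sub]
            ring
          rw [flow_flow, hj, he]
          exact hz'
      · exact fun g => (measurable_flow _ hA).inter (measurableSet_level 0)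
    · rw [lintegral_const, Measure.restrict_apply_univ, Real.volume_Ioc]
      simp
  rw [h1] at h2
  exact absurd h2 (not_le.2 (ENNReal.mul_lt_top (mSpace_level_ne_top 0).lt_top
    ENNReal.ofReal_lt_top))

/-! ### Bricks -/

/-- The part of the phase space covered by the points of `S`. -/
def cover (S : Set Om) : Set Space := {z | (z : Om) ∈ sat S}

lemma retr_mem_cover {S : Set Om} {x : Om} : retr x ∈ cover S ↔ x ∈ sat S := by
  obtain ⟨g, hg⟩ := exists_vadd_eq_retr x
  change ((retr x : Space) : Om) ∈ sat S ↔ _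
  rw [← hg, vadd_mem_sat]

lemma mem_cover {S : Set Om} {z : Space} : z ∈ cover S ↔ ∃ x ∈ S, retr x = z := by
  constructor
  · intro h
    obtain ⟨g, hg⟩ := mem_sat.1 h
    exact ⟨_, hg, by rw [retr_vadd, retr_coe]⟩
  · rintro ⟨x, hx, rfl⟩
    exact retr_mem_cover.2 (subset_sat _ hx)

lemma cover_eq_image (S : Set Om) : cover S = retr '' S := by
  ext z; exact mem_cover

lemma measurableSet_cover {S : Set Om} (hS : MeasurableSet S) : MeasurableSet (cover S) :=
  measurable_subtype_coe (measurableSet_sat hS)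

lemma cover_mono {S T : Set Om} (h : S ⊆ T) : cover S ⊆ cover T := by
  simp only [cover_eq_image]
  exact image_mono h

open scoped Pointwise in
/-- The projection to the quotient does not increase the measure; it may identify points of `S`. -/
lemma mSpace_cover_le (S : Set Om) : mSpace (cover S) ≤ mOm S := by
  rw [mSpace_apply, isAddFundamentalDomain_dom.measure_eq_tsum S]
  have : retr ⁻¹' cover S ∩ dom ⊆ ⋃ g : Dig, (g +ᵥ S) ∩ dom := by
    rintro x ⟨h1, h2⟩
    obtain ⟨g, hg⟩ := mem_sat.1 (retr_mem_cover.1 h1)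
    exact mem_iUnion.2 ⟨-g, ⟨_, hg, by simp⟩, h2⟩
  exact (measure_mono this).trans (measure_iUnion_le _)

lemma cover_tower (n : ℕ) : cover (tower n) = level n := rfl

/-- Inside a tower, the measure of the covered set is the measure of the set. -/
lemma retr_preimage_cover_inter {n : ℕ} {S : Set Om} (h : S ⊆ tower n) :
    retr ⁻¹' cover S ∩ tower n = S := by
  ext x
  refine ⟨fun ⟨h1, h2⟩ => ?_, fun hx => ⟨retr_mem_cover.2 (subset_sat _ hx), h hx⟩⟩
  obtain ⟨g, hg⟩ := mem_sat.1 (retr_mem_cover.1 h1)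
  have := vadd_eq_self_of_mem_tower h2 (h hg)
  simpa [this] using hg

lemma mSpace_cover {n : ℕ} {S : Set Om} (h : S ⊆ tower n) (hS : MeasurableSet S) :
    mSpace (cover S) = mOm S := by
  have h1 := (measurePreserving_retr n).measure_preimage (measurableSet_cover hS).nullMeasurableSet
  rw [Measure.restrict_apply (measurable_retr (measurableSet_cover hS)),
    retr_preimage_cover_inter h, Measure.restrict_apply (measurableSet_cover hS),
    ← cover_tower, inter_eq_left.2 (cover_mono h)] at h1
  exact h1.symm

lemma flow_mem_cover {t : ℝ} {S : Set Om} {z : Space} :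
    flow t z ∈ cover S ↔ z ∈ cover (trans t ⁻¹' S) := by
  obtain ⟨x, rfl⟩ : ∃ x, retr x = z := ⟨z, retr_coe z⟩
  rw [flow_retr, retr_mem_cover, retr_mem_cover, mem_sat, mem_sat]
  simp only [vadd_trans, mem_preimage]

/-- The set of points of `Om` over the cylinder of order `n` with position in `[p, q)`. -/
def box (n : ℕ) (p q : ℝ) : Set Om := cyl n ×ˢ Ico p q

/-- The part of the phase space covered by `box n p q`. -/
def brick (n : ℕ) (p q : ℝ) : Set Space := cover (box n p q)

lemma measurableSet_cyl (n : ℕ) : MeasurableSet (cyl n) := by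
  have : cyl n = ⋂ i, ⋂ (_ : i < n), {c : ℕ → Fin 3 | c i = 0} := by
    ext; simp [cyl]
  rw [this]
  exact MeasurableSet.iInter fun i => MeasurableSet.iInter fun _ =>
    (measurable_pi_apply i) (measurableSet_singleton 0)

lemma measurableSet_box (n : ℕ) (p q : ℝ) : MeasurableSet (box n p q) :=
  (measurableSet_cyl n).prod measurableSet_Ico

lemma measurableSet_brick (n : ℕ) (p q : ℝ) : MeasurableSet (brick n p q) :=
  measurableSet_cover (measurableSet_box n p q)

lemma mOm_prod_le (n : ℕ) (I : Set ℝ) : mOm (cyl n ×ˢ I) ≤ volume I := by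
  rw [mOm, Measure.prod_prod]
  exact mul_le_of_le_one_left' prob_le_one

lemma mSpace_brick_ne_top (n : ℕ) (p q : ℝ) : mSpace (brick n p q) ≠ ∞ :=
  ne_top_of_le_ne_top (by simp) ((mSpace_cover_le _).trans (mOm_prod_le n _))

lemma flow_preimage_brick (t : ℝ) (n : ℕ) (p q : ℝ) :
    flow t ⁻¹' brick n p q = brick n (p - t) (q - t) := by
  ext z
  rw [mem_preimage, brick, flow_mem_cover, brick]
  have : trans t ⁻¹' box n p q = box n (p - t) (q - t) := by
    ext x
    simp only [trans, box, mem_preimage, mem_prod, mem_Ico, sub_le_iff_le_add, lt_sub_iff_add_lt]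
  rw [this]

lemma box_subset_tower {n : ℕ} {p q : ℝ} (hp : -hgt n ≤ p) (hq : q ≤ hgt n) :
    box n p q ⊆ tower n := by
  rw [tower_eq]
  exact prod_mono_right (Ico_subset_Ico hp hq)

lemma brick_subset_level {n : ℕ} {p q : ℝ} (hp : -hgt n ≤ p) (hq : q ≤ hgt n) :
    brick n p q ⊆ level n := cover_mono (box_subset_tower hp hq)

/-- Translated bricks which together fit into a tower are disjoint. -/
lemma disjoint_brick {n : ℕ} {p q q' r : ℝ} (h1 : q ≤ q')
    (h2 : r ≤ p + 2 * hgt n) : Disjoint (brick n p q) (brick n q' r) := by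
  by_cases hpq : p < q
  swap
  · have : Ico p q = ∅ := Ico_eq_empty hpq
    simp [brick, box, this, cover_eq_image]
  by_cases hqr : q' < r
  swap
  · have : Ico q' r = ∅ := Ico_eq_empty hqr
    simp [brick, box, this, cover_eq_image]
  rw [Set.disjoint_left]
  intro z hz hz'
  obtain ⟨x, hx, rfl⟩ := mem_cover.1 hz
  obtain ⟨y, hy, hxy⟩ := mem_cover.1 hz'
  obtain ⟨g, rfl⟩ := retr_eq_iff.1 hxy.symm
  have h3 : trans (-(p + hgt n)) x ∈ tower n := by
    refine ⟨hx.1, ?_⟩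
    have := hx.2
    simp only [trans, mem_Ico] at this ⊢
    constructor <;> linarith
  have h4 : g +ᵥ trans (-(p + hgt n)) x ∈ tower n := by
    rw [vadd_trans]
    refine ⟨hy.1, ?_⟩
    have := hy.2
    simp only [trans, mem_Ico] at this ⊢
    constructor <;> linarith
  have h5 := vadd_eq_self_of_mem_tower h3 h4
  have h6 := hy.2
  simp only [h5, zero_vadd, mem_Ico] at h6
  have h7 := hx.2
  simp only [mem_Ico] at h7
  linarith

/-- The first digits of a point can be replaced by zeros when the position is changed accordingly. -/
lemma cover_prefix (N : ℕ) (e : ℕ → Fin 3) (I : Set ℝ) :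
    cover ({c | ∀ i < N, c i = e i} ×ˢ I) =
      cover (cyl N ×ˢ ((fun f => f - ∑ i ∈ Finset.range N, dig i (e i)) ⁻¹' I)) := by
  ext z
  rw [mem_cover, mem_cover]
  constructor
  · rintro ⟨⟨c, f⟩, ⟨hc, hf⟩, rfl⟩
    refine ⟨(fun i => if i < N then 0 else c i, f + ∑ i ∈ Finset.range N, dig i (e i)),
      ⟨fun i hi => if_pos hi, ?_⟩, ?_⟩
    · simpa using hf
    · refine (retr_eq_iff.2 ((exists_vadd_eq_iff _ _).2 ⟨N, fun i hi => ?_, ?_⟩)).symm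
      · simp [not_lt.2 hi]
      · simp only [pos]
        have e1 : ∑ i ∈ Finset.range N, dig i (c i) = ∑ i ∈ Finset.range N, dig i (e i) :=
          Finset.sum_congr rfl fun i hi => congrArg (dig i) (hc i (Finset.mem_range.1 hi))
        rw [e1]
        rw [Finset.sum_eq_zero (s := Finset.range N) (f := fun i => dig i (if i < N then 0 else c i))
          fun i hi => by rw [if_pos (Finset.mem_range.1 hi), dig_zero]]
        ring
  · rintro ⟨⟨c, f⟩, ⟨hc, hf⟩, rfl⟩
    refine ⟨(fun i => if i < N then e i else c i, f - ∑ i ∈ Finset.range N, dig i (e i)),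
      ⟨fun i hi => if_pos hi, hf⟩, ?_⟩
    refine (retr_eq_iff.2 ((exists_vadd_eq_iff _ _).2 ⟨N, fun i hi => ?_, ?_⟩)).symm
    · simp [not_lt.2 hi]
    · simp only [pos]
      have e1 : ∑ i ∈ Finset.range N, dig i (c i) = 0 :=
        Finset.sum_eq_zero fun i hi => by
          rw [show c i = 0 from hc i (Finset.mem_range.1 hi), dig_zero]
      rw [e1]
      rw [Finset.sum_congr (s₁ := Finset.range N) (f := fun i => dig i (if i < N then e i else c i))
        rfl fun i hi => by rw [if_pos (Finset.mem_range.1 hi)]]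
      ring

/-- Every brick splits into three bricks of the next order. -/
lemma brick_eq_iUnion (n : ℕ) (p q : ℝ) :
    brick n p q = ⋃ a : Fin 3, brick (n + 1) (p + dig n a) (q + dig n a) := by
  have h1 : box n p q = ⋃ a : Fin 3,
      {c : ℕ → Fin 3 | ∀ i < n + 1, c i = Pi.single (M := fun _ => Fin 3) n a i} ×ˢ Ico p q := by
    ext x
    simp only [box, mem_iUnion, mem_prod, exists_and_right]
    refine and_congr_left fun _ => ⟨fun h => ⟨x.1 n, fun i hi => ?_⟩, fun ⟨a, h⟩ i hi => ?_⟩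
    · rcases Nat.lt_succ_iff_lt_or_eq.1 hi with hi | rfl
      · rw [Pi.single_eq_of_ne hi.ne, h i hi]
      · rw [Pi.single_eq_same]
    · rw [h i (by omega), Pi.single_eq_of_ne hi.ne]
  have h2 : ∀ a : Fin 3, ∑ i ∈ Finset.range (n + 1), dig i (Pi.single (M := fun _ => Fin 3) n a i) =
      dig n a := fun a => by
    rw [Finset.sum_range_succ, Pi.single_eq_same, Finset.sum_eq_zero, zero_add]
    intro i hi
    rw [Pi.single_eq_of_ne (Finset.mem_range.1 hi).ne, dig_zero]
  rw [brick, h1, cover_eq_image, image_iUnion]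
  refine iUnion_congr fun a => ?_
  rw [← cover_eq_image, cover_prefix, h2, brick, box]
  congr 2
  ext f
  simp only [mem_preimage, mem_Ico]
  constructor <;> rintro ⟨h1, h2⟩ <;> constructor <;> linarith

/-- The splitting of a brick into three is disjoint for bricks which fit into a tower. -/
lemma pairwise_disjoint_brick_succ {n : ℕ} {p q : ℝ} (h : q - p ≤ 2 * hgt n) :
    Pairwise (Function.onFun Disjoint
      fun a : Fin 3 => brick (n + 1) (p + dig n a) (q + dig n a)) := by
  have h1 := hgt_le_gapA n
  have h2 := gapA_le_gapB n
  have h3 := hgt_lt_succ n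
  have h4 := hgt_pos n
  have key : ∀ a b : Fin 3, a < b →
      Disjoint (brick (n + 1) (p + dig n a) (q + dig n a))
        (brick (n + 1) (p + dig n b) (q + dig n b)) := by
    intro a b hab
    refine disjoint_brick ?_ ?_ <;>
      fin_cases a <;> fin_cases b <;> simp at hab ⊢ <;> linarith
  intro a b hab
  rcases lt_or_gt_of_ne hab with h | h
  · exact key a b h
  · exact (key b a h).symm

lemma brick_union {n : ℕ} {p q r : ℝ} (h1 : p ≤ q) (h2 : q ≤ r) :
    brick n p r = brick n p q ∪ brick n q r := by
  simp only [brick, cover_eq_image, ← image_union, box, ← prod_union, Ico_union_Ico_eq_Ico h1 h2]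

/-! ### Correlations of the unit brick -/

/-- The differences of distinct offsets of one stage determine the offsets. -/
lemma eq_of_dig_sub_eq {k : ℕ} {a b a' b' : Fin 3} (hab : a ≠ b)
    (h : dig k a' - dig k b' = dig k a - dig k b) : a' = a ∧ b' = b := by
  have h1 := hgt_le_gapA k
  have h2 := gapA_le_gapB k
  have h4 := hgt_pos k
  fin_cases a <;> fin_cases b <;> first | exact absurd rfl hab | skip
  all_goals
    fin_cases a' <;> fin_cases b' <;> first | exact ⟨rfl, rfl⟩ | (simp at h; exfalso; linarith)

/-- The measure of the intersection of the unit brick with its translate by a sum of digit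
differences. -/
lemma mSpace_brick_inter (N : ℕ) (e e' : ℕ → Fin 3) :
    mSpace (brick 0 0 1 ∩
      flow (∑ i ∈ Finset.range N, (dig i (e' i) - dig i (e i))) ⁻¹' brick 0 0 1) =
      3⁻¹ ^ ((Finset.range N).filter fun i => e i ≠ e' i).card := by
  set t := ∑ i ∈ Finset.range N, (dig i (e' i) - dig i (e i))
  have hsub : box 0 0 1 ⊆ tower 0 :=
    box_subset_tower (by linarith [hgt_pos 0]) (one_le_hgt 0)
  have hcyl : cyl 0 = univ := by simp [cyl]
  set J := (Finset.range N).filter fun i => e i ≠ e' i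
  have h1 : brick 0 0 1 ∩ flow t ⁻¹' brick 0 0 1 =
      cover ({c | ∀ i ∈ J, c i = e i} ×ˢ Ico 0 1) := by
    ext z
    rw [mem_inter_iff, mem_preimage, mem_cover]
    constructor
    · rintro ⟨hz, hz'⟩
      obtain ⟨x, hx, rfl⟩ := mem_cover.1 hz
      obtain ⟨y, hy, hxy⟩ := mem_cover.1 hz'
      rw [flow_retr] at hxy
      refine ⟨x, ⟨fun i hi => ?_, hx.2⟩, rfl⟩
      obtain ⟨M, hM⟩ := time_eq_sum (n := 0) (by simp) (by simp) hxy.symm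
      have h2 := hM (max M N) (le_max_left _ _)
      have hiN : i < N := by simp [J] at hi; exact hi.1
      let E : ℕ → Fin 3 := fun i => if i < N then e i else 0
      let E' : ℕ → Fin 3 := fun i => if i < N then e' i else 0
      have h3 : t = ∑ i ∈ Finset.Ico 0 (max M N), (dig i (E' i) - dig i (E i)) := by
        rw [← Finset.range_eq_Ico, ← Finset.sum_range_add_sum_Ico _ (le_max_right M N)]
        rw [Finset.sum_eq_zero (s := Finset.Ico N (max M N)), add_zero]
        · refine Finset.sum_congr rfl fun i hi => ?_
          simp [E, E', Finset.mem_range.1 hi]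
        · intro i hi
          simp [E, E', not_lt.2 (Finset.mem_Ico.1 hi).1]
      have h4 := dig_sub_eq_of_abs_sum_lt (n := 0) (N := max M N) x.1 y.1 E E' ?_ i (Nat.zero_le _)
        (lt_of_lt_of_le hiN (le_max_right _ _))
      · simp only [E, E', hiN, if_true] at h4
        have hne : e' i ≠ e i := by
          simp only [J, Finset.mem_filter] at hi
          exact hi.2.symm
        exact (eq_of_dig_sub_eq hne h4).2
      · rw [← h2, ← h3]
        have hx2 := hx.2
        have hy2 := hy.2
        simp only [mem_Ico] at hx2 hy2
        have := one_le_hgt 0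
        have := hgt_le_gapA 0
        rw [abs_lt]
        constructor <;> linarith
    · rintro ⟨x, ⟨hx1, hx2⟩, rfl⟩
      have hx : x ∈ box 0 0 1 := ⟨by simp [hcyl], hx2⟩
      refine ⟨mem_cover.2 ⟨x, hx, rfl⟩, ?_⟩
      rw [flow_retr]
      refine mem_cover.2 ⟨(fun i => if i ∈ J then e' i else x.1 i, x.2), ⟨by simp [hcyl], hx2⟩, ?_⟩
      refine (retr_eq_iff.2 ((exists_vadd_eq_iff _ _).2 ⟨N, fun i hi => ?_, ?_⟩)).symm
      · have : i ∉ J := by simp [J, not_lt.2 hi]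
        simp [trans, this]
      · simp only [pos, trans, t]
        rw [add_assoc, ← Finset.sum_add_distrib]
        congr 1
        refine Finset.sum_congr rfl fun i hi => ?_
        by_cases hiJ : i ∈ J
        · rw [if_pos hiJ, hx1 i hiJ]
          ring
        · have : e i = e' i := by
            by_contra h
            exact hiJ (by simp only [J, Finset.mem_filter]; exact ⟨hi, h⟩)
          rw [if_neg hiJ, this]
          ring
  have h2 : ({c | ∀ i ∈ J, c i = e i} ×ˢ Ico 0 1 : Set Om) ⊆ tower 0 := by
    refine subset_trans ?_ hsub
    rw [box, hcyl]
    exact prod_mono_left (subset_univ _)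
  have h3 : MeasurableSet {c : ℕ → Fin 3 | ∀ i ∈ J, c i = e i} := by
    have : {c : ℕ → Fin 3 | ∀ i ∈ J, c i = e i} = ⋂ i ∈ J, {c : ℕ → Fin 3 | c i = e i} := by
      ext; simp
    rw [this]
    exact Finset.measurableSet_biInter _ fun i _ =>
      (measurable_pi_apply i) (measurableSet_singleton _)
  rw [h1, mSpace_cover h2 (h3.prod measurableSet_Ico), mOm, Measure.prod_prod,
    digLaw_pi_singleton]
  simp

/-! ### The Koopman representation -/

section Koopman

open Filter Topology Complex
open scoped InnerProductSpace symmDiff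

/-- The indicator function of a set of finite measure as an element of `L²`; zero for other sets. -/
def ind (A : Set Space) : Lp ℂ 2 mSpace :=
  open Classical in
  if h : MeasurableSet A ∧ mSpace A ≠ ∞ then indicatorConstLp 2 h.1 h.2 (1 : ℂ) else 0

lemma ind_eq {A : Set Space} (hA : MeasurableSet A) (h : mSpace A ≠ ∞) :
    ind A = indicatorConstLp 2 hA h (1 : ℂ) := dif_pos ⟨hA, h⟩

lemma ind_empty : ind ∅ = 0 := by
  rw [ind_eq MeasurableSet.empty (by simp), indicatorConstLp_empty]

lemma ind_union {A B : Set Space} (hA : MeasurableSet A) (h : mSpace A ≠ ∞) (hB : MeasurableSet B)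
    (h' : mSpace B ≠ ∞) (hAB : Disjoint A B) : ind (A ∪ B) = ind A + ind B := by
  rw [ind_eq hA h, ind_eq hB h', ind_eq (hA.union hB) (by finiteness),
    indicatorConstLp_disjoint_union hA hB h h' hAB]

lemma ind_biUnion {ι : Type*} (J : Finset ι) {A : ι → Set Space} (hA : ∀ i, MeasurableSet (A i))
    (h : ∀ i, mSpace (A i) ≠ ∞) (hd : (J : Set ι).PairwiseDisjoint A) :
    ind (⋃ i ∈ J, A i) = ∑ i ∈ J, ind (A i) := by
  classical
  induction J using Finset.induction_on with
  | empty => simp [ind_empty]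
  | insert i J hi ih =>
    rw [Finset.set_biUnion_insert, Finset.sum_insert hi, ind_union (hA i) (h i)
      (Finset.measurableSet_biUnion _ fun j _ => hA j) ?_ ?_,
      ih (hd.subset (by simp))]
    · exact (measure_biUnion_lt_top J.finite_toSet fun j _ => (h j).lt_top).ne
    · rw [Set.disjoint_iUnion₂_right]
      intro j hj
      exact hd (by simp) (by simp [hj]) (by rintro rfl; exact hi hj)

lemma inner_ind {A B : Set Space} (hA : MeasurableSet A) (h : mSpace A ≠ ∞) (hB : MeasurableSet B)
    (h' : mSpace B ≠ ∞) : ⟪ind A, ind B⟫_ℂ = mSpace.real (A ∩ B) := by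
  rw [ind_eq hA h, ind_eq hB h']
  exact L2.inner_indicatorConstLp_one_indicatorConstLp_one hA hB h h'

lemma tendsto_ind {ι : Type*} {l : Filter ι} {A : ι → Set Space} {B : Set Space}
    (hA : ∀ i, MeasurableSet (A i)) (h : ∀ i, mSpace (A i) ≠ ∞) (hB : MeasurableSet B)
    (h' : mSpace B ≠ ∞) (ht : Tendsto (fun i => mSpace (A i ∆ B)) l (𝓝 0)) :
    Tendsto (fun i => ind (A i)) l (𝓝 (ind B)) := by
  rw [ind_eq hB h']
  simp only [fun i => ind_eq (hA i) (h i)]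
  exact tendsto_indicatorConstLp_set (by norm_num) ht

lemma disjoint_cover {n : ℕ} {S T : Set Om} (hS : S ⊆ tower n) (hT : T ⊆ tower n)
    (h : Disjoint S T) : Disjoint (cover S) (cover T) := by
  rw [Set.disjoint_left]
  intro z hz hz'
  obtain ⟨x, hx, rfl⟩ := mem_cover.1 hz
  have h1 : x ∈ retr ⁻¹' cover T ∩ tower n := ⟨hz', hS hx⟩
  rw [retr_preimage_cover_inter hT] at h1
  exact Set.disjoint_left.1 h hx h1

/-- The digit sequences which start with the first `N` digits of `e`. -/
def prefixCyl (N : ℕ) (e : Dig) : Set (ℕ → Fin 3) := {c | ∀ i < N, c i = e i}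

/-- The sets of digit sequences with a prescribed beginning. -/
def prefixCyls : Set (Set (ℕ → Fin 3)) := {C | ∃ N e, C = prefixCyl N e}

lemma prefixCyl_inter {N M : ℕ} {e e' : Dig} (h : (prefixCyl N e ∩ prefixCyl M e').Nonempty) :
    ∃ e'', prefixCyl N e ∩ prefixCyl M e' = prefixCyl (max N M) e'' := by
  have key : ∀ N M : ℕ, ∀ e e' : Dig, N ≤ M → (prefixCyl N e ∩ prefixCyl M e').Nonempty →
      prefixCyl N e ∩ prefixCyl M e' = prefixCyl M e' := by
    rintro N M e e' hNM ⟨c, h1, h2⟩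
    refine inter_eq_right.2 fun c' hc' i hi => ?_
    rw [hc' i (by omega), ← h2 i (by omega), h1 i hi]
  rcases le_total N M with hNM | hNM
  · exact ⟨e', by rw [max_eq_right hNM, key N M e e' hNM h]⟩
  · rw [inter_comm] at h ⊢
    exact ⟨e, by rw [max_eq_left hNM, key M N e' e hNM h]⟩

lemma isPiSystem_prefixCyls : IsPiSystem prefixCyls := by
  rintro _ ⟨N, e, rfl⟩ _ ⟨M, e', rfl⟩ h
  exact ⟨_, prefixCyl_inter h⟩

lemma measurableSet_prefixCyl (N : ℕ) (e : Dig) : MeasurableSet (prefixCyl N e) := by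
  have : prefixCyl N e = ⋂ i, ⋂ (_ : i < N), {c : ℕ → Fin 3 | c i = e i} := by
    ext; simp [prefixCyl]
  rw [this]
  exact MeasurableSet.iInter fun i => MeasurableSet.iInter fun _ =>
    (measurable_pi_apply i) (measurableSet_singleton _)

lemma generateFrom_prefixCyls :
    (MeasurableSpace.pi : MeasurableSpace (ℕ → Fin 3)) = .generateFrom prefixCyls := by
  refine le_antisymm ?_ (MeasurableSpace.generateFrom_le ?_)
  · refine iSup_le fun i => ?_
    rintro _ ⟨S, -, rfl⟩
    have : Function.eval i ⁻¹' S = ⋃ e : {e : Dig // e i ∈ S}, prefixCyl (i + 1) e := by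
      ext c
      simp only [mem_preimage, Function.eval, mem_iUnion]
      constructor
      · intro hc
        let e : Dig := Finsupp.onFinset (Finset.range (i + 1)) (fun j => if j < i + 1 then c j else 0)
          (by intro j hj; by_contra h; simp at h; simp [not_le.2 h] at hj)
        have he : ∀ j < i + 1, e j = c j := fun j hj => if_pos hj
        exact ⟨⟨e, by rwa [he i (by omega)]⟩, fun j hj => (he j hj).symm⟩
      · rintro ⟨⟨e, he⟩, hc⟩
        rw [hc i (by omega)]
        exact he
    rw [this]
    exact MeasurableSet.iUnion fun e => .basic _ ⟨_, _, rfl⟩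
  · rintro _ ⟨N, e, rfl⟩
    exact measurableSet_prefixCyl N e

/-- The generating π-system of `Om`. -/
lemma generateFrom_rects : (inferInstance : MeasurableSpace Om) =
    .generateFrom (image2 (· ×ˢ ·) prefixCyls (⋃ a : ℚ, {Iio (a : ℝ)})) := by
  rw [← generateFrom_prod_eq, ← generateFrom_prefixCyls, ← Real.borel_eq_generateFrom_Iio_rat,
    ← BorelSpace.measurable_eq]
  · exact ⟨fun _ => univ, fun _ => ⟨0, 0, by simp [prefixCyl]⟩, iUnion_const _⟩
  · refine ⟨fun n : ℕ => Iio ((n : ℚ) : ℝ), fun n => mem_iUnion.2 ⟨n, rfl⟩, ?_⟩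
    refine eq_univ_of_forall fun x => ?_
    obtain ⟨n, hn⟩ := exists_nat_gt x
    exact mem_iUnion.2 ⟨n, by simpa using hn⟩

lemma exists_rat_hgt (n : ℕ) : ∃ r : ℚ, hgt n = r := ⟨(Nat.factorial (3 * n + 20) : ℕ), by
  rw [hgt, scale_eq]; push_cast; rfl⟩

lemma rect_inter_tower (N n : ℕ) (e : Dig) (a r : ℚ) (hr : hgt n = r) :
    (prefixCyl N e ×ˢ Iio (a : ℝ)) ∩ tower n =
      (prefixCyl N e ∩ prefixCyl n 0) ×ˢ Ico (-hgt n) (min a r : ℚ) := by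
  have : cyl n = prefixCyl n 0 := rfl
  rw [tower_eq, prod_inter_prod, this]
  congr 1
  ext f
  rw [hr]
  simp only [mem_inter_iff, mem_Iio, mem_Ico, Rat.cast_min, lt_min_iff]
  tauto

lemma cover_prefixCyl (N : ℕ) (e : Dig) (p q : ℝ) : cover (prefixCyl N e ×ˢ Ico p q) =
    brick N (p + ∑ i ∈ Finset.range N, dig i (e i)) (q + ∑ i ∈ Finset.range N, dig i (e i)) := by
  have := cover_prefix N e (Ico p q)
  rwa [preimage_sub_const_Ico] at this

/-- Rectangles cut by a tower are bricks, so that their indicators are in `K` as well. -/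
lemma ind_cover_rect_mem {K : Submodule ℂ (Lp ℂ 2 mSpace)}
    (h : ∀ n p q, p ≤ q → q - p ≤ 2 * hgt n → (∃ r : ℚ, q - p = r) → ind (brick n p q) ∈ K)
    (N n : ℕ) (e : Dig) (a : ℚ) : ind (cover ((prefixCyl N e ×ˢ Iio (a : ℝ)) ∩ tower n)) ∈ K := by
  have h0 : ind (cover ∅) ∈ K := by simp [cover_eq_image, ind_empty]
  obtain ⟨r, hr⟩ := exists_rat_hgt n
  rw [rect_inter_tower N n e a r hr]
  by_cases hne : (prefixCyl N e ∩ prefixCyl n 0).Nonempty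
  swap
  · rw [not_nonempty_iff_eq_empty.1 hne, empty_prod]
    exact h0
  by_cases hlt : -hgt n ≤ (min a r : ℚ)
  swap
  · rw [Ico_eq_empty (fun h => hlt h.le), prod_empty]
    exact h0
  obtain ⟨e', he'⟩ := prefixCyl_inter hne
  rw [he', cover_prefixCyl]
  have hr' : ((min a r : ℚ) : ℝ) ≤ r := by exact_mod_cast min_le_right a r
  have hm := hgt_mono (le_max_right N n)
  refine h (max N n) _ _ (add_le_add_left hlt _) ?_ ⟨min a r + r, ?_⟩
  · rw [add_sub_add_right_eq_sub]
    linarith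
  · rw [add_sub_add_right_eq_sub, hr]
    push_cast
    ring

/-- The indicators of the bricks of rational length span a dense subspace. -/
lemma eq_top_of_brick_mem {K : Submodule ℂ (Lp ℂ 2 mSpace)} (hK : IsClosed (K : Set (Lp ℂ 2 mSpace)))
    (h : ∀ n p q, p ≤ q → q - p ≤ 2 * hgt n → (∃ r : ℚ, q - p = r) → ind (brick n p q) ∈ K) :
    K = ⊤ := by
  have hcov : ∀ n (S : Set Om), mSpace (cover (S ∩ tower n)) ≠ ∞ := fun n S =>
    ne_top_of_le_ne_top (mSpace_level_ne_top n) (measure_mono (cover_mono inter_subset_right))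
  have hlevel : ∀ n, ind (level n) ∈ K := fun n => by
    obtain ⟨r, hr⟩ := exists_rat_hgt n
    exact h n (-hgt n) (hgt n) (by linarith [hgt_pos n]) (by linarith)
      ⟨2 * r, by push_cast; rw [← hr]; ring⟩
  -- inside one tower, extend from rectangles to measurable sets by a π-λ argument
  have h1 : ∀ n (S : Set Om), MeasurableSet S → ind (cover (S ∩ tower n)) ∈ K := by
    intro n S hS
    induction S, hS using MeasurableSpace.induction_on_inter generateFrom_rects
      (isPiSystem_prefixCyls.prod Real.isPiSystem_Iio_rat) with
    | empty => simp [cover_eq_image, ind_empty]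
    | basic S hS =>
      obtain ⟨_, ⟨N, e, rfl⟩, J, hJ, rfl⟩ := hS
      obtain ⟨a, rfl⟩ := mem_iUnion.1 hJ
      exact ind_cover_rect_mem h N n e a
    | compl S hS ih =>
      have e1 : level n = cover (S ∩ tower n) ∪ cover (Sᶜ ∩ tower n) := by
        rw [cover_eq_image, cover_eq_image, ← image_union, ← union_inter_distrib_right,
          union_compl_self, univ_inter, ← cover_eq_image, cover_tower]
      have e2 := hlevel n
      rw [e1, ind_union (measurableSet_cover (hS.inter (measurableSet_tower n))) (hcov n S)
        (measurableSet_cover (hS.compl.inter (measurableSet_tower n))) (hcov n _)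
        (disjoint_cover inter_subset_right inter_subset_right
          (disjoint_compl_right.mono inter_subset_left inter_subset_left))] at e2
      exact (Submodule.add_mem_iff_right K ih).1 e2
    | iUnion f hd hf ih =>
      have hm : ∀ i, MeasurableSet (cover (f i ∩ tower n)) := fun i =>
        measurableSet_cover ((hf i).inter (measurableSet_tower n))
      have hdis : Pairwise (Function.onFun Disjoint fun i => cover (f i ∩ tower n)) :=
        fun i j hij => disjoint_cover inter_subset_right inter_subset_right
          ((hd hij).mono inter_subset_left inter_subset_left)
      have e1 : cover ((⋃ i, f i) ∩ tower n) = ⋃ i, cover (f i ∩ tower n) := by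
        simp only [cover_eq_image, iUnion_inter, image_iUnion]
      have hfin := hcov n (⋃ i, f i)
      rw [e1] at hfin ⊢
      have e2 : Tendsto (fun N => ind (⋃ i ∈ Finset.range N, cover (f i ∩ tower n))) atTop
          (𝓝 (ind (⋃ i, cover (f i ∩ tower n)))) := by
        refine tendsto_ind (fun N => Finset.measurableSet_biUnion _ fun i _ => hm i)
          (fun N => ne_top_of_le_ne_top hfin (measure_mono (iUnion₂_subset fun i _ =>
            subset_iUnion (fun i => cover (f i ∩ tower n)) i)))
          (MeasurableSet.iUnion hm) hfin ?_
        have : IsFiniteMeasure (mSpace.restrict (level n)) :=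
          ⟨by rw [Measure.restrict_apply_univ]; exact (mSpace_level_ne_top n).lt_top⟩
        have e3 := tendsto_measure_biUnion_Ici_zero_of_pairwise_disjoint
          (μ := mSpace.restrict (level n)) (Es := fun i => cover (f i ∩ tower n)) (fun i => (hm i).nullMeasurableSet) hdis
        refine tendsto_of_tendsto_of_tendsto_of_le_of_le tendsto_const_nhds e3
          (fun _ => bot_le) fun N => ?_
        change mSpace _ ≤ mSpace.restrict (level n) _
        rw [Measure.restrict_apply' (measurableSet_level n)]
        refine measure_mono fun z hz => ?_
        rcases hz with ⟨hz1, hz2⟩ | ⟨hz1, hz2⟩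
        · obtain ⟨i, _, hi⟩ := mem_iUnion₂.1 hz1
          exact absurd (mem_iUnion.2 ⟨i, hi⟩) hz2
        · obtain ⟨i, hi⟩ := mem_iUnion.1 hz1
          refine ⟨mem_iUnion₂.2 ⟨i, ?_, hi⟩, cover_mono inter_subset_right hi⟩
          by_contra hlt
          exact hz2 (mem_iUnion₂.2 ⟨i, Finset.mem_range.2 (not_le.1 hlt), hi⟩)
      refine hK.mem_of_tendsto e2 (Filter.Eventually.of_forall fun N => ?_)
      rw [ind_biUnion _ hm (fun i => hcov n _) fun i _ j _ hij => hdis hij]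
      exact K.sum_mem fun i _ => ih i
  -- exhaust `B` by its intersections with the towers
  have h2 : ∀ B : Set Space, MeasurableSet B → mSpace B ≠ ∞ → ind B ∈ K := by
    intro B hB hfin
    have e1 : ∀ n, B ∩ level n = cover (retr ⁻¹' B ∩ tower n) := fun n => by
      ext z
      rw [mem_inter_iff, mem_level, mem_cover]
      constructor
      · rintro ⟨hz, x, hx, rfl⟩
        exact ⟨x, ⟨hz, hx⟩, rfl⟩
      · rintro ⟨x, ⟨h1, hx⟩, rfl⟩
        exact ⟨h1, x, hx, rfl⟩
    have e2 : Tendsto (fun n => ind (B ∩ level n)) atTop (𝓝 (ind B)) := by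
      refine tendsto_ind (fun n => hB.inter (measurableSet_level n))
        (fun n => ne_top_of_le_ne_top hfin (measure_mono inter_subset_left)) hB hfin ?_
      have : ∀ n, (B ∩ level n) ∆ B = B ∩ (level n)ᶜ := fun n => by
        ext z; simp [mem_symmDiff]; tauto
      simp only [this]
      have hlim := tendsto_measure_iInter_atTop (μ := mSpace) (s := fun n => B ∩ (level n)ᶜ)
        (fun n => (hB.inter (measurableSet_level n).compl).nullMeasurableSet)
        (fun n m hnm => inter_subset_inter_right _ (compl_subset_compl.2 (level_mono hnm)))
        ⟨0, ne_top_of_le_ne_top hfin (measure_mono inter_subset_left)⟩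
      rwa [← inter_iInter, ← compl_iUnion, iUnion_level, compl_univ, inter_empty,
        measure_empty] at hlim
    refine hK.mem_of_tendsto e2 (Filter.Eventually.of_forall fun n => ?_)
    rw [e1]
    exact h1 n _ (measurable_retr hB)
  refine eq_top_iff.2 fun f _ => ?_
  refine Lp.induction (p := 2) (by norm_num) (fun f => f ∈ K) (fun c S hS hμS => ?_)
    (fun f g hf hg _ ihf ihg => K.add_mem ihf ihg) hK f
  have e1 : (Lp.simpleFunc.indicatorConst 2 hS hμS.ne c : Lp ℂ 2 mSpace) = c • ind S := by
    rw [ind_eq hS hμS.ne, Lp.simpleFunc.coe_indicatorConst]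
    refine Lp.ext ?_
    filter_upwards [indicatorConstLp_coeFn (p := 2) (hs := hS) (hμs := hμS.ne) (c := c),
      indicatorConstLp_coeFn (p := 2) (hs := hS) (hμs := hμS.ne) (c := (1 : ℂ)),
      Lp.coeFn_smul c (indicatorConstLp 2 hS hμS.ne (1 : ℂ))] with z h1 h2 h3
    rw [h1, h3, Pi.smul_apply, h2]
    by_cases hz : z ∈ S <;> simp [hz]
  rw [e1]
  exact K.smul_mem c (h2 S hS hμS.ne)

/-- The Koopman operators of the flow. -/
def koop (t : ℝ) : Lp ℂ 2 mSpace →ₗᵢ[ℂ] Lp ℂ 2 mSpace :=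
  Lp.compMeasurePreservingₗᵢ ℂ (flow t) (measurePreserving_flow t)

lemma koop_coeFn (t : ℝ) (f : Lp ℂ 2 mSpace) : koop t f =ᵐ[mSpace] f ∘ flow t :=
  Lp.coeFn_compMeasurePreserving f (measurePreserving_flow t)

lemma koop_ind (t : ℝ) {A : Set Space} (hA : MeasurableSet A) (h : mSpace A ≠ ∞) :
    koop t (ind A) = ind (flow t ⁻¹' A) := by
  rw [ind_eq hA h, ind_eq (measurable_flow t hA)
    (by rwa [(measurePreserving_flow t).measure_preimage hA.nullMeasurableSet])]
  rfl

lemma koop_ind_brick (t : ℝ) (n : ℕ) (p q : ℝ) :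
    koop t (ind (brick n p q)) = ind (brick n (p - t) (q - t)) := by
  rw [koop_ind t (measurableSet_brick n p q) (mSpace_brick_ne_top n p q), flow_preimage_brick]

/-- Short translates of a brick are close to it. -/
lemma mSpace_brick_symmDiff_le (n : ℕ) (p q s : ℝ) :
    mSpace (brick n (p + s) (q + s) ∆ brick n p q) ≤ ENNReal.ofReal (4 * |s|) := by
  have h1 : brick n (p + s) (q + s) ∆ brick n p q ⊆
      cover (cyl n ×ˢ (Icc (p - |s|) (p + |s|) ∪ Icc (q - |s|) (q + |s|))) := by
    have key : ∀ p₁ q₁ p₂ q₂ : ℝ, |p₁ - p| ≤ |s| → |q₁ - q| ≤ |s| → |p₂ - p| ≤ |s| →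
        |q₂ - q| ≤ |s| → brick n p₁ q₁ \ brick n p₂ q₂ ⊆
          cover (cyl n ×ˢ (Icc (p - |s|) (p + |s|) ∪ Icc (q - |s|) (q + |s|))) := by
      intro p₁ q₁ p₂ q₂ hp hq hp' hq' z hz
      obtain ⟨x, hx, rfl⟩ := mem_cover.1 hz.1
      refine mem_cover.2 ⟨x, ⟨hx.1, ?_⟩, rfl⟩
      have h2 : ¬ (p₂ ≤ x.2 ∧ x.2 < q₂) := fun h =>
        hz.2 (mem_cover.2 ⟨x, ⟨hx.1, h⟩, rfl⟩)
      have h3 := hx.2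
      simp only [mem_Ico, mem_union, mem_Icc] at h3 ⊢
      rw [abs_le] at hp hq hp' hq'
      rcases not_and_or.1 h2 with h | h
      · left; constructor <;> linarith
      · right; constructor <;> linarith
    exact union_subset (key _ _ _ _ (by simp) (by simp) (by simp) (by simp))
      (key _ _ _ _ (by simp) (by simp) (by simp) (by simp))
  refine (measure_mono h1).trans ((mSpace_cover_le _).trans ((mOm_prod_le n _).trans
    ((measure_union_le _ _).trans ?_)))
  rw [Real.volume_Icc, Real.volume_Icc, ← ENNReal.ofReal_add (by simp) (by simp)]
  exact ENNReal.ofReal_le_ofReal (by linarith)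

lemma continuous_koop_ind_brick (n : ℕ) (p q : ℝ) :
    Continuous fun t => koop t (ind (brick n p q)) := by
  simp only [koop_ind_brick]
  refine continuous_iff_continuousAt.2 fun t => ?_
  refine tendsto_ind (fun s => measurableSet_brick _ _ _) (fun s => mSpace_brick_ne_top _ _ _)
    (measurableSet_brick _ _ _) (mSpace_brick_ne_top _ _ _) ?_
  have h1 : Tendsto (fun s : ℝ => ENNReal.ofReal (4 * |t - s|)) (𝓝 t) (𝓝 0) := by
    have : Continuous fun s : ℝ => ENNReal.ofReal (4 * |t - s|) :=
      ENNReal.continuous_ofReal.comp (by fun_prop)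
    simpa using this.tendsto t
  refine tendsto_of_tendsto_of_tendsto_of_le_of_le tendsto_const_nhds h1 (fun _ => bot_le)
    fun s => ?_
  have := mSpace_brick_symmDiff_le n (p - t) (q - t) (t - s)
  simpa using this

lemma isIsometricFlow_koop : IsIsometricFlow koop where
  zero_apply f := by
    refine Lp.ext ?_
    filter_upwards [koop_coeFn 0 f] with z hz
    rw [hz, flow_zero]
    rfl
  add_apply s t f := by
    refine Lp.ext ?_
    filter_upwards [koop_coeFn (s + t) f, koop_coeFn s (koop t f),
      (measurePreserving_flow s).quasiMeasurePreserving.ae (koop_coeFn t f)] with z h1 h2 h3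
    rw [h1, h2, Function.comp_apply, Function.comp_apply, h3, Function.comp_apply, flow_flow,
      add_comm]
  continuous := by
    let K : Submodule ℂ (Lp ℂ 2 mSpace) :=
      { carrier := {f | Continuous fun t => koop t f}
        add_mem' := fun {f g} hf hg => by
          simp only [mem_ofPred_eq, map_add]
          exact Continuous.add hf hg
        zero_mem' := by simpa using continuous_const
        smul_mem' := fun c f hf => by
          simp only [mem_ofPred_eq, map_smul]
          exact Continuous.const_smul hf c }
    have hK : IsClosed (K : Set (Lp ℂ 2 mSpace)) := by
      refine isClosed_of_closure_subset fun f hf => ?_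
      refine continuous_of_uniform_approx_of_continuous fun u hu => ?_
      obtain ⟨ε, hε, hu⟩ := Metric.mem_uniformity_dist.1 hu
      obtain ⟨g, hg, hfg⟩ := Metric.mem_closure_iff.1 hf ε hε
      exact ⟨fun t => koop t g, hg, fun t => hu (by rwa [(koop t).isometry.dist_eq])⟩
    have := eq_top_of_brick_mem hK fun n p q _ _ _ => continuous_koop_ind_brick n p q
    exact fun f => by
      have : f ∈ K := this ▸ Submodule.mem_top
      exact this

end Koopman

/-! ### The maximal spectral type of the flow -/

section SpectralType

open Filter Topology Complex
open scoped InnerProductSpace ComplexConjugate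

lemma charFun_spec_ind {B : Set Space} (hB : MeasurableSet B) (h : mSpace B ≠ ∞) (t : ℝ) :
    charFun (isIsometricFlow_koop.spec (ind B)) t = mSpace.real (B ∩ flow t ⁻¹' B) := by
  rw [isIsometricFlow_koop.charFun_spec, koop_ind t hB h, inner_ind hB h (measurable_flow t hB)
    (by rwa [(measurePreserving_flow t).measure_preimage hB.nullMeasurableSet])]

/-- The spectral measure of a part of a tower has zero correlation at times which are not return
times. -/
lemma charFun_spec_ind_eq_zero {n : ℕ} {B : Set Space} (hB : MeasurableSet B) (hBn : B ⊆ level n)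
    {t : ℝ} (ht : ∀ z ∈ level n, flow t z ∉ level n) :
    charFun (isIsometricFlow_koop.spec (ind B)) t = 0 := by
  rw [charFun_spec_ind hB (ne_top_of_le_ne_top (mSpace_level_ne_top n) (measure_mono hBn))]
  have : B ∩ flow t ⁻¹' B = ∅ := by
    ext z
    simp only [mem_inter_iff, mem_preimage, mem_empty_iff_false, iff_false, not_and]
    exact fun hz hz' => ht z (hBn hz) (hBn hz')
  simp [this]

lemma charFun_sub_eq_zero_of_lt {τ : Measure ℝ} (t : ℕ → ℝ)
    (h : ∀ k l, l < k → charFun τ (t k - t l) = 0) (k l : ℕ) (hkl : k ≠ l) :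
    charFun τ (t k - t l) = 0 := by
  rcases lt_or_gt_of_ne hkl with h' | h'
  · rw [← neg_sub, charFun_neg, h l k h', map_zero]
  · exact h k l h'

/-- The spectral measures of subsets of the towers have no atoms. -/
lemma nullSingletonClass_spec_ind {n : ℕ} {B : Set Space} (hB : MeasurableSet B)
    (hBn : B ⊆ level n) : NullSingletonClass (isIsometricFlow_koop.spec (ind B)) := by
  obtain ⟨K, hK⟩ := eventually_atTop.1 (eventually_flow_notMem_level n one_ne_zero)
  refine nullSingletonClass_of_charFun_sub_eq_zero (fun k => hgt (K + k + 1))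
    (charFun_sub_eq_zero_of_lt _ fun k l hkl => ?_)
  have h1 : hgt (K + l + 1) ≤ hgt (K + k) := hgt_mono (by omega)
  have h2 := hgt_lt_succ (K + k)
  have h3 := hgt_le_gapA (K + k)
  have h4 := gapA_le_gapB (K + k)
  have h5 := hgt_pos (K + l + 1)
  refine charFun_spec_ind_eq_zero hB hBn fun z hz => ?_
  have := hK (K + k) (by omega) (hgt (K + k + 1) - hgt (K + l + 1))
    (by rw [abs_of_pos (by linarith)]; linarith) (by rw [abs_of_pos (by linarith)]; linarith) z hz
  rwa [one_mul] at this

/-- A brick is a union of translates of a shorter brick. -/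
lemma ind_brick_eq_sum (n m : ℕ) (p : ℝ) {δ : ℝ} (hδ : 0 < δ) (h : m * δ ≤ 2 * hgt n) :
    ind (brick n p (p + m * δ)) =
      ∑ j ∈ Finset.range m, koop (-(p + j * δ)) (ind (brick n 0 δ)) := by
  induction m with
  | zero => simp [brick, box, cover_eq_image, ind_empty]
  | succ m ih =>
    have h1 : (m : ℝ) * δ ≤ 2 * hgt n := by push_cast at h; linarith
    have h0 : (0 : ℝ) ≤ m * δ := by positivity
    rw [Finset.sum_range_succ, ← ih h1, koop_ind_brick,
      ← ind_union (measurableSet_brick _ _ _) (mSpace_brick_ne_top _ _ _)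
        (measurableSet_brick _ _ _) (mSpace_brick_ne_top _ _ _)]
    · rw [show (0 : ℝ) - -(p + m * δ) = p + m * δ by ring,
        show δ - -(p + m * δ) = p + (m + 1 : ℕ) * δ by push_cast; ring,
        ← brick_union (by linarith) (by push_cast; linarith)]
    · refine disjoint_brick (by linarith) ?_
      push_cast at h
      linarith

/-- The unit brick of a tower consists of three translates of the unit brick of the next tower. -/
lemma ind_brick_eq_sum_succ (n : ℕ) :
    ind (brick n 0 1) = ∑ a : Fin 3, koop (-dig n a) (ind (brick (n + 1) 0 1)) := by
  rw [brick_eq_iUnion]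
  have := ind_biUnion (Finset.univ : Finset (Fin 3))
    (A := fun a => brick (n + 1) (0 + dig n a) (1 + dig n a))
    (fun a => measurableSet_brick _ _ _) (fun a => mSpace_brick_ne_top _ _ _)
    fun a _ b _ hab => pairwise_disjoint_brick_succ (by linarith [one_le_hgt n]) hab
  simp only [Finset.mem_univ, iUnion_true] at this
  rw [this]
  simp only [koop_ind_brick, sub_neg_eq_add]

/-- A measure of maximal spectral type: the spectral measure of the unit brick. -/
def sigma : Measure ℝ := isIsometricFlow_koop.spec (ind (brick 0 0 1))

instance : IsFiniteMeasure sigma := by unfold sigma; infer_instance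

/-- Each unit brick is a sum of translates of the next one, so that the spectral type does not grow. -/
lemma spec_unit_brick_absolutelyContinuous (n : ℕ) :
    isIsometricFlow_koop.spec (ind (brick n 0 1)) ≪ sigma := by
  induction n with
  | zero => exact Measure.AbsolutelyContinuous.rfl
  | succ n ih =>
    refine Measure.AbsolutelyContinuous.trans ?_ ih
    rw [ind_brick_eq_sum_succ n]
    have := nullSingletonClass_spec_ind (n := n + 1) (measurableSet_brick (n + 1) 0 1)
      (brick_subset_level (by linarith [hgt_pos (n + 1)]) (one_le_hgt _))
    exact isIsometricFlow_koop.spec_absolutelyContinuous_sum Finset.univ_nonempty _ _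

/-- A unit brick is a sum of translates of bricks of length `1 / m`, whose spectral type is therefore
not larger. -/
lemma spec_short_brick_absolutelyContinuous (n : ℕ) {m : ℕ} (hm : m ≠ 0) :
    isIsometricFlow_koop.spec (ind (brick n 0 (m : ℝ)⁻¹)) ≪ sigma := by
  have hm' : (0 : ℝ) < m := by positivity
  refine Measure.AbsolutelyContinuous.trans ?_ (spec_unit_brick_absolutelyContinuous n)
  have h1 := ind_brick_eq_sum n m 0 (inv_pos.2 hm')
    (by rw [mul_inv_cancel₀ hm'.ne']; linarith [one_le_hgt n])
  rw [mul_inv_cancel₀ hm'.ne', zero_add] at h1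
  rw [h1]
  have := nullSingletonClass_spec_ind (n := n) (measurableSet_brick n 0 (m : ℝ)⁻¹)
    (brick_subset_level (by linarith [hgt_pos n])
      ((inv_le_one_of_one_le₀ (by exact_mod_cast Nat.one_le_iff_ne_zero.2 hm)).trans (one_le_hgt n)))
  exact isIsometricFlow_koop.spec_absolutelyContinuous_sum (Finset.nonempty_range_iff.2 hm) _ _

/-- Every spectral measure is dominated by `sigma`: bricks of rational length are sums of translates
of bricks of length `1 / m`, and they span a dense subspace. -/
lemma acSubspace_sigma : isIsometricFlow_koop.acSubspace sigma = ⊤ := by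
  refine eq_top_of_brick_mem (isIsometricFlow_koop.isClosed_acSubspace _) ?_
  rintro n p q hpq hle ⟨r, hr⟩
  have hr0 : 0 ≤ r := by
    have : (0 : ℝ) ≤ r := by rw [← hr]; linarith
    exact_mod_cast this
  have hd : (0 : ℝ) < r.den := by exact_mod_cast r.den_pos
  have h1 : q = p + r.num.toNat * (r.den : ℝ)⁻¹ := by
    have h2 : ((r.num.toNat : ℤ) : ℝ) = r.num := by
      rw [Int.toNat_of_nonneg (Rat.num_nonneg.2 hr0)]
    rw [Int.cast_natCast] at h2
    rw [h2, ← div_eq_mul_inv, ← Rat.cast_def, ← hr]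
    ring
  rw [h1, ind_brick_eq_sum n _ p (inv_pos.2 hd) (by linarith), IsIsometricFlow.mem_acSubspace]
  exact (isIsometricFlow_koop.spec_sum_absolutelyContinuous _ _ _).trans
    (spec_short_brick_absolutelyContinuous n r.den_nz)

lemma isSpectralMeasure_spec {f : Space → ℂ} (hf : MemLp f 2 mSpace) :
    IsSpectralMeasure flow mSpace f (isIsometricFlow_koop.spec (hf.toLp f)) := by
  refine ⟨inferInstance, fun t => ?_⟩
  rw [isIsometricFlow_koop.charFun_spec, L2.inner_def]
  refine integral_congr_ae ?_
  filter_upwards [hf.coeFn_toLp, koop_coeFn t (hf.toLp f),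
    (measurePreserving_flow t).quasiMeasurePreserving.ae hf.coeFn_toLp] with z h1 h2 h3
  rw [h1, h2, Function.comp_apply, h3, RCLike.inner_apply]

lemma isMaximalSpectralType_sigma : IsMaximalSpectralType flow mSpace sigma where
  isFiniteMeasure := inferInstance
  dominates f hf := ⟨_, isSpectralMeasure_spec hf, by
    rw [← IsIsometricFlow.mem_acSubspace, acSubspace_sigma]
    exact Submodule.mem_top⟩
  attained := by
    have hf : MemLp (ind (brick 0 0 1)) 2 mSpace := Lp.memLp _
    refine ⟨_, hf, _, isSpectralMeasure_spec hf, ?_⟩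
    rw [Lp.toLp_coeFn]
    exact Measure.AbsolutelyContinuous.rfl

/-! ### Singularity of the rescaled spectral types -/

/-- At a sum of offset differences, the correlation of the unit brick of the lowest tower is the
measure of the set of points at which the digits involved have prescribed values. -/
lemma charFun_sigma_sum (N : ℕ) (e e' : ℕ → Fin 3) :
    charFun sigma (∑ i ∈ Finset.range N, (dig i (e' i) - dig i (e i))) =
      (((3 : ℝ)⁻¹ ^ ((Finset.range N).filter fun i => e i ≠ e' i).card : ℝ) : ℂ) := by
  rw [sigma, charFun_spec_ind (measurableSet_brick 0 0 1) (mSpace_brick_ne_top 0 0 1),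
    measureReal_def, mSpace_brick_inter]
  simp

lemma charFun_sigma_gapA (k : ℕ) : charFun sigma (gapA k) = ((3 : ℝ)⁻¹ : ℝ) := by
  have h := charFun_sigma_sum (k + 1) 0 (Pi.single (M := fun _ => Fin 3) k 1)
  have h1 : ∑ i ∈ Finset.range (k + 1), (dig i (Pi.single (M := fun _ => Fin 3) k 1 i) -
      dig i ((0 : ℕ → Fin 3) i)) = gapA k := by
    rw [Finset.sum_range_succ, Finset.sum_eq_zero]
    · simp
    · intro i hi
      simp [Pi.single_eq_of_ne (Finset.mem_range.1 hi).ne]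
  have h2 : ((Finset.range (k + 1)).filter fun i =>
      (0 : ℕ → Fin 3) i ≠ Pi.single (M := fun _ => Fin 3) k 1 i) = {k} := by
    ext i
    simp only [Finset.mem_filter, Finset.mem_range, Finset.mem_singleton, Pi.zero_apply]
    by_cases hik : i = k
    · subst hik; simp
    · simp [hik]
  rw [h1, h2] at h
  simpa using h

lemma charFun_sigma_gapA_sub {k l : ℕ} (hkl : l < k) :
    charFun sigma (gapA k - gapA l) = (((3 : ℝ)⁻¹ ^ 2 : ℝ) : ℂ) := by
  have h := charFun_sigma_sum (k + 1) (Pi.single (M := fun _ => Fin 3) l 1)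
    (Pi.single (M := fun _ => Fin 3) k 1)
  have h1 : ∑ i ∈ Finset.range (k + 1), (dig i (Pi.single (M := fun _ => Fin 3) k 1 i) -
      dig i (Pi.single (M := fun _ => Fin 3) l 1 i)) = gapA k - gapA l := by
    rw [Finset.sum_sub_distrib, Finset.sum_eq_single_of_mem k (by simp),
      Finset.sum_eq_single_of_mem l (by simp; omega)]
    · simp
    · intro i _ hi
      simp [Pi.single_eq_of_ne hi]
    · intro i _ hi
      simp [Pi.single_eq_of_ne hi]
  have h2 : ((Finset.range (k + 1)).filter fun i => Pi.single (M := fun _ => Fin 3) l (1 : Fin 3) i ≠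
      Pi.single (M := fun _ => Fin 3) k 1 i) = {k, l} := by
    ext i
    simp only [Finset.mem_filter, Finset.mem_range, Finset.mem_insert, Finset.mem_singleton]
    by_cases hik : i = k
    · subst hik
      simp [Pi.single_eq_of_ne hkl.ne']
    · by_cases hil : i = l
      · subst hil
        simp [hik]
        omega
      · simp [hik, hil]
  rw [h1, h2, Finset.card_pair hkl.ne'] at h
  exact h

lemma sigma_univ : IsProbabilityMeasure sigma := by
  have h := charFun_sigma_sum 0 0 0
  simp only [Finset.range_zero, Finset.sum_empty, Finset.filter_empty, Finset.card_empty, pow_zero,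
    charFun_zero] at h
  refine ⟨?_⟩
  rw [← ENNReal.toReal_eq_one_iff]
  exact_mod_cast h

/-- Along the times `gapA k / s'`, the characters are orthogonal for the first measure, and for the
second one they are orthogonal after subtracting their common mean `1 / 3`. -/
lemma mutuallySingular_sigma {s s' : ℝ} (hs : 0 < s) (hs' : 0 < s') (hne : s ≠ s') :
    (sigma.map (fun x => x * s)).MutuallySingular (sigma.map (fun x => x * s')) := by
  have hmap : ∀ r t : ℝ, charFun (sigma.map (fun x => x * r)) t = charFun sigma (r * t) := by
    intro r t
    rw [← charFun_map_mul]
    simp only [mul_comm]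
  have := sigma_univ
  have : IsProbabilityMeasure (sigma.map (fun x => x * s')) :=
    Measure.isProbabilityMeasure_map (by fun_prop)
  obtain ⟨K, hK⟩ := eventually_atTop.1 (eventually_flow_gapA_notMem_level 0 (div_pos hs hs')
    (by rwa [ne_eq, div_eq_one_iff_eq hs'.ne']))
  refine mutuallySingular_of_charFun (fun k => gapA (K + k) / s') (c := 3⁻¹) (by norm_num)
    (charFun_sub_eq_zero_of_lt _ fun k l hkl => ?_) (fun k => ?_) (fun k l hkl => ?_)
  · rw [hmap, sigma]
    refine charFun_spec_ind_eq_zero (n := 0) (measurableSet_brick 0 0 1)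
      (brick_subset_level (by linarith [hgt_pos 0]) (one_le_hgt 0)) fun z hz => ?_
    have h1 := hK (K + k) (by omega) (gapA (K + k) - gapA (K + l)) ?_ z hz
    · rwa [show s / s' * (gapA (K + k) - gapA (K + l)) =
        s * (gapA (K + k) / s' - gapA (K + l) / s') by field_simp] at h1
    · rw [sub_sub_cancel_left, abs_neg, abs_of_pos (gapA_pos _)]
      have h2 := hgt_mono (show K + l + 1 ≤ K + k by omega)
      have h3 := gapB_le_hgt (K + l)
      have h4 := gapA_le_gapB (K + l)
      have h5 := gapA_pos (K + l)
      linarith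
  · rw [hmap, mul_div_cancel₀ _ hs'.ne', charFun_sigma_gapA]
  · rw [hmap, ← sub_div, mul_div_cancel₀ _ hs'.ne']
    rcases lt_or_gt_of_ne hkl with h | h
    · rw [← neg_sub, charFun_neg, charFun_sigma_gapA_sub (by omega), conj_ofReal]
      push_cast
      rfl
    · rw [charFun_sigma_gapA_sub (by omega)]
      push_cast
      rfl

end SpectralType

/-! ### Construction of Poisson random measures -/

section PoissonConstruction

open Filter Topology Complex
open scoped NNReal

lemma lintegral_natCast_poissonMeasure (r : ℝ≥0) : ∫⁻ n, (n : ℝ≥0∞) ∂(poissonMeasure r) = r := by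
  have h : ∀ n : ℕ, ((n + 1 : ℕ) : ℝ≥0∞) * poissonMeasure r {n + 1} =
      r * poissonMeasure r {n} := fun n => by
    rw [poissonMeasure_singleton, poissonMeasure_singleton, ← ENNReal.ofReal_natCast,
      ← ENNReal.ofReal_coe_nnreal, ← ENNReal.ofReal_mul (by positivity),
      ← ENNReal.ofReal_mul (by positivity)]
    congr 1
    rw [Nat.factorial_succ]
    push_cast
    field_simp
    ring
  have h1 : ∑' n, poissonMeasure r {n} = 1 := by
    rw [← measure_iUnion (fun i j hij => by simpa using hij) (by simp)]
    have : ⋃ i : ℕ, ({i} : Set ℕ) = univ := by ext; simp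
    rw [this, measure_univ]
  rw [lintegral_countable', tsum_eq_zero_add' ENNReal.summable, tsum_congr h,
    ENNReal.tsum_mul_left, h1]
  simp

lemma integral_pow_poissonMeasure (r : ℝ≥0) (φ : ℂ) :
    ∫ n, φ ^ n ∂(poissonMeasure r) = exp (r * (φ - 1)) := by
  rw [integral_poissonMeasure]
  have h1 : ∀ n : ℕ, (Real.exp (-r) * r ^ n / n.factorial) • φ ^ n =
      exp (-r) * ((r * φ) ^ n / n.factorial) := fun n => by
    rw [real_smul]
    push_cast
    ring
  rw [tsum_congr h1, tsum_mul_left, ← congrFun (NormedSpace.exp_eq_tsum_div (𝔸 := ℂ)) (r * φ),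
    ← Complex.exp_eq_exp_ℂ, ← exp_add]
  congr 1
  ring

lemma integral_infinitePi_prod {Ω : ℕ → Type*} [∀ i, MeasurableSpace (Ω i)]
    (P : ∀ i, Measure (Ω i)) [∀ i, IsProbabilityMeasure (P i)] (J : Finset ℕ) (f : ∀ i, Ω i → ℂ)
    (hf : ∀ i, Measurable (f i)) :
    ∫ ω, ∏ i ∈ J, f i (ω i) ∂(Measure.infinitePi P) = ∏ i ∈ J, ∫ x, f i x ∂(P i) := by
  have h1 : ∀ ω : ∀ i, Ω i, ∏ i ∈ J, f i (ω i) = ∏ i : J, f i (J.restrict ω i) := fun ω => by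
    rw [← Finset.prod_coe_sort J]
    rfl
  simp only [h1]
  rw [← integral_map (μ := Measure.infinitePi P) (φ := J.restrict)
    (f := fun x : (∀ i : J, Ω i) => ∏ i : J, f i (x i)) (by fun_prop)
    (Finset.measurable_fun_prod Finset.univ fun (i : J) _ =>
      (hf i).comp (measurable_pi_apply i)).aestronglyMeasurable,
    Measure.infinitePi_map_restrict, integral_fintype_prod_eq_prod (fun i : J => f i),
    ← Finset.prod_coe_sort J]

variable {X : Type*} [MeasurableSpace X]

/-- A decomposition of an s-finite measure into finite pieces. -/
def pieces (μ : Measure X) [SFinite μ] (n : ℕ) : FiniteMeasure X := ⟨sfiniteSeq μ n, inferInstance⟩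

/-- For each piece of the measure, a number of points and a sequence of points. -/
abbrev Pts (X : Type*) : Type _ := ℕ → ℕ × (ℕ → X)

/-- Independent Poisson numbers of points and independent points. -/
def ptsLaw [Nonempty X] (μ : Measure X) [SFinite μ] : Measure (Pts X) :=
  Measure.infinitePi fun n => (poissonMeasure (pieces μ n).mass).prod
    (Measure.infinitePi fun _ : ℕ => ((pieces μ n).normalize : Measure X))

instance [Nonempty X] (μ : Measure X) [SFinite μ] : IsProbabilityMeasure (ptsLaw μ) := by
  unfold ptsLaw; infer_instance

/-- The number of the points of one piece in the set `A`. -/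
def cnt (A : Set X) (w : ℕ × (ℕ → X)) : ℕ := ∑ j ∈ Finset.range w.1, A.indicator 1 (w.2 j)

/-- The counting measure of all points. -/
def pointMeas (ω : Pts X) : Measure X :=
  Measure.sum fun n => ∑ j ∈ Finset.range (ω n).1, Measure.dirac ((ω n).2 j)

lemma measurable_cnt {A : Set X} (hA : MeasurableSet A) : Measurable (cnt A) := by
  refine measurable_from_prod_countable_right fun N => ?_
  exact Finset.measurable_fun_sum (Finset.range N) fun j _ =>
    (measurable_one.indicator hA : Measurable (A.indicator (1 : X → ℕ))).comp
      (measurable_pi_apply j)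

lemma pointMeas_apply (ω : Pts X) {A : Set X} (hA : MeasurableSet A) :
    pointMeas ω A = ∑' n, (cnt A (ω n) : ℝ≥0∞) := by
  rw [pointMeas, Measure.sum_apply _ hA]
  refine tsum_congr fun n => ?_
  rw [Measure.finsetSum_apply, cnt, Nat.cast_sum]
  refine Finset.sum_congr rfl fun j _ => ?_
  rw [Measure.dirac_apply' _ hA]
  by_cases h : (ω n).2 j ∈ A <;> simp [h]

lemma measurable_pointMeas : Measurable (pointMeas : Pts X → Measure X) := by
  refine Measure.measurable_of_measurable_coe _ fun A hA => ?_
  simp only [pointMeas_apply _ hA]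
  refine Measurable.tsum fun n => ?_
  exact (Measurable.of_discrete (f := fun n : ℕ => (n : ℝ≥0∞))).comp
    ((measurable_cnt hA).comp (measurable_pi_apply n))

variable [Nonempty X] (μ : Measure X) [SFinite μ]

lemma pieces_eq (n : ℕ) : (pieces μ n).mass • ((pieces μ n).normalize : Measure X) =
    sfiniteSeq μ n :=
  (congrArg (fun ρ : FiniteMeasure X => (ρ : Measure X))
    (pieces μ n).self_eq_mass_smul_normalize).symm

/-- Wald's identity: the mean number of points in `A` is the mass of `A`. -/
lemma lintegral_cnt (n : ℕ) {A : Set X} (hA : MeasurableSet A) :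
    ∫⁻ w, (cnt A w : ℝ≥0∞) ∂((poissonMeasure (pieces μ n).mass).prod
      (Measure.infinitePi fun _ : ℕ => ((pieces μ n).normalize : Measure X))) =
      sfiniteSeq μ n A := by
  have hm : Measurable fun w : ℕ × (ℕ → X) => (cnt A w : ℝ≥0∞) :=
    (Measurable.of_discrete (f := fun n : ℕ => (n : ℝ≥0∞))).comp (measurable_cnt hA)
  rw [lintegral_prod _ hm.aemeasurable]
  have h1 : ∀ N : ℕ, ∫⁻ x, (cnt A (N, x) : ℝ≥0∞)
      ∂(Measure.infinitePi fun _ : ℕ => ((pieces μ n).normalize : Measure X)) =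
      N * ((pieces μ n).normalize : Measure X) A := fun N => by
    have : ∀ x : ℕ → X, (cnt A (N, x) : ℝ≥0∞) =
        ∑ j ∈ Finset.range N, A.indicator (1 : X → ℝ≥0∞) (x j) := fun x => by
      rw [cnt, Nat.cast_sum]
      refine Finset.sum_congr rfl fun j _ => ?_
      by_cases h : x j ∈ A <;> simp [h]
    have hmj : ∀ j : ℕ, Measurable fun x : ℕ → X => A.indicator (1 : X → ℝ≥0∞) (x j) :=
      fun j => (measurable_one.indicator hA : Measurable (A.indicator (1 : X → ℝ≥0∞))).comp
        (measurable_pi_apply j)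
    simp only [this]
    rw [lintegral_finsetSum _ fun j _ => hmj j]
    have h2 : ∀ j : ℕ, ∫⁻ x, A.indicator (1 : X → ℝ≥0∞) (x j)
        ∂(Measure.infinitePi fun _ : ℕ => ((pieces μ n).normalize : Measure X)) =
        ((pieces μ n).normalize : Measure X) A := fun j => by
      have := (measurePreserving_eval_infinitePi
        (fun _ : ℕ => ((pieces μ n).normalize : Measure X)) j).lintegral_comp
        (measurable_one.indicator hA : Measurable (A.indicator (1 : X → ℝ≥0∞)))
      rw [lintegral_indicator_one hA] at this
      exact this
    simp [h2]
  simp only [h1]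
  rw [lintegral_mul_const _ .of_discrete, lintegral_natCast_poissonMeasure, ← pieces_eq μ n]
  rfl

lemma lintegral_pointMeas {A : Set X} (hA : MeasurableSet A) :
    ∫⁻ ω, pointMeas ω A ∂(ptsLaw μ) = μ A := by
  simp only [pointMeas_apply _ hA]
  have hm : Measurable fun w : ℕ × (ℕ → X) => (cnt A w : ℝ≥0∞) :=
    (Measurable.of_discrete (f := fun n : ℕ => (n : ℝ≥0∞))).comp (measurable_cnt hA)
  have hmn : ∀ n : ℕ, Measurable fun ω : Pts X => (cnt A (ω n) : ℝ≥0∞) :=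
    fun n => hm.comp (measurable_pi_apply n)
  rw [lintegral_tsum fun n => (hmn n).aemeasurable]
  conv_rhs => rw [← sum_sfiniteSeq μ, Measure.sum_apply _ hA]
  refine tsum_congr fun n => ?_
  rw [← lintegral_cnt μ n hA]
  exact (measurePreserving_eval_infinitePi (fun n => (poissonMeasure (pieces μ n).mass).prod
    (Measure.infinitePi fun _ : ℕ => ((pieces μ n).normalize : Measure X))) n).lintegral_comp hm

variable {ι : Type*} [Fintype ι] {A : ι → Set X}

/-- The characteristic function of the numbers of the points of one piece in disjoint sets. -/
lemma integral_exp_cnt (hA : ∀ i, MeasurableSet (A i))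
    (hd : Pairwise (Function.onFun Disjoint A)) (θ : ι → ℝ) (n : ℕ) :
    ∫ w, exp (∑ i, (θ i * cnt (A i) w : ℝ) * I) ∂((poissonMeasure (pieces μ n).mass).prod
      (Measure.infinitePi fun _ : ℕ => ((pieces μ n).normalize : Measure X))) =
      exp (∑ i, (exp (θ i * I) - 1) * (sfiniteSeq μ n).real (A i)) := by
  set ρ : Measure X := ((pieces μ n).normalize : Measure X) with hρ
  set g : X → ℂ := fun x => ∏ i, exp ((θ i * (A i).indicator 1 x : ℝ) * I) with hg
  have hgm : Measurable g := Finset.measurable_fun_prod _ fun i _ =>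
    Complex.measurable_exp.comp ((Complex.measurable_ofReal.comp
      ((measurable_one.indicator (hA i)).const_mul _)).mul_const _)
  -- at most one of the disjoint sets contains `x`
  have hg1 : ∀ x, g x = 1 + ∑ i, (exp (θ i * I) - 1) * (A i).indicator 1 x := fun x => by
    by_cases hx : ∃ i, x ∈ A i
    · obtain ⟨i, hi⟩ := hx
      have hne : ∀ j, j ≠ i → x ∉ A j := fun j hj hxj => (hd hj).le_bot ⟨hxj, hi⟩
      rw [hg]
      simp only
      rw [Finset.prod_eq_single i (fun j _ hj => by simp [hne j hj]) (by simp),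
        Finset.sum_eq_single i (fun j _ hj => by simp [hne j hj]) (by simp)]
      simp [hi]
    · push Not at hx
      simp [hg, hx]
  have hint : ∀ i, Integrable ((A i).indicator (1 : X → ℂ)) ρ := fun i =>
    (integrable_const (1 : ℂ)).indicator (hA i)
  have hφ : ∫ x, g x ∂ρ = 1 + ∑ i, (exp (θ i * I) - 1) * (ρ.real (A i) : ℂ) := by
    simp only [hg1]
    rw [integral_add (integrable_const _) (integrable_finsetSum _ fun i _ => (hint i).const_mul _),
      integral_finsetSum _ fun i _ => (hint i).const_mul _]
    congr 1
    · simp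
    · refine Finset.sum_congr rfl fun i _ => ?_
      rw [integral_const_mul]
      congr 1
      have := integral_indicator_const (μ := ρ) (1 : ℂ) (hA i)
      rw [real_smul, mul_one] at this
      exact this
  have h1 : ∀ N : ℕ, ∫ x, exp (∑ i, (θ i * cnt (A i) (N, x) : ℝ) * I)
      ∂(Measure.infinitePi fun _ : ℕ => ρ) = (∫ x, g x ∂ρ) ^ N := fun N => by
    rw [← Finset.card_range N, ← Finset.prod_const,
      ← integral_infinitePi_prod (fun _ => ρ) _ (fun _ => g) (fun _ => hgm)]
    refine integral_congr_ae (ae_of_all _ fun x => ?_)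
    simp only [hg, ← exp_sum, cnt, Finset.card_range]
    rw [Finset.sum_comm]
    congr 1
    refine Finset.sum_congr rfl fun i _ => ?_
    rw [← Finset.sum_mul]
    congr 1
    push_cast
    rw [Finset.mul_sum]
    refine Finset.sum_congr rfl fun j _ => ?_
    by_cases h : x j ∈ A i <;> simp [h]
  have hmeas : Measurable fun w : ℕ × (ℕ → X) => exp (∑ i, (θ i * cnt (A i) w : ℝ) * I) := by
    refine Complex.measurable_exp.comp (Finset.measurable_fun_sum _ fun i _ =>
      (Complex.measurable_ofReal.comp (((Measurable.of_discrete
        (f := fun n : ℕ => (n : ℝ))).comp (measurable_cnt (hA i))).const_mul _)).mul_const _)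
  rw [integral_prod _ (Integrable.of_bound hmeas.aestronglyMeasurable 1 (ae_of_all _ fun w => by
    rw [← Finset.sum_mul, ← ofReal_sum, norm_exp_ofReal_mul_I]))]
  simp only [h1]
  rw [integral_pow_poissonMeasure, hφ, add_sub_cancel_left, Finset.mul_sum]
  congr 1
  refine Finset.sum_congr rfl fun i _ => ?_
  rw [mul_left_comm]
  congr 1
  rw [← pieces_eq μ n, measureReal_nnreal_smul_apply]
  push_cast
  rfl

end PoissonConstruction

section PoissonLaw

open Filter Topology Complex
open scoped NNReal

variable {X : Type*} [MeasurableSpace X] [Nonempty X] (μ : Measure X) [SFinite μ]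

lemma ae_pointMeas_ne_top {A : Set X} (hA : MeasurableSet A) (hμ : μ A ≠ ∞) :
    ∀ᵐ ω ∂(ptsLaw μ), pointMeas ω A ≠ ∞ := by
  have h := ae_lt_top (μ := ptsLaw μ) ((Measure.measurable_coe hA).comp measurable_pointMeas)
    (by
      have := lintegral_pointMeas μ hA
      simp only [Function.comp_apply]
      rw [this]; exact hμ)
  filter_upwards [h] with ω hω using hω.ne

variable {ι : Type*} [Fintype ι] {A : ι → Set X}

/-- The joint characteristic function of the numbers of points in disjoint sets. -/
lemma integral_exp_pointMeas (hA : ∀ i, MeasurableSet (A i)) (hμ : ∀ i, μ (A i) ≠ ∞)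
    (hd : Pairwise (Function.onFun Disjoint A)) (θ : ι → ℝ) :
    ∫ ω, exp (∑ i, (θ i * (pointMeas ω (A i)).toReal : ℝ) * I) ∂(ptsLaw μ) =
      exp (∑ i, (exp (θ i * I) - 1) * μ.real (A i)) := by
  have hmeas : Measurable fun w : ℕ × (ℕ → X) => exp (∑ i, (θ i * cnt (A i) w : ℝ) * I) :=
    Complex.measurable_exp.comp (Finset.measurable_fun_sum _ fun i _ =>
      (Complex.measurable_ofReal.comp (((Measurable.of_discrete
        (f := fun n : ℕ => (n : ℝ))).comp (measurable_cnt (hA i))).const_mul _)).mul_const _)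
  have h1 : ∀ M : ℕ, ∫ ω, ∏ n ∈ Finset.range M, exp (∑ i, (θ i * cnt (A i) (ω n) : ℝ) * I)
      ∂(ptsLaw μ) = exp (∑ i, (exp (θ i * I) - 1) *
        ∑ n ∈ Finset.range M, (sfiniteSeq μ n).real (A i)) := fun M => by
    rw [ptsLaw, integral_infinitePi_prod _ _ (fun _ w => exp (∑ i, (θ i * cnt (A i) w : ℝ) * I))
      fun _ => hmeas]
    simp only [integral_exp_cnt μ hA hd θ]
    rw [← exp_sum, Finset.sum_comm]
    simp [Finset.mul_sum]
  have hsum : ∀ i, Tendsto (fun M => ∑ n ∈ Finset.range M, (sfiniteSeq μ n).real (A i)) atTop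
      (𝓝 (μ.real (A i))) := fun i => by
    have h2 : ∑' n, sfiniteSeq μ n (A i) = μ (A i) := by
      conv_rhs => rw [← sum_sfiniteSeq μ, Measure.sum_apply _ (hA i)]
    have h3 := ENNReal.hasSum_toReal (f := fun n => sfiniteSeq μ n (A i)) (by rw [h2]; exact hμ i)
    rw [← ENNReal.tsum_toReal_eq fun n => by finiteness, h2] at h3
    exact h3.tendsto_sum_nat
  have hR : Tendsto (fun M => exp (∑ i, (exp (θ i * I) - 1) *
        ∑ n ∈ Finset.range M, (sfiniteSeq μ n).real (A i))) atTop
      (𝓝 (exp (∑ i, (exp (θ i * I) - 1) * μ.real (A i)))) := by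
    refine (Complex.continuous_exp.tendsto _).comp (tendsto_finsetSum _ fun i _ =>
      Tendsto.const_mul _ ?_)
    have := (Complex.continuous_ofReal.tendsto _).comp (hsum i)
    simpa [Function.comp_def] using this
  refine tendsto_nhds_unique ?_ hR
  simp only [← h1]
  refine tendsto_integral_of_dominated_convergence (fun _ => 1) (fun M => ?_)
    (integrable_const _) (fun M => ae_of_all _ fun ω => ?_) ?_
  · exact (Finset.measurable_fun_prod (Finset.range M) fun n _ =>
      hmeas.comp (measurable_pi_apply (n : ℕ))).aestronglyMeasurable
  · rw [norm_prod]
    refine (Finset.prod_eq_one fun n _ => ?_).le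
    rw [← Finset.sum_mul, ← ofReal_sum, norm_exp_ofReal_mul_I]
  · filter_upwards [ae_all_iff.2 fun i => ae_pointMeas_ne_top μ (hA i) (hμ i)] with ω hω
    have h4 : ∀ i, Tendsto (fun M => ∑ n ∈ Finset.range M, (cnt (A i) (ω n) : ℝ)) atTop
        (𝓝 (pointMeas ω (A i)).toReal) := fun i => by
      have h3 := ENNReal.hasSum_toReal (f := fun n => (cnt (A i) (ω n) : ℝ≥0∞))
        (by rw [← pointMeas_apply ω (hA i)]; exact hω i)
      rw [← ENNReal.tsum_toReal_eq fun n => by finiteness, ← pointMeas_apply ω (hA i)] at h3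
      simpa using h3.tendsto_sum_nat
    have h5 : ∀ M, ∏ n ∈ Finset.range M, exp (∑ i, (θ i * cnt (A i) (ω n) : ℝ) * I) =
        exp (∑ i, (θ i * ∑ n ∈ Finset.range M, (cnt (A i) (ω n) : ℝ) : ℝ) * I) := fun M => by
      rw [← exp_sum, Finset.sum_comm]
      congr 1
      refine Finset.sum_congr rfl fun i _ => ?_
      push_cast
      rw [Finset.mul_sum, Finset.sum_mul]
    simp only [h5]
    refine (Complex.continuous_exp.tendsto _).comp (tendsto_finsetSum _ fun i _ => ?_)
    exact ((Complex.continuous_ofReal.tendsto _).comp ((h4 i).const_mul (θ i))).mul_const I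

/-- The law of the number of points in a set of finite measure. -/
lemma map_pointMeas_toReal {A : Set X} (hA : MeasurableSet A) (hμ : μ A ≠ ∞) :
    (ptsLaw μ).map (fun ω => (pointMeas ω A).toReal) =
      (poissonMeasure (μ A).toNNReal).map (fun n : ℕ => (n : ℝ)) := by
  have hm : Measurable fun ω : Pts X => (pointMeas ω A).toReal :=
    ((Measure.measurable_coe hA).comp measurable_pointMeas).ennreal_toReal
  have := Measure.isProbabilityMeasure_map (μ := ptsLaw μ) hm.aemeasurable
  have := Measure.isProbabilityMeasure_map (μ := poissonMeasure (μ A).toNNReal)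
    (Measurable.of_discrete (f := fun n : ℕ => (n : ℝ))).aemeasurable
  refine Measure.ext_of_charFun (funext fun t => ?_)
  rw [charFun_map_cast_poissonMeasure, charFun_apply_real, integral_map hm.aemeasurable
    (by fun_prop)]
  have := integral_exp_pointMeas μ (A := fun _ : Unit => A) (fun _ => hA) (fun _ => hμ)
    (fun i j hij => absurd rfl hij) (fun _ => t)
  simp only [Finset.univ_unique, Finset.sum_singleton] at this
  push_cast at this
  rw [this, mul_comm (cexp _ - 1)]
  rfl

/-- The joint characteristic function of the counts in disjoint sets is a product. -/
lemma iIndepFun_pointMeas_toReal (hA : ∀ i, MeasurableSet (A i)) (hμ : ∀ i, μ (A i) ≠ ∞)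
    (hd : Pairwise (Function.onFun Disjoint A)) :
    iIndepFun (fun i ω => (pointMeas ω (A i)).toReal) (ptsLaw μ) := by
  have hm : ∀ i, Measurable fun ω : Pts X => (pointMeas ω (A i)).toReal := fun i =>
    ((Measure.measurable_coe (hA i)).comp measurable_pointMeas).ennreal_toReal
  rw [iIndepFun_iff_charFun_pi fun i => (hm i).aemeasurable]
  intro t
  simp only [map_pointMeas_toReal μ (hA _) (hμ _), charFun_map_cast_poissonMeasure]
  have hmt : Measurable fun ω : Pts X => WithLp.toLp 2 fun i => (pointMeas ω (A i)).toReal :=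
    (WithLp.measurable_toLp 2 _).comp (measurable_pi_lambda _ hm)
  rw [← exp_sum, charFun_apply, integral_map hmt.aemeasurable (by fun_prop)]
  have := integral_exp_pointMeas μ hA hμ hd t
  have h2 : ∀ ω : Pts X, inner ℝ (WithLp.toLp 2 fun i => (pointMeas ω (A i)).toReal) t =
      ∑ i, t i * (pointMeas ω (A i)).toReal := fun ω => by
    simp [PiLp.inner_apply]
  simp only [h2]
  push_cast at this ⊢
  simp only [Finset.sum_mul]
  rw [this]
  congr 1
  refine Finset.sum_congr rfl fun i _ => ?_
  rw [mul_comm]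
  rfl

/-- The law of the Poisson random measure with intensity `μ`. -/
def poissonLaw : Measure (Measure X) := (ptsLaw μ).map pointMeas

lemma isPoissonLaw_poissonLaw : IsPoissonLaw μ (poissonLaw μ) := by
  have hofReal : ∀ {A : Set X}, MeasurableSet A → μ A ≠ ∞ →
      (fun ω => pointMeas ω A) =ᵐ[ptsLaw μ] fun ω => ENNReal.ofReal (pointMeas ω A).toReal :=
    fun {A} hA hμ => by
      filter_upwards [ae_pointMeas_ne_top μ hA hμ] with ω hω
      rw [ENNReal.ofReal_toReal hω]
  refine ⟨Measure.isProbabilityMeasure_map measurable_pointMeas.aemeasurable,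
    fun A hA hμ => ?_, fun n A hA hμ hd => ?_⟩
  · have hm : Measurable fun ω : Pts X => (pointMeas ω A).toReal :=
      ((Measure.measurable_coe hA).comp measurable_pointMeas).ennreal_toReal
    rw [poissonLaw, Measure.map_map (Measure.measurable_coe hA) measurable_pointMeas]
    have h1 : (ptsLaw μ).map ((fun ω : Measure X => ω A) ∘ pointMeas) =
        (ptsLaw μ).map (ENNReal.ofReal ∘ fun ω => (pointMeas ω A).toReal) :=
      Measure.map_congr (hofReal hA hμ)
    rw [h1, ← Measure.map_map ENNReal.measurable_ofReal hm, map_pointMeas_toReal μ hA hμ,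
      Measure.map_map ENNReal.measurable_ofReal .of_discrete]
    congr 1
    ext n
    simp
  · have := Measure.isProbabilityMeasure_map (μ := ptsLaw μ)
      (measurable_pointMeas (X := X)).aemeasurable
    have h1 : iIndepFun (fun i ω => pointMeas ω (A i)) (ptsLaw μ) :=
      ((iIndepFun_pointMeas_toReal μ hA hμ fun i j hij => hd i j hij).comp
        (fun _ => ENNReal.ofReal) fun _ => ENNReal.measurable_ofReal).congr
        fun i => (hofReal (hA i) (hμ i)).symm
    have hme : ∀ i, Measurable fun ω : Measure X => ω (A i) :=
      fun i => Measure.measurable_coe (hA i)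
    have hmp : ∀ i, Measurable fun ω : Pts X => pointMeas ω (A i) :=
      fun i => (hme i).comp measurable_pointMeas
    rw [iIndepFun_iff_map_fun_eq_pi_map fun i => (hmp i).aemeasurable] at h1
    rw [poissonLaw, iIndepFun_iff_map_fun_eq_pi_map fun i => (hme i).aemeasurable,
      Measure.map_map (measurable_pi_lambda _ hme) measurable_pointMeas]
    simp only [Measure.map_map (hme _) measurable_pointMeas]
    exact h1

end PoissonLaw

/-! ### Mixing along a sequence of maps -/

section MixingSequence

open Filter Topology

lemma hasSum_measureReal_iUnion {Y : Type*} [MeasurableSpace Y] {Q : Measure Y} [IsFiniteMeasure Q]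
    {E : ℕ → Set Y} (hE : ∀ j, MeasurableSet (E j)) (hd : Pairwise (Function.onFun Disjoint E)) :
    HasSum (fun j => Q.real (E j)) (Q.real (⋃ j, E j)) := by
  have h := measure_iUnion (μ := Q) hd hE
  have h2 := ENNReal.hasSum_toReal (f := fun n => Q (E n)) (by rw [← h]; finiteness)
  rw [← ENNReal.tsum_toReal_eq fun n => by finiteness, ← h] at h2
  exact h2

variable {Y : Type*} [MeasurableSpace Y] {Q : Measure Y} [IsProbabilityMeasure Q] {S : ℕ → Y → Y}

/-- The pair `(E, F)` of events is asymptotically independent along the sequence `S`. -/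
def MixingPair (Q : Measure Y) (S : ℕ → Y → Y) (E F : Set Y) : Prop :=
  Tendsto (fun n => Q.real (E ∩ S n ⁻¹' F)) atTop (𝓝 (Q.real E * Q.real F))

lemma mixingPair_empty_left (F : Set Y) : MixingPair Q S ∅ F := by simp [MixingPair]

lemma mixingPair_compl_left (hS : ∀ n, MeasurePreserving (S n) Q Q) {E F : Set Y}
    (hE : MeasurableSet E) (hF : MeasurableSet F) (h : MixingPair Q S E F) :
    MixingPair Q S Eᶜ F := by
  have h1 : ∀ n, Q.real (Eᶜ ∩ S n ⁻¹' F) = Q.real F - Q.real (E ∩ S n ⁻¹' F) := fun n => by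
    have h2 := measureReal_inter_add_sdiff (μ := Q) (s := S n ⁻¹' F) hE
    have h3 : Q.real (S n ⁻¹' F) = Q.real F := by
      rw [measureReal_def, (hS n).measure_preimage hF.nullMeasurableSet, measureReal_def]
    rw [sdiff_eq, inter_comm _ E, inter_comm _ Eᶜ] at h2
    linarith
  have h4 : Q.real Eᶜ * Q.real F = Q.real F - Q.real E * Q.real F := by
    rw [probReal_compl_eq_one_sub hE]; ring
  rw [MixingPair, h4]
  simp only [h1]
  exact tendsto_const_nhds.sub h

lemma mixingPair_iUnion_left {E : ℕ → Set Y} {F : Set Y} (hS : ∀ n, MeasurePreserving (S n) Q Q)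
    (hE : ∀ j, MeasurableSet (E j)) (hF : MeasurableSet F)
    (hd : Pairwise (Function.onFun Disjoint E))
    (h : ∀ j, MixingPair Q S (E j) F) : MixingPair Q S (⋃ j, E j) F := by
  have hs : HasSum (fun j => Q.real (E j)) (Q.real (⋃ j, E j)) :=
    hasSum_measureReal_iUnion hE hd
  have h1 : ∀ n, Q.real ((⋃ j, E j) ∩ S n ⁻¹' F) = ∑' j, Q.real (E j ∩ S n ⁻¹' F) := fun n => by
    rw [iUnion_inter]
    exact ((hasSum_measureReal_iUnion (fun j => (hE j).inter ((hS n).measurable hF))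
      fun i j hij => (hd hij).mono inter_subset_left inter_subset_left).tsum_eq).symm
  rw [MixingPair, ← hs.tsum_eq, ← tsum_mul_right]
  simp only [h1]
  refine tendsto_tsum_of_dominated_convergence hs.summable h
    (Eventually.of_forall fun n j => ?_)
  rw [Real.norm_of_nonneg measureReal_nonneg]
  exact measureReal_mono inter_subset_left

lemma mixingPair_compl_right (hS : ∀ n, MeasurePreserving (S n) Q Q) {E F : Set Y}
    (hF : MeasurableSet F) (h : MixingPair Q S E F) :
    MixingPair Q S E Fᶜ := by
  have h1 : ∀ n, Q.real (E ∩ S n ⁻¹' Fᶜ) = Q.real E - Q.real (E ∩ S n ⁻¹' F) := fun n => by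
    have h2 := measureReal_inter_add_sdiff (μ := Q) (s := E) ((hS n).measurable hF)
    rw [sdiff_eq, ← preimage_compl] at h2
    linarith
  have h4 : Q.real E * Q.real Fᶜ = Q.real E - Q.real E * Q.real F := by
    rw [probReal_compl_eq_one_sub hF]; ring
  rw [MixingPair, h4]
  simp only [h1]
  exact tendsto_const_nhds.sub h

lemma mixingPair_iUnion_right {E : Set Y} {F : ℕ → Set Y} (hS : ∀ n, MeasurePreserving (S n) Q Q)
    (hE : MeasurableSet E) (hF : ∀ j, MeasurableSet (F j))
    (hd : Pairwise (Function.onFun Disjoint F))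
    (h : ∀ j, MixingPair Q S E (F j)) : MixingPair Q S E (⋃ j, F j) := by
  have hs : HasSum (fun j => Q.real (F j)) (Q.real (⋃ j, F j)) :=
    hasSum_measureReal_iUnion hF hd
  have h1 : ∀ n, Q.real (E ∩ S n ⁻¹' ⋃ j, F j) = ∑' j, Q.real (E ∩ S n ⁻¹' F j) := fun n => by
    rw [preimage_iUnion, inter_iUnion]
    exact ((hasSum_measureReal_iUnion (fun j => hE.inter ((hS n).measurable (hF j)))
      fun i j hij => ((hd hij).preimage _).mono inter_subset_right inter_subset_right).tsum_eq).symm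
  rw [MixingPair, ← hs.tsum_eq, ← tsum_mul_left]
  simp only [h1]
  refine tendsto_tsum_of_dominated_convergence hs.summable h
    (Eventually.of_forall fun n j => ?_)
  rw [Real.norm_of_nonneg measureReal_nonneg]
  refine (measureReal_mono inter_subset_right).trans_eq ?_
  rw [measureReal_def, (hS n).measure_preimage (hF j).nullMeasurableSet, measureReal_def]

/-- Asymptotic independence extends from a generating π-system to all events. -/
lemma mixingPair_of_generateFrom (hS : ∀ n, MeasurePreserving (S n) Q Q) {C : Set (Set Y)}
    (hC : IsPiSystem C) (hgen : ‹MeasurableSpace Y› = MeasurableSpace.generateFrom C)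
    (h : ∀ E ∈ C, ∀ F ∈ C, MixingPair Q S E F) {E F : Set Y} (hE : MeasurableSet E)
    (hF : MeasurableSet F) : MixingPair Q S E F := by
  have hCm : ∀ E ∈ C, MeasurableSet E := fun E hE => by
    rw [hgen]; exact MeasurableSpace.measurableSet_generateFrom hE
  have h1 : ∀ F ∈ C, ∀ E, MeasurableSet E → MixingPair Q S E F := fun F hF E hE => by
    induction E, hE using MeasurableSpace.induction_on_inter hgen hC with
    | empty => exact mixingPair_empty_left F
    | basic E hE => exact h E hE F hF
    | compl E hE ih => exact mixingPair_compl_left hS hE (hCm F hF) ih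
    | iUnion f hd hm ih => exact mixingPair_iUnion_left hS hm (hCm F hF) hd ih
  induction F, hF using MeasurableSpace.induction_on_inter hgen hC with
  | empty => simp [MixingPair]
  | basic F hF => exact h1 F hF E hE
  | compl F hF ih => exact mixingPair_compl_right hS hF ih
  | iUnion f hd hm ih => exact mixingPair_iUnion_right hS hE hm hd ih

/-- Mixing along a sequence passes to the Cartesian square. -/
lemma mixingPair_prod (hS : ∀ n, MeasurePreserving (S n) Q Q)
    (h : ∀ E F, MeasurableSet E → MeasurableSet F → MixingPair Q S E F) {E F : Set (Y × Y)}
    (hE : MeasurableSet E) (hF : MeasurableSet F) :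
    MixingPair (Q.prod Q) (fun n => Prod.map (S n) (S n)) E F := by
  refine mixingPair_of_generateFrom (fun n => (hS n).prod (hS n)) isPiSystem_prod
    generateFrom_prod.symm ?_ hE hF
  rintro _ ⟨E₁, hE₁, E₂, hE₂, rfl⟩ _ ⟨F₁, hF₁, F₂, hF₂, rfl⟩
  have h1 := (h E₁ F₁ hE₁ hF₁).mul (h E₂ F₂ hE₂ hF₂)
  have h2 : ∀ n, (Q.prod Q).real (E₁ ×ˢ E₂ ∩ Prod.map (S n) (S n) ⁻¹' F₁ ×ˢ F₂) =
      Q.real (E₁ ∩ S n ⁻¹' F₁) * Q.real (E₂ ∩ S n ⁻¹' F₂) := fun n => by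
    rw [← measureReal_prod_prod, ← prod_inter_prod]
    rfl
  rw [MixingPair, measureReal_prod_prod, measureReal_prod_prod]
  simp only [h2]
  convert h1 using 2
  ring

end MixingSequence

/-! ### Properties of Poisson laws -/

section PoissonProperties

open Filter Topology

variable {X : Type*} [MeasurableSpace X] {μ : Measure X} {P : Measure (Measure X)}

/-- The values of a measure on the sets of a family. -/
def evalFam {ι : Type*} (A : ι → Set X) (ω : Measure X) : ι → ℝ≥0∞ := fun i => ω (A i)

lemma measurable_evalFam {ι : Type*} {A : ι → Set X} (hA : ∀ i, MeasurableSet (A i)) :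
    Measurable (evalFam A) :=
  measurable_pi_lambda _ fun i => Measure.measurable_coe (hA i)

lemma iIndepFun_of_isPoissonLaw (hP : IsPoissonLaw μ P) {ι : Type*} [Fintype ι] {A : ι → Set X}
    (hA : ∀ i, MeasurableSet (A i)) (hμ : ∀ i, μ (A i) ≠ ∞)
    (hd : Pairwise (Function.onFun Disjoint A)) :
    iIndepFun (fun i (ω : Measure X) => ω (A i)) P := by
  have h := hP.indep _ (A ∘ (Fintype.equivFin ι).symm) (fun i => hA _) (fun i => hμ _)
    fun i j hij => hd fun h => hij ((Fintype.equivFin ι).symm.injective h)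
  have h2 := h.precomp (Fintype.equivFin ι).injective
  simpa [Function.comp_def] using h2

/-- The nonempty finite sets of indices. -/
abbrev NESet (ι : Type*) : Type _ := {S : Finset ι // S.Nonempty}

variable {ι ι' : Type*} {A : ι → Set X} {A' : ι' → Set X}

/-- The points which belong to exactly those sets of the family which have an index in `S`. -/
def atom (A : ι → Set X) (S : NESet ι) : Set X := {x | ∀ i, x ∈ A i ↔ i ∈ S.1}

lemma atom_subset {S : NESet ι} {i : ι} (hi : i ∈ S.1) : atom A S ⊆ A i :=
  fun _ hx => (hx i).2 hi

lemma disjoint_atom : Pairwise (Function.onFun Disjoint (atom A)) := by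
  refine fun S S' h => disjoint_left.2 fun x hx hx' => h ?_
  ext i
  rw [← hx i, hx' i]

lemma measure_atom_ne_top (hμ : ∀ i, μ (A i) ≠ ∞) (S : NESet ι) : μ (atom A S) ≠ ∞ := by
  obtain ⟨i, hi⟩ := S.2
  exact measure_ne_top_of_subset (atom_subset hi) (hμ i)

variable [Fintype ι] [Fintype ι']

lemma measurableSet_atom (hA : ∀ i, MeasurableSet (A i)) (S : NESet ι) :
    MeasurableSet (atom A S) := by
  have : atom A S = ⋂ i, {x | x ∈ A i ↔ i ∈ S.1} := by ext x; simp [atom]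
  rw [this]
  refine MeasurableSet.iInter fun i => ?_
  by_cases h : i ∈ S.1
  · simpa [h] using hA i
  · have h1 : {x | x ∈ A i ↔ i ∈ S.1} = (A i)ᶜ := by ext x; simp [h]
    rw [h1]
    exact (hA i).compl

open Classical in
/-- The map which recovers the values on the sets of a family from the values on its atoms. -/
def sumAtoms (v : NESet ι → ℝ≥0∞) : ι → ℝ≥0∞ := fun i => ∑ S : NESet ι, if i ∈ S.1 then v S else 0

lemma measurable_sumAtoms : Measurable (sumAtoms (ι := ι)) := by
  refine measurable_pi_lambda _ fun i => Finset.measurable_fun_sum _ fun S _ => ?_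
  split_ifs
  · exact measurable_pi_apply S
  · exact measurable_const

lemma evalFam_eq_sumAtoms (hA : ∀ i, MeasurableSet (A i)) (ω : Measure X) :
    evalFam A ω = sumAtoms (evalFam (atom A) ω) := by
  classical
  funext i
  have h : A i = ⋃ S ∈ (Finset.univ.filter fun S : NESet ι => i ∈ S.1), atom A S := by
    ext x
    simp only [Finset.mem_filter_univ, mem_iUnion, exists_prop]
    refine ⟨fun hx => ⟨⟨Finset.univ.filter fun j => x ∈ A j, i, by simpa using hx⟩, by simpa using hx,
      fun j => by simp⟩, ?_⟩
    rintro ⟨S, hS, hx⟩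
    exact atom_subset hS hx
  rw [evalFam, h, measure_biUnion_finset (fun S _ S' _ hSS' => disjoint_atom hSS')
    fun S _ => measurableSet_atom hA S, Finset.sum_filter]
  unfold sumAtoms
  refine Finset.sum_congr rfl fun S _ => ?_
  congr

/-- The joint law of the values on the sets of a finite family depends only on the intensity. -/
lemma map_evalFam (hP : IsPoissonLaw μ P) (hA : ∀ i, MeasurableSet (A i))
    (hμ : ∀ i, μ (A i) ≠ ∞) :
    P.map (evalFam A) = (Measure.pi fun S : NESet ι =>
      (poissonMeasure (μ (atom A S)).toNNReal).map (fun n : ℕ => (n : ℝ≥0∞))).map sumAtoms := by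
  have := hP.isProbabilityMeasure
  have hm := measurableSet_atom hA
  have h1 : evalFam A = sumAtoms ∘ evalFam (atom A) := funext (evalFam_eq_sumAtoms hA)
  have h2 := iIndepFun_of_isPoissonLaw hP hm (measure_atom_ne_top hμ) disjoint_atom
  rw [iIndepFun_iff_map_fun_eq_pi_map fun S => (Measure.measurable_coe (hm S)).aemeasurable] at h2
  rw [h1, ← Measure.map_map measurable_sumAtoms (measurable_evalFam hm)]
  congr 1
  simp only [hP.poisson _ (hm _) (measure_atom_ne_top hμ _)] at h2
  exact h2

/-- The values on sets of two families which live on disjoint sets are independent. -/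
lemma indepFun_evalFam (hP : IsPoissonLaw μ P) (hA : ∀ i, MeasurableSet (A i))
    (hμ : ∀ i, μ (A i) ≠ ∞) (hA' : ∀ i, MeasurableSet (A' i)) (hμ' : ∀ i, μ (A' i) ≠ ∞)
    (hd : ∀ i j, Disjoint (A i) (A' j)) : IndepFun (evalFam A) (evalFam A') P := by
  classical
  have hm := measurableSet_atom hA
  have hm' := measurableSet_atom hA'
  have h1 : evalFam A = sumAtoms ∘ evalFam (atom A) := funext (evalFam_eq_sumAtoms hA)
  have h1' : evalFam A' = sumAtoms ∘ evalFam (atom A') := funext (evalFam_eq_sumAtoms hA')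
  rw [h1, h1']
  refine IndepFun.comp ?_ measurable_sumAtoms measurable_sumAtoms
  have hdd : ∀ S S', Disjoint (atom A S) (atom A' S') := fun S S' => by
    obtain ⟨i, hi⟩ := S.2
    obtain ⟨j, hj⟩ := S'.2
    exact (hd i j).mono (atom_subset hi) (atom_subset hj)
  have hmm : ∀ S : NESet ι ⊕ NESet ι', MeasurableSet (Sum.elim (atom A) (atom A') S) := by
    rintro (S | S)
    exacts [hm S, hm' S]
  have h2 := iIndepFun_of_isPoissonLaw hP (A := Sum.elim (atom A) (atom A')) hmm
    (by
      rintro (S | S)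
      exacts [measure_atom_ne_top hμ S, measure_atom_ne_top hμ' S])
    (by
      rintro (S | S) (S' | S') h
      · exact disjoint_atom fun h' => h (h' ▸ rfl)
      · exact hdd S S'
      · exact (hdd S' S).symm
      · exact disjoint_atom fun h' => h (h' ▸ rfl))
  have h3 := h2.indepFun_finset (Finset.univ.map ⟨Sum.inl, Sum.inl_injective⟩)
    (Finset.univ.map ⟨Sum.inr, Sum.inr_injective⟩)
    (by
      rw [Finset.disjoint_left]
      simp)
    fun S => Measure.measurable_coe (hmm S)
  exact h3.comp
    (φ := fun v (S : NESet ι) => v ⟨Sum.inl S, by simp⟩)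
    (ψ := fun v (S : NESet ι') => v ⟨Sum.inr S, by simp⟩)
    (measurable_pi_lambda _ fun S => measurable_pi_apply _)
    (measurable_pi_lambda _ fun S => measurable_pi_apply _)

variable (μ) in
/-- The events which depend on the values on finitely many sets of finite measure. -/
def cylEvents : Set (Set (Measure X)) :=
  {E | ∃ (ι : Type) (_ : Fintype ι) (A : ι → Set X) (B : Set (ι → ℝ≥0∞)),
    (∀ i, MeasurableSet (A i)) ∧ (∀ i, μ (A i) ≠ ∞) ∧ MeasurableSet B ∧ E = evalFam A ⁻¹' B}

lemma isPiSystem_cylEvents : IsPiSystem (cylEvents μ) := by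
  rintro _ ⟨ι, _, A, B, hA, hμ, hB, rfl⟩ _ ⟨ι', _, A', B', hA', hμ', hB', rfl⟩ _
  refine ⟨ι ⊕ ι', inferInstance, Sum.elim A A',
    (fun v i => v (Sum.inl i)) ⁻¹' B ∩ (fun v i => v (Sum.inr i)) ⁻¹' B', ?_, ?_,
    (measurable_pi_lambda _ (fun i => measurable_pi_apply _) hB).inter
      (measurable_pi_lambda _ (fun i => measurable_pi_apply _) hB'), rfl⟩
  · rintro (i | i)
    exacts [hA i, hA' i]
  · rintro (i | i)
    exacts [hμ i, hμ' i]

/-- Since `μ` is σ-finite, a measure is determined measurably by its values on sets of finite `μ`-measure. -/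
lemma generateFrom_cylEvents [SigmaFinite μ] :
    (inferInstance : MeasurableSpace (Measure X)) = MeasurableSpace.generateFrom (cylEvents μ) := by
  refine le_antisymm ?_ (MeasurableSpace.generateFrom_le ?_)
  · refine iSup₂_le fun A hA => ?_
    rw [← measurable_iff_comap_le]
    set D : ℕ → Set X := disjointed (spanningSets μ) with hD
    have hDm : ∀ n, MeasurableSet (D n) :=
      fun n => MeasurableSet.disjointed (measurableSet_spanningSets μ) n
    have h1 : ∀ ω : Measure X, ω A = ∑' n, ω (A ∩ D n) := fun ω => by
      rw [← measure_iUnion (fun i j hij => ((disjoint_disjointed _) hij).mono inter_subset_right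
        inter_subset_right) fun n => hA.inter (hDm n), ← inter_iUnion, iUnion_disjointed,
        iUnion_spanningSets, inter_univ]
    simp only [h1]
    have h2 : ∀ m : MeasurableSpace (Measure X), (∀ n, Measurable[m] fun ω => ω (A ∩ D n)) →
        Measurable[m] fun ω => ∑' n, ω (A ∩ D n) := fun m h => Measurable.tsum h
    refine h2 _ fun n B hB => ?_
    refine MeasurableSpace.measurableSet_generateFrom
      ⟨Unit, inferInstance, fun _ => A ∩ D n, (fun v => v ()) ⁻¹' B, fun _ => hA.inter (hDm n),
        fun _ => ?_, measurable_pi_apply _ hB, rfl⟩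
    exact measure_ne_top_of_subset (inter_subset_right.trans (disjointed_subset _ _))
      (measure_spanningSets_lt_top μ n).ne
  · rintro _ ⟨ι, _, A, B, hA, hμ, hB, rfl⟩
    exact measurable_evalFam hA hB

/-- The Poisson law is determined by a σ-finite intensity. -/
lemma isPoissonLaw_unique [SigmaFinite μ] {P' : Measure (Measure X)} (hP : IsPoissonLaw μ P)
    (hP' : IsPoissonLaw μ P') : P = P' := by
  have := hP.isProbabilityMeasure
  have := hP'.isProbabilityMeasure
  refine ext_of_generate_finite _ generateFrom_cylEvents (isPiSystem_cylEvents (μ := μ)) ?_ (by simp)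
  rintro _ ⟨ι, _, A, B, hA, hμ, hB, rfl⟩
  rw [← Measure.map_apply (measurable_evalFam hA) hB, ← Measure.map_apply (measurable_evalFam hA) hB,
    map_evalFam hP hA hμ, map_evalFam hP' hA hμ]

/-- The image of the Poisson random measure under a measure preserving map. -/
lemma measurePreserving_map_of_isPoissonLaw [SigmaFinite μ] (hP : IsPoissonLaw μ P) {T : X → X}
    (hT : MeasurePreserving T μ μ) : MeasurePreserving (fun ω : Measure X => ω.map T) P P := by
  have hm : Measurable fun ω : Measure X => ω.map T := Measure.measurable_map T hT.measurable
  refine ⟨hm, isPoissonLaw_unique (μ := μ) ⟨?_, fun A hA hμ => ?_, fun n A hA hμ hd => ?_⟩ hP⟩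
  · have := hP.isProbabilityMeasure
    exact Measure.isProbabilityMeasure_map hm.aemeasurable
  · rw [Measure.map_map (Measure.measurable_coe hA) hm]
    have h1 : ((fun ω : Measure X => ω A) ∘ fun ω : Measure X => ω.map T) =
        fun ω : Measure X => ω (T ⁻¹' A) :=
      funext fun ω => Measure.map_apply hT.measurable hA
    rw [h1, ← hT.measure_preimage hA.nullMeasurableSet]
    refine hP.poisson _ (hT.measurable hA) ?_
    rwa [hT.measure_preimage hA.nullMeasurableSet]
  · have := hP.isProbabilityMeasure
    have := Measure.isProbabilityMeasure_map (μ := P) hm.aemeasurable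
    have h := hP.indep n (fun i => T ⁻¹' A i) (fun i => hT.measurable (hA i))
      (fun i => by rw [hT.measure_preimage (hA i).nullMeasurableSet]; exact hμ i)
      fun i j hij => (hd i j hij).preimage T
    have hme : ∀ i, Measurable fun ω : Measure X => ω (A i) :=
      fun i => Measure.measurable_coe (hA i)
    have h1 : ∀ (ω : Measure X) i, (ω.map T) (A i) = ω (T ⁻¹' A i) :=
      fun ω i => Measure.map_apply hT.measurable (hA i)
    rw [iIndepFun_iff_map_fun_eq_pi_map fun i =>
      (Measure.measurable_coe (hT.measurable (hA i))).aemeasurable] at h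
    rw [iIndepFun_iff_map_fun_eq_pi_map fun i => (hme i).aemeasurable,
      Measure.map_map (measurable_pi_lambda _ hme) hm]
    have h2 : ∀ i, (P.map fun ω : Measure X => ω.map T).map (fun ω : Measure X => ω (A i)) =
        P.map fun ω : Measure X => ω (T ⁻¹' A i) := fun i => by
      rw [Measure.map_map (hme _) hm]
      exact congrArg (fun φ => P.map φ) (funext fun ω => h1 ω i)
    rw [show (fun i => (P.map fun ω : Measure X => ω.map T).map fun ω : Measure X => ω (A i)) =
      fun i => P.map fun ω : Measure X => ω (T ⁻¹' A i) from funext h2, ← h]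
    exact congrArg (fun φ => P.map φ) (funext fun ω => funext fun i => h1 ω i)

/-- Markov's inequality for the number of points in `A`. -/
lemma measure_ne_zero_le_of_isPoissonLaw (hP : IsPoissonLaw μ P) {A : Set X}
    (hA : MeasurableSet A) : P {ω | ω A ≠ 0} ≤ μ A := by
  by_cases hμ : μ A = ∞
  · rw [hμ]; exact le_top
  have h1 : P {ω | ω A ≠ 0} = poissonMeasure (μ A).toNNReal {n | n ≠ 0} := by
    have h2 : P.map (fun ω : Measure X => ω A) {0}ᶜ =
        (poissonMeasure (μ A).toNNReal).map (fun n : ℕ => (n : ℝ≥0∞)) {0}ᶜ := by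
      rw [hP.poisson A hA hμ]
    rw [Measure.map_apply (Measure.measurable_coe hA) (measurableSet_singleton _).compl,
      Measure.map_apply .of_discrete (measurableSet_singleton _).compl] at h2
    convert h2 using 2 <;>
    · ext n
      simp
  have h3 : poissonMeasure (μ A).toNNReal {n | n ≠ 0} ≤
      ∫⁻ n, (n : ℝ≥0∞) ∂(poissonMeasure (μ A).toNNReal) := by
    rw [← lintegral_indicator_one .of_discrete]
    refine lintegral_mono fun n => ?_
    by_cases h : n = 0
    · simp [h]
    · simp only [mem_ofPred_eq, ne_eq, h, not_false_eq_true, indicator_of_mem, Pi.one_apply]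
      exact_mod_cast Nat.one_le_iff_ne_zero.2 h
  rw [h1]
  refine h3.trans ?_
  rw [lintegral_natCast_poissonMeasure, ENNReal.coe_toNNReal hμ]

end PoissonProperties

/-! ### Poisson suspensions -/

section PoissonSuspension

open Filter Topology

variable {X : Type*} [MeasurableSpace X] {μ : Measure X} {P : Measure (Measure X)}

lemma abs_measureReal_sub_le {Y : Type*} [MeasurableSpace Y] {Q : Measure Y} [IsFiniteMeasure Q]
    {E E' N : Set Y} (h : E ⊆ E' ∪ N) (h' : E' ⊆ E ∪ N) :
    |Q.real E - Q.real E'| ≤ Q.real N := by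
  have h1 := (measureReal_mono h (μ := Q)).trans (measureReal_union_le _ _)
  have h2 := (measureReal_mono h' (μ := Q)).trans (measureReal_union_le _ _)
  rw [abs_le]
  constructor <;> linarith

/-- If the images of sets of finite measure become asymptotically disjoint from them, then cylinder
events are asymptotically independent under the suspension: up to the event that there is a point
in the small overlap, the two events depend on the points in disjoint sets. -/
lemma mixingPair_cylEvents (hP : IsPoissonLaw μ P) {T : ℕ → X → X}
    (hT : ∀ n, MeasurePreserving (T n) μ μ)
    (h0 : ∀ A, MeasurableSet A → μ A ≠ ∞ → Tendsto (fun n => μ (A ∩ T n ⁻¹' A)) atTop (𝓝 0))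
    {E F : Set (Measure X)} (hE : E ∈ cylEvents μ) (hF : F ∈ cylEvents μ) :
    MixingPair P (fun n ω => ω.map (T n)) E F := by
  have := hP.isProbabilityMeasure
  obtain ⟨ι, _, A, B, hA, hμ, hB, rfl⟩ := hE
  obtain ⟨ι', _, A', B', hA', hμ', hB', rfl⟩ := hF
  set U : Set X := (⋃ i, A i) ∪ ⋃ i, A' i with hU
  have hUm : MeasurableSet U := (MeasurableSet.iUnion hA).union (MeasurableSet.iUnion hA')
  have hUμ : μ U ≠ ∞ := by
    refine measure_union_ne_top ?_ ?_
    · exact ((measure_iUnion_fintype_le _ _).trans_lt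
        (ENNReal.sum_lt_top.2 fun i _ => (hμ i).lt_top)).ne
    · exact ((measure_iUnion_fintype_le _ _).trans_lt
        (ENNReal.sum_lt_top.2 fun i _ => (hμ' i).lt_top)).ne
  have hAT : ∀ n i, MeasurableSet (T n ⁻¹' A' i) := fun n i => (hT n).measurable (hA' i)
  have hV : ∀ n, MeasurableSet (T n ⁻¹' U) := fun n => (hT n).measurable hUm
  have hF : ∀ n, (fun ω : Measure X => ω.map (T n)) ⁻¹' (evalFam A' ⁻¹' B') =
      evalFam (fun i => T n ⁻¹' A' i) ⁻¹' B' := fun n => by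
    ext ω
    have h1 : evalFam A' (ω.map (T n)) = evalFam (fun i => T n ⁻¹' A' i) ω :=
      funext fun i => Measure.map_apply (hT n).measurable (hA' i)
    simp only [mem_preimage, h1]
  have hPF : ∀ n, P.real (evalFam (fun i => T n ⁻¹' A' i) ⁻¹' B') = P.real (evalFam A' ⁻¹' B') :=
    fun n => by
    rw [← hF n]
    have h1 := hP.poisson
    have hmu : ∀ i, μ (T n ⁻¹' A' i) ≠ ∞ := fun i => by
      rw [(hT n).measure_preimage (hA' i).nullMeasurableSet]; exact hμ' i
    have h2 : ∀ S, μ (atom (fun i => T n ⁻¹' A' i) S) = μ (atom A' S) := fun S => by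
      rw [← (hT n).measure_preimage (measurableSet_atom hA' S).nullMeasurableSet]
      rfl
    rw [hF n, measureReal_def, measureReal_def, ← Measure.map_apply (measurable_evalFam (hAT n)) hB',
      ← Measure.map_apply (measurable_evalFam hA') hB', map_evalFam hP (hAT n) hmu,
      map_evalFam hP hA' hμ']
    simp only [h2]
  -- `En n` is `E` for the points outside the overlap, and hence independent of the translate of `F`
  set En : ℕ → Set (Measure X) := fun n => evalFam (fun i => A i \ T n ⁻¹' U) ⁻¹' B with hEn
  have hind : ∀ n, P.real (En n ∩ evalFam (fun i => T n ⁻¹' A' i) ⁻¹' B') =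
      P.real (En n) * P.real (evalFam A' ⁻¹' B') := fun n => by
    rw [← hPF n, measureReal_def, measureReal_def, measureReal_def, ← ENNReal.toReal_mul]
    congr 1
    refine (indepFun_evalFam hP (fun i => (hA i).diff (hV n))
      (fun i => measure_ne_top_of_subset sdiff_subset (hμ i)) (hAT n) (fun i => ?_)
      fun i j => ?_).measure_inter_preimage_eq_mul _ _ hB hB'
    · rw [(hT n).measure_preimage (hA' i).nullMeasurableSet]; exact hμ' i
    · refine disjoint_left.2 fun x hx hx' => hx.2 ?_
      exact Or.inr (mem_iUnion.2 ⟨j, hx'⟩)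
  -- the event that there is a point in the overlap
  set N : ℕ → Set (Measure X) := fun n => {ω | ω (U ∩ T n ⁻¹' U) ≠ 0} with hN
  have hEN : ∀ n, ∀ ω ∉ N n, evalFam (fun i => A i \ T n ⁻¹' U) ω = evalFam A ω :=
    fun n ω hω => by
    funext i
    simp only [hN, mem_ofPred_eq, not_not] at hω
    refine measure_sdiff_null' ?_
    refine measure_mono_null (inter_subset_inter_left _ ?_) hω
    exact (subset_iUnion A i).trans subset_union_left
  have hN0 : Tendsto (fun n => P.real (N n)) atTop (𝓝 0) := by
    have h1 := (ENNReal.tendsto_toReal (ENNReal.zero_ne_top)).comp (h0 U hUm hUμ)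
    refine squeeze_zero (fun _ => measureReal_nonneg) (fun n => ?_) h1
    exact ENNReal.toReal_mono (measure_ne_top_of_subset inter_subset_left hUμ)
      (measure_ne_zero_le_of_isPoissonLaw hP (hUm.inter (hV n)))
  rw [MixingPair, tendsto_iff_norm_sub_tendsto_zero]
  refine squeeze_zero (fun _ => norm_nonneg _) (fun n => ?_)
    (by simpa using hN0.const_mul 2 : Tendsto (fun n => 2 * P.real (N n)) atTop (𝓝 0))
  rw [hF n, Real.norm_eq_abs]
  have h1 : |P.real (evalFam A ⁻¹' B ∩ evalFam (fun i => T n ⁻¹' A' i) ⁻¹' B') -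
      P.real (En n ∩ evalFam (fun i => T n ⁻¹' A' i) ⁻¹' B')| ≤ P.real (N n) := by
    refine abs_measureReal_sub_le (fun ω hω => ?_) fun ω hω => ?_
    · by_cases hn : ω ∈ N n
      · exact Or.inr hn
      · refine Or.inl ⟨?_, hω.2⟩
        rw [hEn]
        simp only [mem_preimage]
        rw [hEN n ω hn]
        exact hω.1
    · by_cases hn : ω ∈ N n
      · exact Or.inr hn
      · refine Or.inl ⟨?_, hω.2⟩
        have h := hω.1
        rw [hEn] at h
        simp only [mem_preimage] at h
        rwa [hEN n ω hn] at h
  have h2 : |P.real (En n) - P.real (evalFam A ⁻¹' B)| ≤ P.real (N n) := by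
    refine abs_measureReal_sub_le (fun ω hω => ?_) fun ω hω => ?_
    · by_cases hn : ω ∈ N n
      · exact Or.inr hn
      · rw [hEn] at hω
        simp only [mem_preimage] at hω
        rw [hEN n ω hn] at hω
        exact Or.inl hω
    · by_cases hn : ω ∈ N n
      · exact Or.inr hn
      · refine Or.inl ?_
        rw [hEn]
        simp only [mem_preimage]
        rw [hEN n ω hn]
        exact hω
  rw [hind n] at h1
  have h3 : |P.real (En n) * P.real (evalFam A' ⁻¹' B') -
      P.real (evalFam A ⁻¹' B) * P.real (evalFam A' ⁻¹' B')| ≤ P.real (N n) := by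
    rw [← sub_mul, abs_mul, abs_of_nonneg (measureReal_nonneg (s := evalFam A' ⁻¹' B'))]
    exact (mul_le_of_le_one_right (abs_nonneg _) measureReal_le_one).trans h2
  calc _ ≤ _ := abs_sub_le _ (P.real (En n) * P.real (evalFam A' ⁻¹' B')) _
    _ ≤ _ := by linarith

variable [SigmaFinite μ]

/-- A measure preserving flow under which sets of finite measure return less and less to themselves
along some sequence of times has a weakly mixing Poisson suspension. -/
lemma isWeaklyMixingFlow_suspensionFlow (hP : IsPoissonLaw μ P) {T : ℝ → X → X}
    (hT : ∀ t, MeasurePreserving (T t) μ μ) (t : ℕ → ℝ)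
    (h0 : ∀ A, MeasurableSet A → μ A ≠ ∞ → Tendsto (fun n => μ (A ∩ T (t n) ⁻¹' A)) atTop (𝓝 0)) :
    IsWeaklyMixingFlow (suspensionFlow T) P := by
  have := hP.isProbabilityMeasure
  have hS : ∀ n, MeasurePreserving (fun ω : Measure X => ω.map (T (t n))) P P :=
    fun n => measurePreserving_map_of_isPoissonLaw hP (hT (t n))
  intro F hF hinv
  have h1 := mixingPair_prod hS (fun E F hE hF => mixingPair_of_generateFrom hS
    (isPiSystem_cylEvents (μ := μ)) generateFrom_cylEvents
    (fun E hE F hF => mixingPair_cylEvents hP (fun n => hT (t n)) h0 hE hF) hE hF) hF hF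
  have h2 : ∀ n, (P.prod P).real (F ∩ Prod.map (fun ω : Measure X => ω.map (T (t n)))
      (fun ω : Measure X => ω.map (T (t n))) ⁻¹' F) = (P.prod P).real F := fun n => by
    refine measureReal_congr ?_
    have h3 := (ae_eq_refl (μ := P.prod P) F).inter (hinv (t n))
    rw [inter_self] at h3
    exact h3
  rw [MixingPair] at h1
  simp only [h2] at h1
  -- mixing of the invariant set `F` with itself
  have h3 : (P.prod P).real F = (P.prod P).real F * (P.prod P).real F :=
    tendsto_nhds_unique tendsto_const_nhds h1
  have h4 : (P.prod P).real F = 0 ∨ (P.prod P).real F = 1 := by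
    have h5 : (P.prod P).real F * ((P.prod P).real F - 1) = 0 := by linarith
    rcases mul_eq_zero.1 h5 with h | h
    · exact Or.inl h
    · exact Or.inr (by linarith)
  rcases h4 with h | h
  · left
    rwa [measureReal_eq_zero_iff] at h
  · right
    rw [← measureReal_eq_zero_iff, probReal_compl_eq_one_sub hF, h, sub_self]

lemma measurableSet_measure_lt_top {D : Set X} (hD : MeasurableSet D) :
    MeasurableSet {ω : Measure X | ω D < ∞} :=
  measurableSet_lt (Measure.measurable_coe hD) measurable_const

open Classical in
/-- The kernel `ω ↦ ω.restrict D`, set to zero where it is not finite. -/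
def restrictKernel {D : Set X} (hD : MeasurableSet D) : Kernel (Measure X) X :=
  Kernel.piecewise (measurableSet_measure_lt_top hD)
    (Kernel.restrict ⟨id, measurable_id⟩ hD) 0

lemma restrictKernel_of_lt {D : Set X} (hD : MeasurableSet D) {ω : Measure X} (h : ω D < ∞) :
    restrictKernel hD ω = ω.restrict D := by
  unfold restrictKernel
  rw [Kernel.piecewise_apply, if_pos (show ω ∈ {ω : Measure X | ω D < ∞} from h)]
  rfl

lemma isFiniteMeasure_restrictKernel {D : Set X} (hD : MeasurableSet D) (ω : Measure X) :
    IsFiniteMeasure (restrictKernel hD ω) := by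
  by_cases h : ω D < ∞
  · rw [restrictKernel_of_lt hD h]
    exact ⟨by simpa using h⟩
  · unfold restrictKernel
    rw [Kernel.piecewise_apply, if_neg (show ω ∉ {ω : Measure X | ω D < ∞} from h)]
    infer_instance

/-- The Poisson law is carried by the measures which are finite on each piece of a partition; on this
set `(t, ω) ↦ ω.map (T t)` is given by a countable sum of finite kernels, for which the dependence on
`t` is jointly measurable. -/
lemma aemeasurable_suspensionFlow (hP : IsPoissonLaw μ P) {T : ℝ → X → X}
    (hT : Measurable (Function.uncurry T)) :
    AEMeasurable (fun p : ℝ × Measure X => suspensionFlow T p.1 p.2)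
      ((volume : Measure ℝ).prod P) := by
  have := hP.isProbabilityMeasure
  have hTt : ∀ t, Measurable (T t) := fun t => hT.comp measurable_prodMk_left
  set D : ℕ → Set X := disjointed (spanningSets μ)
  have hD : ∀ n, MeasurableSet (D n) :=
    fun n => MeasurableSet.disjointed (measurableSet_spanningSets μ) n
  have hDμ : ∀ n, μ (D n) ≠ ∞ := fun n =>
    measure_ne_top_of_subset (disjointed_subset _ _) (measure_spanningSets_lt_top μ n).ne
  refine ⟨fun p => Measure.sum fun n => (restrictKernel (hD n) p.2).map (T p.1), ?_, ?_⟩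
  · refine Measure.measurable_of_measurable_coe _ fun A hA => ?_
    have h1 : ∀ p : ℝ × Measure X, (Measure.sum fun n => (restrictKernel (hD n) p.2).map (T p.1)) A =
        ∑' n, restrictKernel (hD n) p.2 (T p.1 ⁻¹' A) := fun p => by
      rw [Measure.sum_apply _ hA]
      exact tsum_congr fun n => Measure.map_apply (hTt _) hA
    simp only [h1]
    refine Measurable.tsum fun n => ?_
    have ht : MeasurableSet {q : (ℝ × Measure X) × X | T q.1.1 q.2 ∈ A} :=
      (hT.comp (measurable_fst.fst.prodMk measurable_snd)) hA
    exact Kernel.measurable_kernel_prodMk_left_of_finite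
      (κ := Kernel.prodMkLeft ℝ (restrictKernel (hD n))) ht
      fun p => isFiniteMeasure_restrictKernel (hD n) p.2
  · have h1 : ∀ᵐ ω ∂P, ∀ n, ω (D n) < ∞ := by
      refine ae_all_iff.2 fun n => ?_
      have h2 := hP.poisson (D n) (hD n) (hDμ n)
      have h3 : ∀ᵐ x ∂(P.map fun ω : Measure X => ω (D n)), x < ∞ := by
        rw [h2, ae_map_iff (Measurable.of_discrete).aemeasurable measurableSet_Iio]
        exact ae_of_all _ fun k => ENNReal.natCast_lt_top k
      exact ae_of_ae_map (Measure.measurable_coe (hD n)).aemeasurable h3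
    have h2 : ∀ᵐ p ∂((volume : Measure ℝ).prod P), ∀ n, p.2 (D n) < ∞ :=
      Measure.quasiMeasurePreserving_snd.ae h1
    filter_upwards [h2] with p hp
    have h3 : p.2 = Measure.sum fun n => restrictKernel (hD n) p.2 := by
      simp only [restrictKernel_of_lt (hD _) (hp _)]
      rw [← Measure.restrict_iUnion (disjoint_disjointed _) hD, iUnion_disjointed,
        iUnion_spanningSets, Measure.restrict_univ]
    rw [suspensionFlow, ← Measure.map_sum (hTt _).aemeasurable, ← h3]

lemma isMPFlow_suspensionFlow (hP : IsPoissonLaw μ P) {T : ℝ → X → X} (hT : IsMPFlow T μ)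
    (hm : Measurable (Function.uncurry T)) : IsMPFlow (suspensionFlow T) P where
  zero := by
    funext ω
    simp [suspensionFlow, hT.zero]
  add s t := by
    funext ω
    simp only [suspensionFlow, hT.add, Function.comp_apply]
    rw [Measure.map_map (hT.measurePreserving s).measurable (hT.measurePreserving t).measurable]
  aemeasurable := aemeasurable_suspensionFlow hP hm
  measurePreserving t := measurePreserving_map_of_isPoissonLaw hP (hT.measurePreserving t)

end PoissonSuspension

/-! ### Simultaneous returns along the gaps -/

section Returns

open Filter Topology
open scoped symmDiff

/-- The digit sequence whose only nonzero digit is the digit `a` at the place `k`. -/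
def digSingle (k : ℕ) (a : Fin 3) : ℕ → Fin 3 := ⇑(Finsupp.single k a : Dig)

lemma digSingle_apply (k : ℕ) (a : Fin 3) (i : ℕ) : digSingle k a i = if k = i then a else 0 :=
  Finsupp.single_apply

lemma tendsto_digSingle (a : Fin 3) : Tendsto (fun k => digSingle k a) atTop (𝓝 0) := by
  rw [tendsto_pi_nhds]
  intro i
  refine tendsto_const_nhds.congr' ?_
  filter_upwards [eventually_gt_atTop i] with k hk
  rw [digSingle_apply, if_neg hk.ne', Pi.zero_apply]

/-- Small translations of the digit sequences move a set by little. -/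
lemma tendsto_digLaw_diff {B : Set (ℕ → Fin 3)} (hB : MeasurableSet B) (a : Fin 3) :
    Tendsto (fun k => digLaw (B \ (fun c => c + digSingle k a) ⁻¹' B)) atTop (𝓝 0) := by
  let F : C((ℕ → Fin 3) × (ℕ → Fin 3), ℕ → Fin 3) := ⟨fun p => p.2 + p.1, by fun_prop⟩
  have h1 : Tendsto (fun k => F.curry (digSingle k a)) atTop (𝓝 (F.curry 0)) :=
    (F.curry.continuous.tendsto 0).comp (tendsto_digSingle a)
  have h2 := tendsto_measure_symmDiff_preimage_nhds_zero (μ := digLaw) (ν := digLaw) h1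
    (Eventually.of_forall fun k => measurePreserving_add_digLaw (digSingle k a))
    (measurePreserving_add_digLaw 0) hB.nullMeasurableSet (measure_ne_top _ _)
  refine tendsto_of_tendsto_of_tendsto_of_le_of_le tendsto_const_nhds h2 (fun _ => zero_le)
    fun k => measure_mono fun c hc => Or.inr ⟨?_, hc.2⟩
  change c + 0 ∈ B
  rw [add_zero]
  exact hc.1

/-- For large `k`, many sequences in a set of positive measure have the `k`-th digit `0` and remain
in the set if this digit is changed. -/
lemma eventually_digLaw_ne_zero {B : Set (ℕ → Fin 3)} (hB : MeasurableSet B) (h0 : digLaw B ≠ 0) :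
    ∀ᶠ k in atTop, digLaw {c | c k = 0 ∧ ∀ a, c + digSingle k a ∈ B} ≠ 0 := by
  have h1 : Tendsto (fun k => ∑ a, digLaw (B \ (fun c => c + digSingle k a) ⁻¹' B)) atTop (𝓝 0) := by
    simpa using tendsto_finsetSum Finset.univ fun a _ => tendsto_digLaw_diff hB a
  filter_upwards [h1.eventually_lt_const (pos_iff_ne_zero.2 h0)] with k hk hzero
  set F : Set (ℕ → Fin 3) := {c | ∀ a, c + digSingle k a ∈ B} with hF
  -- the set `F` is invariant under changes of the `k`-th digit
  have hinv : ∀ (b : Fin 3) c, c + digSingle k b ∈ F ↔ c ∈ F := fun b c => by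
    have h2 : ∀ a b, digSingle k a + digSingle k b = digSingle k (a + b) := fun a b => by
      rw [digSingle, digSingle, digSingle, Finsupp.single_add, Finsupp.coe_add]
    simp only [hF, mem_ofPred_eq, add_assoc, h2]
    exact ⟨fun h a => by simpa using h (a - b), fun h a => h _⟩
  have hslice : ∀ b : Fin 3, digLaw (F ∩ {c | c k = b}) = 0 := fun b => by
    refine measure_mono_null ?_ (((measurePreserving_add_digLaw
      (digSingle k (-b))).quasiMeasurePreserving.preimage_null hzero))
    rintro c ⟨hc, rfl⟩
    refine ⟨?_, (hinv _ _).2 hc⟩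
    simp [digSingle_apply]
  have hF0 : digLaw F = 0 := by
    have h2 : F ⊆ ⋃ b, F ∩ {c | c k = b} := fun c hc => mem_iUnion.2 ⟨c k, hc, rfl⟩
    exact measure_mono_null h2 (measure_iUnion_null hslice)
  have h3 : digLaw B ≤ digLaw F + ∑ a, digLaw (B \ (fun c => c + digSingle k a) ⁻¹' B) := by
    refine (measure_mono fun c hc => ?_).trans ((measure_union_le F
      (⋃ a, B \ (fun c => c + digSingle k a) ⁻¹' B)).trans
      (add_le_add_right (measure_iUnion_fintype_le _ _) _))
    by_cases h : c ∈ F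
    · exact Or.inl h
    · simp only [hF, mem_ofPred_eq, not_forall] at h
      obtain ⟨a, ha⟩ := h
      exact Or.inr (mem_iUnion.2 ⟨a, hc, ha⟩)
  rw [hF0, zero_add] at h3
  exact absurd hk (not_lt.2 h3)

/-- Changing one digit from `0` to `a` moves a point by the offset `dig k a` along its orbit. -/
lemma retr_digSingle (k : ℕ) (a : Fin 3) {c : ℕ → Fin 3} (hc : c k = 0) (f : ℝ) :
    retr (c + digSingle k a, f) = retr (trans (dig k a) (c, f)) := by
  have h := retr_vadd (Finsupp.single k a) (trans (dig k a) (c, f))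
  rw [← h, vadd_def]
  congr 1
  refine Prod.ext rfl ?_
  have h2 := shift_eq (Finsupp.single k a) c {k} Finsupp.support_single_subset
  simp only [Finset.sum_singleton, Finsupp.single_eq_same, hc, zero_add] at h2
  simp only [trans, h2]
  simp [dig]

/-- A set of positive measure contains points which return to it at the times `gapA k` and
`gapA k + gapB k`, for some large `k`. -/
lemma exists_returns {C : Set Space} (hC : MeasurableSet C) (k₀ : ℕ)
    (h : ∀ k, k₀ ≤ k →
      mSpace (C ∩ flow (gapA k) ⁻¹' C ∩ flow (gapA k + gapB k) ⁻¹' C) = 0) : mSpace C = 0 := by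
  have h1 : ∀ᵐ x ∂mOm, ∀ k, k₀ ≤ k → ¬ (retr x ∈ C ∧ retr (trans (gapA k) x) ∈ C ∧
      retr (trans (gapA k + gapB k) x) ∈ C) := by
    refine ae_all_iff.2 fun k => ?_
    by_cases hk : k₀ ≤ k
    · have h2 := measure_eq_zero_iff_ae_notMem.1 (h k hk)
      filter_upwards [ae_retr h2] with x hx _ hx'
      refine hx ⟨⟨hx'.1, ?_⟩, ?_⟩
      · simpa only [mem_preimage, flow_retr] using hx'.2.1
      · simpa only [mem_preimage, flow_retr] using hx'.2.2
    · exact ae_of_all _ fun x hk' => absurd hk' hk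
  -- fix the position, and change the digit `k` from `0` to `1` and to `2`
  have h2 : ∀ᵐ q ∂((volume : Measure ℝ).prod digLaw), ∀ k, k₀ ≤ k → ¬ (retr q.swap ∈ C ∧
      retr (trans (gapA k) q.swap) ∈ C ∧ retr (trans (gapA k + gapB k) q.swap) ∈ C) :=
    (Measure.measurePreserving_swap (μ := (volume : Measure ℝ))
      (ν := digLaw)).quasiMeasurePreserving.ae h1
  have h3 := Measure.ae_ae_of_ae_prod h2
  have hC' : MeasurableSet (retr ⁻¹' C) := measurable_retr hC
  refine mSpace_eq_zero ?_
  rw [mOm, ← Measure.prod_swap, Measure.map_apply measurable_swap hC',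
    Measure.measure_prod_null (measurable_swap hC')]
  filter_upwards [h3] with f hf
  change digLaw (Prod.mk f ⁻¹' (Prod.swap ⁻¹' (retr ⁻¹' C))) = 0
  by_contra h0
  have hB : MeasurableSet {c : ℕ → Fin 3 | retr (c, f) ∈ C} :=
    measurable_prodMk_left (measurable_swap hC')
  obtain ⟨k, hk, hk0⟩ := ((eventually_digLaw_ne_zero hB h0).and (eventually_ge_atTop k₀)).exists
  refine hk (measure_eq_zero_iff_ae_notMem.2 ?_)
  filter_upwards [hf] with c hc hc'
  refine hc k hk0 ⟨?_, ?_, ?_⟩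
  · have := hc'.2 0
    rw [retr_digSingle k 0 hc'.1] at this
    simpa [dig, trans] using this
  · have := hc'.2 1
    rw [retr_digSingle k 1 hc'.1] at this
    simpa [dig] using this
  · have := hc'.2 2
    rw [retr_digSingle k 2 hc'.1] at this
    simpa [dig] using this

/-- Times which are comparable to `gapA k` but differ from it by a fixed ratio are eventually not
return times. -/
lemma eventually_flow_notMem_level_of_ratio (n : ℕ) {θ₁ θ₂ : ℝ} (h0 : 0 < θ₁) (h12 : θ₁ ≤ θ₂)
    (h : θ₂ < 1 ∨ 1 < θ₁) :
    ∀ᶠ k in atTop, ∀ u, θ₁ * gapA k ≤ u → u ≤ θ₂ * gapA k →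
      ∀ z ∈ level n, flow u z ∉ level n := by
  obtain ⟨δ, hδ, hδ'⟩ : ∃ δ > 0, θ₂ + δ ≤ 1 ∨ 1 + δ ≤ θ₁ := by
    rcases h with h | h
    · exact ⟨1 - θ₂, by linarith, Or.inl (by linarith)⟩
    · exact ⟨θ₁ - 1, by linarith, Or.inr (by linarith)⟩
  filter_upwards [eventually_ge_atTop n, eventually_natCast_ge (2 * θ₂ + 10),
    eventually_natCast_ge (10 / θ₁), eventually_natCast_ge (10 / δ)]
    with k hnk h1 h2 h3 u l1 l2 z hz huz
  have ha := gapA_eq k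
  have hb := gapB_eq k
  have p1 := hgt_pos k
  have p2 := gapA_pos k
  have p3 := gapB_pos k
  rw [div_le_iff₀ h0] at h2
  rw [div_le_iff₀ hδ] at h3
  have q1 : 10 * hgt k < θ₁ * gapA k := by
    rw [ha, ← mul_assoc]
    exact mul_lt_mul_of_pos_right (by linarith) p1
  have q2 : 10 * hgt k < δ * gapA k := by
    rw [ha, ← mul_assoc]
    exact mul_lt_mul_of_pos_right (by linarith) p1
  have q3 : (2 * θ₂ + 10) * gapA k < gapB k := by
    rw [hb]
    exact mul_lt_mul_of_pos_right (by linarith) p2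
  have q4 : 21 * gapB k ≤ hgt (k + 1) := gapB_le_hgt k
  have q5 : 21 * hgt (k + 1) ≤ gapA (k + 1) := hgt_le_gapA _
  have q6 : 21 * hgt k ≤ gapA k := hgt_le_gapA _
  have hu : 0 < u := by linarith
  have m1 := abs_sub_dig_le hnk hz huz (by rw [abs_of_pos hu]; linarith)
  rw [abs_le] at m1
  have r1 : u ≤ gapA k - δ * gapA k ∨ gapA k + δ * gapA k ≤ u := by
    rcases hδ' with h | h
    · left
      have := mul_le_mul_of_nonneg_right h p2.le
      linarith
    · right
      have := mul_le_mul_of_nonneg_right h p2.le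
      linarith
  have r2 : 2 * u + 10 * gapA k < gapB k := by linarith
  have r3 : 10 * hgt k < u := by linarith
  have key : ∀ p q : Fin 3, ¬ (-(3 * hgt k) ≤ u - (dig k p - dig k q) ∧
      u - (dig k p - dig k q) ≤ 3 * hgt k) := by
    rintro p q ⟨l1, l2⟩
    clear m1 hz huz ha hb h1 h2 h3 q1 q3 q4 q5 hδ'
    rcases dig_cases k p with hp | hp | hp <;> rcases dig_cases k q with hq | hq | hq <;>
      rw [hp, hq] at l1 l2 <;>
      first
      | linarith
      | (rcases r1 with r1 | r1 <;> linarith)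
  exact key _ _ m1

end Returns

/-! ### The fibered flow -/

section Fibered

open Filter Topology

instance : StandardBorelSpace {r : ℝ // 0 < r} := measurableSet_Ioi.standardBorel

variable (κ : Measure {r : ℝ // 0 < r})

/-- The phase space of the fibered flow. -/
abbrev Fib : Type := {r : ℝ // 0 < r} × ℝ × Space

/-- The invariant measure of the fibered flow. -/
abbrev fibMeas : Measure Fib := κ.prod ((volume : Measure ℝ).prod mSpace)

lemma measurable_fiberedFlow_uncurry : Measurable (Function.uncurry (fiberedFlow flow)) := by
  have h : Measurable fun q : ℝ × Fib => flow ((q.2.1 : ℝ) * q.1) q.2.2.2 :=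
    measurable_flow_uncurry.comp (((measurable_subtype_coe.comp measurable_snd.fst).mul
      measurable_fst).prodMk measurable_snd.snd.snd)
  exact measurable_snd.fst.prodMk (measurable_snd.snd.fst.prodMk h)

lemma fiberedFlow_add (s t : ℝ) :
    fiberedFlow flow (s + t) = fiberedFlow flow s ∘ fiberedFlow flow t := by
  funext p
  simp only [fiberedFlow, Function.comp_apply, flow_flow, mul_add]

lemma fiberedFlow_fiberedFlow (s t : ℝ) (x : Fib) :
    fiberedFlow flow s (fiberedFlow flow t x) = fiberedFlow flow (s + t) x :=
  (congrFun (fiberedFlow_add s t) x).symm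

lemma fiberedFlow_zero : fiberedFlow flow 0 = id := by
  funext p
  simp [fiberedFlow, flow_zero]

variable [IsProbabilityMeasure κ]

/-- A measure preserving map obtained by flowing for a time which depends on the first
coordinate. -/
lemma measurePreserving_fib {τ : {r : ℝ // 0 < r} → ℝ} (hτ : Measurable τ) :
    MeasurePreserving (fun x : Fib => (x.1, x.2.1, flow (τ x.1) x.2.2)) (fibMeas κ)
      (fibMeas κ) := by
  refine (MeasurePreserving.id κ).skew_product (g := fun s (p : ℝ × Space) => (p.1, flow (τ s) p.2)) ?_ ?_
  · exact measurable_snd.fst.prodMk (measurable_flow_uncurry.comp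
      ((hτ.comp measurable_fst).prodMk measurable_snd.snd))
  · exact ae_of_all _ fun s =>
      ((MeasurePreserving.id volume).prod (measurePreserving_flow (τ s))).map_eq

lemma measurePreserving_fiberedFlow (t : ℝ) :
    MeasurePreserving (fiberedFlow flow t) (fibMeas κ) (fibMeas κ) :=
  measurePreserving_fib κ (τ := fun s => (s : ℝ) * t) (measurable_subtype_coe.mul_const t)

lemma isMPFlow_fiberedFlow : IsMPFlow (fiberedFlow flow) (fibMeas κ) where
  zero := fiberedFlow_zero
  add := fiberedFlow_add
  aemeasurable := measurable_fiberedFlow_uncurry.aemeasurable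
  measurePreserving := measurePreserving_fiberedFlow κ

/-- The points of the phase space which lie over the `n`-th tower. -/
def fibLevel (n : ℕ) : Set Fib := {x | x.2.2 ∈ level n}

lemma measurableSet_fibLevel (n : ℕ) : MeasurableSet (fibLevel n) :=
  measurable_snd.snd (measurableSet_level n)

/-- Sets of finite measure return less and less to themselves along the heights of the towers. -/
lemma tendsto_fibMeas_inter {A : Set Fib} (hA : MeasurableSet A) (hμ : fibMeas κ A ≠ ∞) :
    Tendsto (fun k => fibMeas κ (A ∩ fiberedFlow flow (hgt (k + 1)) ⁻¹' A)) atTop (𝓝 0) := by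
  -- it suffices to consider the part of `A` in a fixed tower
  have h1 : Tendsto (fun n => fibMeas κ (A \ fibLevel n)) atTop (𝓝 0) := by
    have h2 : ⋂ n, A \ fibLevel n = ∅ := by
      rw [← sdiff_iUnion, sdiff_eq_empty]
      intro x _
      have : x.2.2 ∈ ⋃ n, level n := by rw [iUnion_level]; trivial
      simpa [fibLevel] using this
    have h3 := tendsto_measure_iInter_atTop (μ := fibMeas κ) (s := fun n => A \ fibLevel n)
      (fun n => (hA.diff (measurableSet_fibLevel n)).nullMeasurableSet)
      (fun m n hmn => sdiff_subset_sdiff_right fun x hx => level_mono hmn hx)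
      ⟨0, measure_ne_top_of_subset sdiff_subset hμ⟩
    rwa [h2, measure_empty] at h3
  have h2 : ∀ n, Tendsto (fun k => fibMeas κ ((A ∩ fibLevel n) ∩
      fiberedFlow flow (hgt (k + 1)) ⁻¹' (A ∩ fibLevel n))) atTop (𝓝 0) := fun n => by
    have hAn := hA.inter (measurableSet_fibLevel n)
    rw [← measure_empty (μ := fibMeas κ)]
    refine tendsto_measure_of_tendsto_indicator (B := A) atTop
      (fun k => hAn.inter ((measurePreserving_fiberedFlow κ _).measurable hAn)) hA hμ
      (Eventually.of_forall fun k => inter_subset_left.trans inter_subset_left) fun x => ?_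
    by_cases hx : x.2.2 ∈ level n
    · filter_upwards [eventually_flow_notMem_level n x.1.2.ne'] with k hk
      have h4 := hk (hgt (k + 1)) (by
        rw [abs_of_pos (hgt_pos _)]; linarith [hgt_pos (k + 1)])
        (abs_of_pos (hgt_pos _)).le x.2.2 hx
      simp only [mem_empty_iff_false, iff_false]
      exact fun h => h4 h.2.2
    · refine Eventually.of_forall fun k => ?_
      simp only [mem_empty_iff_false, iff_false]
      exact fun h => hx h.1.2
  rw [ENNReal.tendsto_nhds_zero]
  intro ε hε
  obtain ⟨n, hn⟩ := (ENNReal.tendsto_nhds_zero.1 h1 (ε / 3)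
    (ENNReal.div_pos hε.ne' (by simp))).exists
  filter_upwards [ENNReal.tendsto_nhds_zero.1 (h2 n) (ε / 3)
    (ENNReal.div_pos hε.ne' (by simp))] with k hk
  set T := fiberedFlow flow (hgt (k + 1))
  have hT : MeasurePreserving T (fibMeas κ) (fibMeas κ) := measurePreserving_fiberedFlow κ _
  have h5 : A ∩ T ⁻¹' A ⊆ ((A ∩ fibLevel n) ∩ T ⁻¹' (A ∩ fibLevel n)) ∪
      ((A \ fibLevel n) ∪ T ⁻¹' (A \ fibLevel n)) := by
    rintro x ⟨hx, hx'⟩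
    by_cases h6 : x ∈ fibLevel n
    · by_cases h7 : T x ∈ fibLevel n
      · exact Or.inl ⟨⟨hx, h6⟩, hx', h7⟩
      · exact Or.inr (Or.inr ⟨hx', h7⟩)
    · exact Or.inr (Or.inl ⟨hx, h6⟩)
  calc fibMeas κ (A ∩ T ⁻¹' A) ≤ _ := measure_mono h5
    _ ≤ _ := measure_union_le _ _
    _ ≤ ε / 3 + (ε / 3 + ε / 3) := by
      refine add_le_add hk ((measure_union_le _ _).trans (add_le_add hn ?_))
      rw [hT.measure_preimage (hA.diff (measurableSet_fibLevel n)).nullMeasurableSet]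
      exact hn
    _ = ε := by rw [← add_assoc, ENNReal.add_thirds]

end Fibered

/-! ### Conjugacies between rescalings of the fibered flow -/

section Conjugacy

open Filter Topology

variable (κ : Measure {r : ℝ // 0 < r}) [IsProbabilityMeasure κ]

/-- A set which does not return at the times `gapA k` and `gapA k + gapB k`, measured along the
fibres, is null. -/
lemma fibMeas_eq_zero_of_returns {A : Set Fib} (hA : MeasurableSet A) (k₀ : ℕ)
    (h : ∀ k, k₀ ≤ k → fibMeas κ {x : Fib | x ∈ A ∧ (x.1, x.2.1, flow (gapA k) x.2.2) ∈ A ∧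
      (x.1, x.2.1, flow (gapA k + gapB k) x.2.2) ∈ A} = 0) : fibMeas κ A = 0 := by
  have h1 : ∀ᵐ x ∂(fibMeas κ), ∀ k, k₀ ≤ k → ¬ (x ∈ A ∧ (x.1, x.2.1, flow (gapA k) x.2.2) ∈ A ∧
      (x.1, x.2.1, flow (gapA k + gapB k) x.2.2) ∈ A) := by
    refine ae_all_iff.2 fun k => ?_
    by_cases hk : k₀ ≤ k
    · filter_upwards [measure_eq_zero_iff_ae_notMem.1 (h k hk)] with x hx _ using hx
    · exact ae_of_all _ fun x hk' => absurd hk' hk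
  refine (Measure.measure_prod_null hA).2 ?_
  filter_upwards [Measure.ae_ae_of_ae_prod h1] with s hs
  have hAs : MeasurableSet (Prod.mk s ⁻¹' A) := measurable_prodMk_left hA
  refine (Measure.measure_prod_null hAs).2 ?_
  filter_upwards [Measure.ae_ae_of_ae_prod hs] with y hy
  refine exists_returns (measurable_prodMk_left hAs) k₀ fun k hk => ?_
  refine measure_eq_zero_iff_ae_notMem.2 ?_
  filter_upwards [hy] with z hz hz'
  exact hz k hk ⟨hz'.1.1, hz'.1.2, hz'.2⟩

variable {κ} {f : Fib → Fib} {c : ℝ}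

/-- An almost everywhere equivariant map is strictly equivariant along the orbits, between points of
a conull set. -/
lemma exists_strictly_equivariant (hf : MeasurePreserving f (fibMeas κ) (fibMeas κ))
    (heq : ∀ t, f ∘ fiberedFlow flow t =ᵐ[fibMeas κ] fiberedFlow flow (c * t) ∘ f) :
    ∃ G : Set Fib, (∀ᵐ x ∂(fibMeas κ), x ∈ G) ∧ ∀ x s, x ∈ G → fiberedFlow flow s x ∈ G →
      f (fiberedFlow flow s x) = fiberedFlow flow (c * s) (f x) := by
  have hm : MeasurableSet {p : ℝ × Fib |
      fiberedFlow flow (-(c * p.1)) (f (fiberedFlow flow p.1 p.2)) = f p.2} := by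
    refine measurableSet_eq_fun ?_ (hf.measurable.comp measurable_snd)
    exact measurable_fiberedFlow_uncurry.comp (((measurable_fst.const_mul c).neg).prodMk
      (hf.measurable.comp measurable_fiberedFlow_uncurry))
  have h1 : ∀ t : ℝ, ∀ᵐ x ∂(fibMeas κ),
      fiberedFlow flow (-(c * t)) (f (fiberedFlow flow t x)) = f x := fun t => by
    filter_upwards [heq t] with x hx
    simp only [Function.comp_apply] at hx
    rw [hx, fiberedFlow_fiberedFlow, neg_add_cancel, fiberedFlow_zero, id]
  refine ⟨{x | ∀ᵐ t : ℝ, fiberedFlow flow (-(c * t)) (f (fiberedFlow flow t x)) = f x},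
    (Measure.ae_ae_comm hm).1 (Eventually.of_forall h1), fun x s hx hs => ?_⟩
  -- compare both points with a common third point of the orbit at which both identities hold
  have h2 := (measurePreserving_add_right volume s).quasiMeasurePreserving.ae hx
  obtain ⟨t, ht, ht'⟩ := (h2.and hs).exists
  rw [fiberedFlow_fiberedFlow] at ht'
  rw [← ht, ← ht', fiberedFlow_fiberedFlow]
  congr 2
  ring

/-- Reparametrization of a fibre by its own time. -/
lemma fiberedFlow_div (u : ℝ) (x : Fib) :
    fiberedFlow flow (u / x.1) x = (x.1, x.2.1, flow u x.2.2) := by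
  rw [fiberedFlow, mul_div_cancel₀ _ x.1.2.ne']

/-- If `f` maps the orbits of `x` to orbits with a speed which differs from the natural one by a
factor bounded away from `1`, then the returns to a tower along the gaps lead to impossible
returns. -/
lemma fibMeas_speed_eq_zero (hf : MeasurePreserving f (fibMeas κ) (fibMeas κ))
    (heq : ∀ t, f ∘ fiberedFlow flow t =ᵐ[fibMeas κ] fiberedFlow flow (c * t) ∘ f)
    (n : ℕ) {S : Set ℝ} (hS : MeasurableSet S)
    (hret : ∀ᶠ k in atTop, ∀ θ ∈ S, ∀ z ∈ level n, flow (θ * gapA k) z ∈ level n →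
      flow (θ * (gapA k + gapB k)) z ∉ level n) :
    fibMeas κ {x | c * (f x).1 / x.1 ∈ S ∧ f x ∈ fibLevel n} = 0 := by
  set A : Set Fib := {x | c * (f x).1 / x.1 ∈ S ∧ f x ∈ fibLevel n} with hA
  have hAm : MeasurableSet A := by
    refine MeasurableSet.inter ?_ (hf.measurable (measurableSet_fibLevel n))
    exact (((measurable_subtype_coe.comp (measurable_fst.comp hf.measurable)).const_mul c).div
      (measurable_subtype_coe.comp measurable_fst)) hS
  obtain ⟨G, hG, hGf⟩ := exists_strictly_equivariant hf heq
  obtain ⟨k₀, hk₀⟩ := eventually_atTop.1 hret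
  refine fibMeas_eq_zero_of_returns κ hAm k₀ fun k hk => measure_eq_zero_iff_ae_notMem.2 ?_
  filter_upwards [hG, (measurePreserving_fib κ (τ := fun _ => gapA k)
    measurable_const).quasiMeasurePreserving.ae hG, (measurePreserving_fib κ
    (τ := fun _ => gapA k + gapB k) measurable_const).quasiMeasurePreserving.ae hG]
    with x hx1 hx2 hx3
  rintro ⟨h1, h2, h3⟩
  rw [← fiberedFlow_div] at hx2 hx3 h2 h3
  have e2 := hGf _ _ hx1 hx2
  have e3 := hGf _ _ hx1 hx3
  have h2' := h2.2
  have h3' := h3.2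
  rw [e2] at h2'
  rw [e3] at h3'
  -- time `u` along the fibre of `x` becomes time `θ * u` along the fibre of `f x`, where `θ` is the
  -- quotient of the speeds
  have hmul : ∀ u : ℝ, ((f x).1 : ℝ) * (c * (u / x.1)) = c * (f x).1 / x.1 * u := fun u => by
    ring
  simp only [fibLevel, mem_ofPred_eq, fiberedFlow, hmul] at h2' h3'
  exact hk₀ k hk _ h1.1 _ h1.2 h2' h3'

lemma ae_of_forall_fibLevel {p : Fib → Prop}
    (h : ∀ n, ∀ᵐ x ∂(fibMeas κ), f x ∈ fibLevel n → p x) : ∀ᵐ x ∂(fibMeas κ), p x := by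
  filter_upwards [ae_all_iff.2 h] with x hx
  have : (f x).2.2 ∈ ⋃ n, level n := by rw [iUnion_level]; trivial
  obtain ⟨n, hn⟩ := mem_iUnion.1 this
  exact hx n hn

/-- A conjugacy which rescales the time by `c` rescales the first coordinate by `c⁻¹`. -/
lemma ae_speed_eq (hf : MeasurePreserving f (fibMeas κ) (fibMeas κ))
    (heq : ∀ t, f ∘ fiberedFlow flow t =ᵐ[fibMeas κ] fiberedFlow flow (c * t) ∘ f) (hc : c ≠ 0) :
    ∀ᵐ x ∂(fibMeas κ), c * (f x).1 = x.1 := by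
  have hpos : ∀ x : Fib, (0 : ℝ) < x.1 := fun x => x.1.2
  refine ae_of_forall_fibLevel (f := f) fun n => ?_
  -- cover the speeds different from `1` by countably many compact intervals with rational endpoints
  rcases lt_or_gt_of_ne hc with hc | hc
  · have h1 : ∀ᵐ x ∂(fibMeas κ), ∀ a b : ℚ, (0 : ℝ) < a → (a : ℝ) ≤ b →
        ¬ (c * (f x).1 / x.1 ∈ Icc (-b : ℝ) (-a) ∧ f x ∈ fibLevel n) := by
      refine ae_all_iff.2 fun a => ae_all_iff.2 fun b => ?_
      by_cases ha : (0 : ℝ) < a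
      · by_cases hab : (a : ℝ) ≤ b
        · have := measure_eq_zero_iff_ae_notMem.1 (fibMeas_speed_eq_zero hf heq n
            (measurableSet_Icc (a := (-b : ℝ)) (b := -a)) (by
              filter_upwards [eventually_not_reversed n ha hab] with k hk θ hθ z hz hz1 hz2
              have p1 := gapA_pos k
              have p2 := add_pos (gapA_pos k) (gapB_pos k)
              refine hk (-θ * gapA k) (-θ * (gapA k + gapB k)) ?_ ?_ ?_ ?_ z hz ?_ ?_
              · exact mul_le_mul_of_nonneg_right (by linarith [hθ.2]) p1.le
              · exact mul_le_mul_of_nonneg_right (by linarith [hθ.1]) p1.le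
              · exact mul_le_mul_of_nonneg_right (by linarith [hθ.2]) p2.le
              · exact mul_le_mul_of_nonneg_right (by linarith [hθ.1]) p2.le
              · rwa [neg_mul, neg_neg]
              · rwa [neg_mul, neg_neg]))
          filter_upwards [this] with x hx _ _ using hx
        · exact ae_of_all _ fun x _ h => absurd h hab
      · exact ae_of_all _ fun x h => absurd h ha
    filter_upwards [h1] with x hx hxn
    have h2 : 0 < -(c * (f x).1 / x.1) := by
      rw [← neg_div, ← neg_mul]
      exact div_pos (mul_pos (neg_pos.2 hc) (hpos _)) (hpos _)
    obtain ⟨a, ha, ha'⟩ := exists_rat_btwn h2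
    obtain ⟨b, hb, hb'⟩ := exists_rat_btwn (lt_add_one (-(c * (f x).1 / x.1)))
    exact absurd ⟨⟨by linarith, by linarith⟩, hxn⟩ (hx a b ha (by linarith))
  · have h1 : ∀ᵐ x ∂(fibMeas κ), ∀ a b : ℚ, (0 : ℝ) < a → (a : ℝ) ≤ b → ((b : ℝ) < 1 ∨ (1 : ℝ) < a) →
        ¬ (c * (f x).1 / x.1 ∈ Icc (a : ℝ) b ∧ f x ∈ fibLevel n) := by
      refine ae_all_iff.2 fun a => ae_all_iff.2 fun b => ?_
      by_cases ha : (0 : ℝ) < a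
      · by_cases hab : (a : ℝ) ≤ b
        · by_cases h1 : (b : ℝ) < 1 ∨ (1 : ℝ) < a
          · have := measure_eq_zero_iff_ae_notMem.1 (fibMeas_speed_eq_zero hf heq n
              (measurableSet_Icc (a := (a : ℝ)) (b := b)) (by
                filter_upwards [eventually_flow_notMem_level_of_ratio n ha hab h1]
                  with k hk θ hθ z hz hz1
                have p1 := gapA_pos k
                exact absurd hz1 (hk _ (mul_le_mul_of_nonneg_right hθ.1 p1.le)
                  (mul_le_mul_of_nonneg_right hθ.2 p1.le) z hz)))
            filter_upwards [this] with x hx _ _ _ using hx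
          · exact ae_of_all _ fun x _ _ h => absurd h h1
        · exact ae_of_all _ fun x _ h => absurd h hab
      · exact ae_of_all _ fun x h => absurd h ha
    filter_upwards [h1] with x hx hxn
    have h2 : 0 < c * (f x).1 / x.1 := div_pos (mul_pos hc (hpos _)) (hpos _)
    have h3 : c * (f x).1 / x.1 = 1 := by
      by_contra h4
      rcases lt_or_gt_of_ne h4 with h4 | h4
      · obtain ⟨a, ha, ha'⟩ := exists_rat_btwn h2
        obtain ⟨b, hb, hb'⟩ := exists_rat_btwn h4
        exact hx a b ha (by linarith) (Or.inl hb') ⟨⟨ha'.le, hb.le⟩, hxn⟩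
      · obtain ⟨a, ha, ha'⟩ := exists_rat_btwn h4
        obtain ⟨b, hb, hb'⟩ := exists_rat_btwn (lt_add_one (c * (f x).1 / x.1))
        exact hx a b (by linarith) (by linarith) (Or.inr ha) ⟨⟨ha'.le, hb.le⟩, hxn⟩
    rwa [div_eq_one_iff_eq (hpos x).ne'] at h3

variable (κ) in
lemma fibMeas_fst_preimage_eq_zero_iff (N : Set {r : ℝ // 0 < r}) :
    fibMeas κ (Prod.fst ⁻¹' N) = 0 ↔ κ N = 0 := by
  have h1 : ((volume : Measure ℝ).prod mSpace) univ ≠ 0 := by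
    rw [← univ_prod_univ, Measure.prod_prod, mSpace_univ]
    simp
  rw [← prod_univ, Measure.prod_prod, mul_eq_zero, or_iff_left h1]

variable (κ) in
/-- By `ae_speed_eq`, a conjugacy acts on the first coordinate as multiplication by a constant. -/
lemma selfSimilarities_subset :
    selfSimilarities (fiberedFlow flow) (fibMeas κ) ⊆ Subtype.val '' quasiInvarianceGroup κ := by
  rintro s ⟨hs, f, g, hf, -, -, -, hfT⟩
  have heq : ∀ t, f ∘ fiberedFlow flow t =ᵐ[fibMeas κ] fiberedFlow flow (s⁻¹ * t) ∘ f := fun t => by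
    have := hfT (s⁻¹ * t)
    rwa [rescaledFlow, mul_inv_cancel_left₀ hs] at this
  have h1 : ∀ᵐ x ∂(fibMeas κ), ((f x).1 : ℝ) = s * x.1 := by
    filter_upwards [ae_speed_eq hf heq (inv_ne_zero hs)] with x hx
    rw [← hx, mul_inv_cancel_left₀ hs]
  have hne : fibMeas κ ≠ 0 := fun h => by
    have := (fibMeas_fst_preimage_eq_zero_iff κ univ).1 (by rw [h]; rfl)
    simp at this
  have : (ae (fibMeas κ)).NeBot := ae_neBot.2 hne
  obtain ⟨x, hx⟩ := h1.exists
  have hs0 : 0 < s := by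
    have h2 : (0 : ℝ) < s * x.1 := hx ▸ (f x).1.2
    exact (mul_pos_iff_of_pos_right x.1.2).1 h2
  have hmul : Measurable fun a : {r : ℝ // 0 < r} => (⟨s, hs0⟩ : {r : ℝ // 0 < r}) * a :=
    (measurable_subtype_coe.const_mul s).subtype_mk
  have key : ∀ N : Set {r : ℝ // 0 < r}, MeasurableSet N →
      (κ.map (fun a => (⟨s, hs0⟩ : {r : ℝ // 0 < r}) * a) N = 0 ↔ κ N = 0) := fun N hN => by
    rw [Measure.map_apply hmul hN, ← fibMeas_fst_preimage_eq_zero_iff,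
      ← fibMeas_fst_preimage_eq_zero_iff κ N,
      ← hf.measure_preimage (measurable_fst hN).nullMeasurableSet]
    have h2 : (Prod.fst ⁻¹' ((fun a => (⟨s, hs0⟩ : {r : ℝ // 0 < r}) * a) ⁻¹' N) : Set Fib)
        =ᵐ[fibMeas κ] f ⁻¹' (Prod.fst ⁻¹' N) := by
      refine eventuallyEq_set.2 ?_
      filter_upwards [h1] with x hx
      have h3 : (⟨s, hs0⟩ : {r : ℝ // 0 < r}) * x.1 = (f x).1 := Subtype.ext hx.symm
      simp only [mem_preimage, h3]
    rw [measure_congr h2]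
  exact ⟨⟨s, hs0⟩, ⟨Measure.AbsolutelyContinuous.mk fun N hN h => (key N hN).2 h,
    Measure.AbsolutelyContinuous.mk fun N hN h => (key N hN).1 h⟩, rfl⟩

end Conjugacy

/-! ### Self-similarities from quasi-invariance -/

section QuasiInvariance

open Filter Topology

variable {κ : Measure {r : ℝ // 0 < r}} [IsProbabilityMeasure κ]

/-- Stretching the second coordinate compensates a density in the first one. -/
lemma measurePreserving_stretch {κ' : Measure {r : ℝ // 0 < r}} [IsProbabilityMeasure κ']
    (h : κ' ≪ κ) (h' : κ ≪ κ') :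
    MeasurePreserving (fun x : Fib => (x.1, x.2.1 * (κ'.rnDeriv κ x.1).toReal, x.2.2))
      (fibMeas κ') (fibMeas κ) := by
  set W := κ'.rnDeriv κ with hW
  have hWm : Measurable W := Measure.measurable_rnDeriv _ _
  have hm : Measurable fun x : Fib => (x.1, x.2.1 * (W x.1).toReal, x.2.2) :=
    measurable_fst.prodMk ((measurable_snd.fst.mul
      (hWm.ennreal_toReal.comp measurable_fst)).prodMk measurable_snd.snd)
  refine ⟨hm, Measure.ext fun E hE => ?_⟩
  rw [Measure.map_apply hm hE, fibMeas, Measure.prod_apply (hm hE), fibMeas, Measure.prod_apply hE]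
  have hκ' : κ.withDensity W = κ' := Measure.withDensity_rnDeriv_eq _ _ h
  conv_lhs => rw [← hκ']
  rw [lintegral_withDensity_eq_lintegral_mul _ hWm (measurable_measure_prodMk_left (hm hE))]
  refine lintegral_congr_ae ?_
  filter_upwards [h' (Measure.rnDeriv_pos h), Measure.rnDeriv_lt_top κ' κ] with s hs hs'
  set w := (W s).toReal with hw
  have hw0 : 0 < w := ENNReal.toReal_pos hs.ne' hs'.ne
  have hEs : MeasurableSet (Prod.mk s ⁻¹' E) := measurable_prodMk_left hE
  have hmw : Measurable fun y : ℝ => y * w := measurable_id.mul_const w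
  have h1 : ((volume : Measure ℝ).prod mSpace).map (Prod.map (fun y => y * w) id) =
      ENNReal.ofReal w⁻¹ • (volume : Measure ℝ).prod mSpace := by
    rw [← Measure.map_prod_map _ _ hmw measurable_id, Measure.map_id,
      Real.map_volume_mul_right hw0.ne', abs_of_pos (inv_pos.2 hw0), Measure.prod_smul_left]
  have h2 := congrArg (fun ρ : Measure (ℝ × Space) => ρ (Prod.mk s ⁻¹' E)) h1
  rw [Measure.map_apply (hmw.prodMap measurable_id) hEs] at h2
  change W s * ((volume : Measure ℝ).prod mSpace)
    (Prod.map (fun y => y * w) id ⁻¹' (Prod.mk s ⁻¹' E)) = _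
  have hWs : W s = ENNReal.ofReal w := (ENNReal.ofReal_toReal hs'.ne).symm
  rw [h2, Measure.smul_apply, smul_eq_mul, ← mul_assoc, hWs, ← ENNReal.ofReal_mul hw0.le, mul_inv_cancel₀ hw0.ne', ENNReal.ofReal_one, one_mul]

/-- The conjugacy multiplies the first coordinate by `h` and stretches the second one by the density
of the image of `κ`. -/
lemma subset_selfSimilarities :
    Subtype.val '' quasiInvarianceGroup κ ⊆ selfSimilarities (fiberedFlow flow) (fibMeas κ) := by
  rintro _ ⟨h, ⟨h1, h2⟩, rfl⟩
  have hh : (0 : ℝ) < h := h.2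
  have hmul : Measurable fun a : {r : ℝ // 0 < r} => h * a :=
    (measurable_subtype_coe.const_mul (h : ℝ)).subtype_mk
  set κ' := κ.map fun a => h * a with hκ'
  have : IsProbabilityMeasure κ' := Measure.isProbabilityMeasure_map hmul.aemeasurable
  set W := κ'.rnDeriv κ with hW
  have hWm : Measurable W := Measure.measurable_rnDeriv _ _
  set w : {r : ℝ // 0 < r} → ℝ := fun s => (W s).toReal with hw
  have hwm : Measurable w := hWm.ennreal_toReal
  have hw0 : ∀ᵐ s ∂κ, w s ≠ 0 := by
    filter_upwards [h2 (Measure.rnDeriv_pos h1), Measure.rnDeriv_lt_top κ' κ] with s hs hs'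
    exact (ENNReal.toReal_pos hs.ne' hs'.ne).ne'
  have hw0' : ∀ᵐ s ∂κ, w (h * s) ≠ 0 := ae_of_ae_map hmul.aemeasurable (h1 hw0)
  set hi : {r : ℝ // 0 < r} := ⟨(h : ℝ)⁻¹, inv_pos.2 hh⟩ with hhi
  have hhi1 : ∀ a, hi * (h * a) = a := fun a => Subtype.ext (inv_mul_cancel_left₀ hh.ne' _)
  have hhi2 : ∀ a, h * (hi * a) = a := fun a => Subtype.ext (mul_inv_cancel_left₀ hh.ne' _)
  have himul : Measurable fun a : {r : ℝ // 0 < r} => hi * a :=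
    (measurable_subtype_coe.const_mul (hi : ℝ)).subtype_mk
  -- `g` inverts `f` where the density does not vanish
  set f : Fib → Fib := fun x => (h * x.1, x.2.1 * w (h * x.1), x.2.2) with hf
  set g : Fib → Fib := fun x => (hi * x.1, x.2.1 / w x.1, x.2.2) with hg
  have hgm : Measurable g := (himul.comp measurable_fst).prodMk
    ((measurable_snd.fst.div (hwm.comp measurable_fst)).prodMk measurable_snd.snd)
  have hfm : MeasurePreserving f (fibMeas κ) (fibMeas κ) := by
    have e1 : MeasurePreserving (fun a => h * a) κ κ' := ⟨hmul, rfl⟩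
    exact (measurePreserving_stretch h1 h2).comp
      (e1.prod (MeasurePreserving.id ((volume : Measure ℝ).prod mSpace)))
  have hgf : g ∘ f =ᵐ[fibMeas κ] id := by
    filter_upwards [Measure.quasiMeasurePreserving_fst.ae hw0'] with x hx
    simp only [hf, hg, Function.comp_apply, hhi1, id, mul_div_cancel_right₀ _ hx]
  have hfg : f ∘ g =ᵐ[fibMeas κ] id := by
    filter_upwards [Measure.quasiMeasurePreserving_fst.ae hw0] with x hx
    simp only [hf, hg, Function.comp_apply, hhi2, id, div_mul_cancel₀ _ hx]
  refine ⟨hh.ne', f, g, hfm, ⟨hgm, ?_⟩, hgf, hfg, fun t => ae_of_all _ fun x => ?_⟩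
  · conv_lhs => rw [← hfm.map_eq]
    rw [Measure.map_map hgm hfm.measurable, Measure.map_congr hgf, Measure.map_id]
  · simp only [hf, Function.comp_apply, rescaledFlow, fiberedFlow]
    refine Prod.ext rfl (Prod.ext rfl ?_)
    simp only [Positive.val_mul]
    congr 1
    ring

end QuasiInvariance

end

end RankOneFlow

open RankOneFlow in
theorem theorem0p2 (κ : Measure {r : ℝ // 0 < r}) (hκ : IsProbabilityMeasure κ) :
    ∃ (Z : Type) (_ : MeasurableSpace Z) (_ : StandardBorelSpace Z) (ν : Measure Z)
      (V : ℝ → Z → Z) (σ : Measure ℝ),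
      -- `V` is an ergodic conservative flow on an infinite σ-finite standard measure space
      SigmaFinite ν ∧ ν univ = ∞ ∧ Measurable (Function.uncurry V) ∧ IsMPFlow V ν ∧
      IsErgodicFlow V ν ∧ IsConservativeFlow V ν ∧
      -- whose maximal spectral type has mutually singular rescalings,
      IsMaximalSpectralType V ν σ ∧
      (∀ s s' : ℝ, 0 < s → 0 < s' → s ≠ s' →
        (σ.map (fun x => x * s)).MutuallySingular (σ.map (fun x => x * s'))) ∧
      -- and the Poisson suspension of `T_t(s, y, z) = (s, y, V_{st} z)` is as required.
      IsMPFlow (fiberedFlow V) (κ.prod ((volume : Measure ℝ).prod ν)) ∧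
      ∃ P : Measure (Measure ({r : ℝ // 0 < r} × ℝ × Z)),
        IsPoissonLaw (κ.prod ((volume : Measure ℝ).prod ν)) P ∧
        IsMPFlow (suspensionFlow (fiberedFlow V)) P ∧
        IsWeaklyMixingFlow (suspensionFlow (fiberedFlow V)) P ∧
        poissonianSelfSimilarities (fiberedFlow V) (κ.prod ((volume : Measure ℝ).prod ν)) =
          Subtype.val '' quasiInvarianceGroup κ := by
  have hne : Nonempty Fib := ⟨⟨1, one_pos⟩, 0, retr (0, 0)⟩
  have hP := isPoissonLaw_poissonLaw (fibMeas κ)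
  exact ⟨Space, inferInstance, inferInstance, mSpace, flow, sigma, inferInstance, mSpace_univ,
    measurable_flow_uncurry, isMPFlow_flow, isErgodicFlow_flow, isConservativeFlow_flow,
    isMaximalSpectralType_sigma, fun s s' hs hs' hss' => mutuallySingular_sigma hs hs' hss',
    isMPFlow_fiberedFlow κ, poissonLaw (fibMeas κ), hP,
    isMPFlow_suspensionFlow hP (isMPFlow_fiberedFlow κ) measurable_fiberedFlow_uncurry,
    isWeaklyMixingFlow_suspensionFlow hP (measurePreserving_fiberedFlow κ) (fun k => hgt (k + 1))
      fun A hA hμ => tendsto_fibMeas_inter κ hA hμ,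
    (selfSimilarities_subset κ).antisymm subset_selfSimilarities⟩
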